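/- Let $\mathcal O_2$ be the ring of germs at $0$ of holomorphic functions on $\mathbb C^2$. For a holomorphic germ $f:(\mathbb C^2,0)\to(\mathbb C,0)$ let $\mathcal I(f)\subset\mathbb N$ be the set of all finite orders $\operatorname{ord}(f\circ\alpha)$, where $\alpha:(\mathbb C,0)\to(\mathbb C^2,0)$ runs over the germs of holomorphic immersions. For a holomorphic germ $\gamma:(\mathbb C,0)\to(\mathbb C^2,0)$ let $\mathcal I(\gamma)\subset\mathbb N$ be the set of all finite orders $\operatorname{ord}(h\circ\gamma)$, where $h:(\mathbb C^2,0)\to(\mathbb C,0)$ runs over the germs of holomorphic submersions. Two germs $\gamma_1,\gamma_2$ are $\mathcal A$-equivalent if $\gamma_2=\psi\circ\gamma_1\circ\phi^{-1}$ for germs of biholomorphisms $\phi,\psi$ fixing the origins; $f_1,f_2$ are $\mathcal K$-equivalent if $f_2=A\cdot(f_1\circ\phi^{-1})$ for such a $\phi$ and a unit $A\in\mathcal O_2$. Write $\operatorname{mult}(f)$ for the degree of the lowest nonzero homogeneous part $F$ of the Taylor series of $f\neq 0$; the tangent cone of $f$ is $\{F=0\}$. A germ is reduced if it has no repeated factors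 in $\mathcal O_2$, and it is singular if its differential at $0$ vanishes. A parametrisation of the curve $f=0$ is a holomorphic germ $\gamma:(\mathbb C,0)\to(\mathbb C^2,0)$ that is injective near $0$ and whose image germ is the germ of $\{f=0\}$. If $f$ is irreducible, a parametrisation of $f=0$ is $\mathcal A$-equivalent to some $(t^m,y(t))$ with $\operatorname{ord}(y)>m\ge 1$, and the first Puiseux exponent $\beta(f)$ is the lowest exponent not divisible by $m$ that occurs in $y$ ($\beta(f)=\infty$ if there is none). **Theorem.** (1) If $\gamma_1,\gamma_2$ are $\mathcal A$-equivalent, then $\mathcal I(\gamma_1)=\mathcal I(\gamma_2)$. If $f_1,f_2$ are $\mathcal K$-equivalent, then $\mathcal I(f_1)=\mathcal I(f_2)$. (2) If $f$ is reduced and $\gamma$ is a parametrisation of the curve $f=0$, then $\mathcal I(\gamma)=\mathcal I(f)$. (3) If $f$ is irreducible and singular, with $m=\operatorname{mult}(f)$ and $\beta=\beta(f)$, then $\beta<\infty$ and $$\mathcal I(f)=\{km : 1\le k<\beta/m\}\cup\{\beta\}.$$ In particular $\mathcal I(f)=\{m,\beta\}$ if and only if $\beta<2m$, and $\mathcal I(f)$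 has exactly two elements if and only if $\beta<2m$. In that case, for an immersion germ $\alpha$, $\operatorname{ord}(f\circ\alpha)=m$ if $\alpha'(0)$ is not in the tangent cone of $f$, and $\operatorname{ord}(f\circ\alpha)=\beta$ if it is. (4) If $f$ and $g$ are irreducible and their tangent cones meet only in $0$, then $$\mathcal I(fg)=\bigl(\operatorname{mult}(f)+\mathcal I(g)\bigr)\cup\bigl(\operatorname{mult}(g)+\mathcal I(f)\bigr).$$ (5) If $f_1,\dots,f_k$ are irreducible, then $$\mathcal I(f_1\cdots f_k)\subset \mathcal I(f_1)+\cdots+\mathcal I(f_k)=\Bigl\{\sum_i a_i : a_i\in\mathcal I(f_i)\Bigr\}.$$ In particular, if the $f_i$ are irreducible and singular, then $\mathcal I(f_1\cdots f_k)$ is finite. (6) If $f$ is reduced, then $\mathcal I(f)$ is unbounded if and only if $f=0$ has a smooth component, that is, $f$ has an irreducible factor with nonzero differential at $0$. (7) Let $f$ be reduced with decomposition $f=\prod_{j=1}^k\prod_{i=1}^{r_j}f_{ij}$ into irreducible factors, where for each $j$ all the $f_{ij}$ have the same tangent cone $L_j$, and the lines $L_j$ are pairwise distinct. Put $m_{ij}=\operatorname{mult}(f_{ij})$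 and assume $\beta(f_{ij})<2m_{ij}$ for all $i,j$. With $M_j=\sum_i m_{ij}$, $\beta_j=\sum_i\beta(f_{ij})$ and $M=\sum_{j=1}^k M_j$, $$\mathcal I(f)=\{M,\;M-M_1+\beta_1,\;\dots,\;M-M_k+\beta_k\}.$$ -/

import Mathlib

open Filter Topology

/-! Germs at the origin are represented by functions that are analytic at `0`; every notion below
depends only on the germ of the function at `0`. The plane is `ℂ × ℂ`. -/

namespace PlaneGerm

noncomputable section

/-- `f` represents a holomorphic map-germ `(E, 0) → (F, 0)`. -/
def IsMapGerm {E F : Type*} [NormedAddCommGroup E] [NormedSpace ℂ E]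
    [NormedAddCommGroup F] [NormedSpace ℂ F] (f : E → F) : Prop :=
  AnalyticAt ℂ f 0 ∧ f 0 = 0

/-- `φ` represents a germ of a biholomorphic map `(E, 0) → (E, 0)`: it has an inverse germ. -/
def IsDiffeoGerm {E : Type*} [NormedAddCommGroup E] [NormedSpace ℂ E] (φ : E → E) : Prop :=
  IsMapGerm φ ∧ ∃ χ : E → E, IsMapGerm χ ∧ χ ∘ φ =ᶠ[𝓝 0] id ∧ φ ∘ χ =ᶠ[𝓝 0] id

/-- `𝒜`-equivalence of parametrised plane curve germs: `γ₂ = ψ ∘ γ₁ ∘ φ⁻¹`. -/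
def AEquiv (γ₁ γ₂ : ℂ → ℂ × ℂ) : Prop :=
  ∃ (φ : ℂ → ℂ) (ψ : ℂ × ℂ → ℂ × ℂ), IsDiffeoGerm φ ∧ IsDiffeoGerm ψ ∧
    γ₂ ∘ φ =ᶠ[𝓝 0] ψ ∘ γ₁

/-- `𝒦`-equivalence of function germs on the plane: `f₂ = A · (f₁ ∘ φ⁻¹)` with `A` a unit
(here `φ` stands for the inverse diffeomorphism). -/
def KEquiv (f₁ f₂ : ℂ × ℂ → ℂ) : Prop :=
  ∃ (φ : ℂ × ℂ → ℂ × ℂ) (A : ℂ × ℂ → ℂ), IsDiffeoGerm φ ∧ AnalyticAt ℂ A 0 ∧ A 0 ≠ 0 ∧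
    f₂ =ᶠ[𝓝 0] fun p => A p * f₁ (φ p)

/-- A germ of an immersion `(ℂ, 0) → (ℂ², 0)`. -/
def IsImmersionGerm (α : ℂ → ℂ × ℂ) : Prop :=
  IsMapGerm α ∧ deriv α 0 ≠ 0

/-- A germ of a submersion `(ℂ², 0) → (ℂ, 0)`. -/
def IsSubmersionGerm (h : ℂ × ℂ → ℂ) : Prop :=
  IsMapGerm h ∧ fderiv ℂ h 0 ≠ 0

/-- `𝓘(γ)`: the natural numbers that occur as the order of `h ∘ γ`, for `h` a submersion germ. -/
def paramContactOrders (γ : ℂ → ℂ × ℂ) : Set ℕ :=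
  {n | ∃ h : ℂ × ℂ → ℂ, IsSubmersionGerm h ∧ analyticOrderAt (h ∘ γ) 0 = (n : ℕ∞)}

/-- `𝓘(f)`: the natural numbers that occur as the order of `f ∘ α`, for `α` an immersion germ. -/
def contactOrders (f : ℂ × ℂ → ℂ) : Set ℕ :=
  {n | ∃ α : ℂ → ℂ × ℂ, IsImmersionGerm α ∧ analyticOrderAt (f ∘ α) 0 = (n : ℕ∞)}

/-- The ring `𝒪₂` of germs at the origin of holomorphic functions of two variables. -/
def holoGerms : Subring ((𝓝 (0 : ℂ × ℂ)).Germ ℂ) where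
  carrier := {g | ∃ f : ℂ × ℂ → ℂ, AnalyticAt ℂ f 0 ∧ (f : (𝓝 (0 : ℂ × ℂ)).Germ ℂ) = g}
  mul_mem' := by
    rintro _ _ ⟨f, hf, rfl⟩ ⟨g, hg, rfl⟩
    exact ⟨f * g, hf.mul hg, rfl⟩
  one_mem' := ⟨1, analyticAt_const, rfl⟩
  add_mem' := by
    rintro _ _ ⟨f, hf, rfl⟩ ⟨g, hg, rfl⟩
    exact ⟨f + g, hf.add hg, rfl⟩
  zero_mem' := ⟨0, analyticAt_const, rfl⟩
  neg_mem' := by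
    rintro _ ⟨f, hf, rfl⟩
    exact ⟨-f, hf.neg, rfl⟩

/-- The element of `𝒪₂` represented by `f`. -/
def germOf (f : ℂ × ℂ → ℂ) (hf : AnalyticAt ℂ f 0) : holoGerms :=
  ⟨(f : (𝓝 (0 : ℂ × ℂ)).Germ ℂ), f, hf, rfl⟩

/-- `f` is holomorphic at `0` and its germ is an irreducible element of `𝒪₂`
(in particular `f 0 = 0`, and `f` is not the zero germ). -/
def IsIrreducibleGerm (f : ℂ × ℂ → ℂ) : Prop :=
  ∃ hf : AnalyticAt ℂ f 0, Irreducible (germOf f hf)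

/-- `f` represents a germ `(ℂ², 0) → (ℂ, 0)` without repeated factors (a `𝒦`-finite germ). -/
def IsReducedGerm (f : ℂ × ℂ → ℂ) : Prop :=
  f 0 = 0 ∧ ∃ hf : AnalyticAt ℂ f 0, Squarefree (germOf f hf)

/-- The curve `f = 0` has a smooth component: an irreducible factor of `f` in `𝒪₂` has nonzero
differential at the origin. -/
def HasSmoothComponent (f : ℂ × ℂ → ℂ) : Prop :=
  ∃ (hf : AnalyticAt ℂ f 0) (g : ℂ × ℂ → ℂ) (hg : AnalyticAt ℂ g 0),
    Irreducible (germOf g hg) ∧ germOf g hg ∣ germOf f hf ∧ fderiv ℂ g 0 ≠ 0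

/-- The multiplicity of a (nonzero) germ: the degree of the lowest nonzero homogeneous part of
its Taylor series at the origin. -/
def mult (f : ℂ × ℂ → ℂ) : ℕ :=
  sInf {r : ℕ | iteratedFDeriv ℂ r f 0 ≠ 0}

/-- The lowest nonzero homogeneous part of the Taylor series at the origin. -/
def initialForm (f : ℂ × ℂ → ℂ) (v : ℂ × ℂ) : ℂ :=
  ((mult f).factorial : ℂ)⁻¹ * iteratedFDeriv ℂ (mult f) f 0 (fun _ => v)

/-- The tangent cone of `f = 0`: the zero set of the initial form. -/
def tangentCone (f : ℂ × ℂ → ℂ) : Set (ℂ × ℂ) :=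
  {v | initialForm f v = 0}

/-- `γ` and `f` define the same curve germ: for all small neighbourhoods `U` of `0 ∈ ℂ`, the sets
`γ(U)` and `f = 0` coincide near the origin. -/
def SameCurve (γ : ℂ → ℂ × ℂ) (f : ℂ × ℂ → ℂ) : Prop :=
  ∃ U₀ ∈ 𝓝 (0 : ℂ), ∀ U ∈ 𝓝 (0 : ℂ), U ⊆ U₀ →
    ∀ᶠ p in 𝓝 (0 : ℂ × ℂ), f p = 0 ↔ p ∈ γ '' U

/-- `γ` is a parametrisation of the curve `f = 0`: a holomorphic germ, injective near `0`
(hence an immersion away from `0`), that defines the same curve as `f`. -/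
def IsParametrisation (γ : ℂ → ℂ × ℂ) (f : ℂ × ℂ → ℂ) : Prop :=
  IsMapGerm γ ∧ (∃ U ∈ 𝓝 (0 : ℂ), Set.InjOn γ U) ∧ SameCurve γ f

/-- The lowest exponent not divisible by `m` in the power series of `y` at `0`
(`⊤` if there is none). -/
def lowestNonMultiple (m : ℕ) (y : ℂ → ℂ) : ℕ∞ :=
  ⨅ (k : ℕ) (_ : ¬ m ∣ k ∧ iteratedDeriv k y 0 ≠ 0), (k : ℕ∞)

/-- `(t ^ m, y t)` with `ord y > m` is a normal form of `γ` up to `𝒜`-equivalence. -/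
def IsNormalForm (γ : ℂ → ℂ × ℂ) (m : ℕ) (y : ℂ → ℂ) : Prop :=
  0 < m ∧ IsMapGerm y ∧ (m : ℕ∞) < analyticOrderAt y 0 ∧ AEquiv γ (fun t => (t ^ m, y t))

/-- The first Puiseux exponent of `γ`, read off a normal form `(t ^ m, y t)`. All normal forms of
`γ` give the same value, so the infimum is that value; it is `⊤` for a regular `γ`. -/
def paramPuiseux (γ : ℂ → ℂ × ℂ) : ℕ∞ :=
  ⨅ (m : ℕ) (y : ℂ → ℂ) (_ : IsNormalForm γ m y), lowestNonMultiple m y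

/-- The first Puiseux exponent `β(f)` of an irreducible germ `f`: that of a parametrisation of
`f = 0`. All parametrisations give the same value, so the infimum is that value. -/
def puiseux (f : ℂ × ℂ → ℂ) : ℕ∞ :=
  ⨅ (γ : ℂ → ℂ × ℂ) (_ : IsParametrisation γ f), paramPuiseux γ

end

end PlaneGerm

/-! For an irreducible germ, choose linear coordinates `(x, w)` whose `w`-axis is not in the tangent
cone. Puiseux's theorem gives a root `w = y (x ^ (1 / n))`. With `n` minimal, the product of `w - y
(ζ t)` over `ζ ^ n = 1`, where `t ^ n = x`, is a germ in `(x, w)` that divides `f`. Irreducibility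
makes the cofactor a unit, comparison of orders gives `n = mult f`, and a shear achieves `ord y > n`
(`IsIrreducibleGerm.exists_chart`).

With `m = mult f`, an immersion transversal to the `x`-axis, which is the tangent cone, meets `f`
with order `m`. Any other immersion is a graph `w = a x` and has order `ord (a (t ^ m) - y t)`
(`IsPuiseuxChart.order_graph`). A submersion composed with `(t ^ m, y t)` gives either `m` or, by
the implicit function theorem, again such a number (`paramContactOrders_eq`). Both kinds of contact
orders thus form the set `graphOrders m y`. A series in `t ^ m` can alter exactly the exponents of
`y` divisible by `m`, so this set consists of the multiples of `m` below the first Puiseux exponent,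
and that exponent (`graphOrders_eq`).

An injective map-germ into a branch is a reparametrisation of `(t ^ m, y t)`
(`IsPuiseuxChart.exists_reparametrisation`). This identifies the contact orders of a curve with
those of its equation and makes the Puiseux exponent independent of choices.

For products, orders along a fixed immersion add, and a tangent vector lies in at most one of
several distinct lines. A smooth branch can be approximated to any order by other graphs, while
singular branches have only finitely many contact orders.

Puiseux's theorem is proved with the Newton polygon by induction on the order in `w`. Translating by
a root of the `w`-derivative removes the linear term, so the edge polynomial is not a full power and
the order drops. All steps are carried out with analytic germs, so convergence is never a separate
issue. Division and descent to `x ^ n` are read off convergent double series. -/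

namespace PlaneGerm

/-! ### Double power series -/

/-- `f` is near the origin the sum of the double power series with coefficients `a`, and these
grow at most geometrically. -/
def HasDoubleSeries (f : ℂ × ℂ → ℂ) (a : ℕ → ℕ → ℂ) : Prop :=
  (∃ C R : ℝ, 0 < C ∧ 0 < R ∧ ∀ i j, ‖a i j‖ ≤ C * R ^ (i + j)) ∧
    ∀ᶠ p in 𝓝 (0 : ℂ × ℂ),
      HasSum (fun q : ℕ × ℕ => a q.1 q.2 * (p.1 ^ q.1 * p.2 ^ q.2)) (f p)

theorem summable_of_geometric_bound {a : ℕ → ℕ → ℂ} {C R : ℝ} (hR : 0 < R)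
    (h : ∀ i j, ‖a i j‖ ≤ C * R ^ (i + j)) :
    ∀ᶠ p in 𝓝 (0 : ℂ × ℂ), Summable (fun q : ℕ × ℕ => a q.1 q.2 * (p.1 ^ q.1 * p.2 ^ q.2)) := by
  have h1 : ∀ᶠ p in 𝓝 (0 : ℂ × ℂ), ‖p‖ < R⁻¹ := by
    have : Tendsto (fun p : ℂ × ℂ => ‖p‖) (𝓝 0) (𝓝 0) := by simpa using tendsto_norm_zero
    exact this.eventually_lt_const (by positivity)
  filter_upwards [h1] with p hp
  have hx : R * ‖p.1‖ < 1 := by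
    have : ‖p.1‖ < R⁻¹ := (norm_fst_le p).trans_lt hp
    calc R * ‖p.1‖ < R * R⁻¹ := by gcongr
      _ = 1 := mul_inv_cancel₀ hR.ne'
  have hy : R * ‖p.2‖ < 1 := by
    have : ‖p.2‖ < R⁻¹ := (norm_snd_le p).trans_lt hp
    calc R * ‖p.2‖ < R * R⁻¹ := by gcongr
      _ = 1 := mul_inv_cancel₀ hR.ne'
  have sx := summable_geometric_of_lt_one (by positivity) hx
  have sy := summable_geometric_of_lt_one (by positivity) hy
  have := (sx.mul_of_nonneg sy (fun _ => by positivity) (fun _ => by positivity)).mul_left C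
  refine Summable.of_norm_bounded this fun q => ?_
  rw [norm_mul, norm_mul, norm_pow, norm_pow]
  calc ‖a q.1 q.2‖ * (‖p.1‖ ^ q.1 * ‖p.2‖ ^ q.2)
      ≤ C * R ^ (q.1 + q.2) * (‖p.1‖ ^ q.1 * ‖p.2‖ ^ q.2) := by gcongr; exact h _ _
    _ = _ := by rw [mul_pow, mul_pow, pow_add]; ring

theorem hasSum_antidiagonal {g : ℕ × ℕ → ℂ} {s : ℂ} (h : HasSum g s) :
    HasSum (fun n => ∑ q ∈ Finset.HasAntidiagonal.antidiagonal n, g q) s := by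
  have h1 := (Finset.HasAntidiagonal.sigmaAntidiagonalEquivProd (A := ℕ)).hasSum_iff.mpr h
  convert! h1.sigma fun n => hasSum_fintype _ using 2 with n
  exact (Finset.sum_coe_sort _ g).symm

/-- The monomial `x ^ i * w ^ (n - i)` as a continuous multilinear map. -/
noncomputable def monomialMap (n i : ℕ) : ContinuousMultilinearMap ℂ (fun _ : Fin n => ℂ × ℂ) ℂ :=
  (ContinuousMultilinearMap.mkPiAlgebra ℂ (Fin n) ℂ).compContinuousLinearMap
    (fun k => if (k : ℕ) < i then ContinuousLinearMap.fst ℂ ℂ ℂ else ContinuousLinearMap.snd ℂ ℂ ℂ)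

theorem monomialMap_apply (i j : ℕ) (v : ℂ × ℂ) :
    monomialMap (i + j) i (fun _ => v) = v.1 ^ i * v.2 ^ j := by
  simp only [monomialMap, ContinuousMultilinearMap.compContinuousLinearMap_apply,
    ContinuousMultilinearMap.mkPiAlgebra_apply]
  rw [Fin.prod_univ_add]
  simp

theorem norm_monomialMap_le (n i : ℕ) : ‖monomialMap n i‖ ≤ 1 := by
  refine (ContinuousMultilinearMap.norm_compContinuousLinearMap_le _ _).trans ?_
  have h1 : ‖ContinuousMultilinearMap.mkPiAlgebra ℂ (Fin n) ℂ‖ = 1 :=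
    ContinuousMultilinearMap.norm_mkPiAlgebra
  rw [h1, one_mul]
  refine Finset.prod_le_one (fun _ _ => norm_nonneg _) fun k _ => ?_
  split_ifs
  · exact ContinuousLinearMap.norm_fst_le ..
  · exact ContinuousLinearMap.norm_snd_le ..

/-- Collecting the monomials of total degree `n` gives a formal multilinear series. There are `n +
1` of them, a factor absorbed by doubling the ratio `R`. -/
theorem HasDoubleSeries.analyticAt {f : ℂ × ℂ → ℂ} {a : ℕ → ℕ → ℂ} (h : HasDoubleSeries f a) :
    AnalyticAt ℂ f 0 := by
  obtain ⟨⟨C, R, hC, hR, hb⟩, hs⟩ := h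
  let p : FormalMultilinearSeries ℂ (ℂ × ℂ) ℂ := fun n =>
    ∑ q ∈ Finset.HasAntidiagonal.antidiagonal n, a q.1 q.2 • monomialMap n q.1
  have hp : ∀ n, ‖p n‖ ≤ C * (2 * R) ^ n := by
    intro n
    calc ‖p n‖ ≤ ∑ q ∈ Finset.HasAntidiagonal.antidiagonal n, ‖a q.1 q.2 • monomialMap n q.1‖ :=
          norm_sum_le _ _
      _ ≤ ∑ q ∈ Finset.HasAntidiagonal.antidiagonal n, C * R ^ n := by
          refine Finset.sum_le_sum fun q hq => ?_
          rw [norm_smul, ← Finset.HasAntidiagonal.mem_antidiagonal.mp hq]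
          calc _ ≤ C * R ^ (q.1 + q.2) * 1 := by
                gcongr
                · exact hb _ _
                · exact norm_monomialMap_le _ _
            _ = _ := mul_one _
      _ = (n + 1) * (C * R ^ n) := by simp
      _ ≤ 2 ^ n * (C * R ^ n) := by
          gcongr
          exact_mod_cast Nat.lt_two_pow_self
      _ = _ := by rw [mul_pow]; ring
  have hr : 0 < p.radius := by
    have h2 : (0 : ℝ) < (2 * R)⁻¹ := by positivity
    have := p.le_radius_of_bound C (r := ⟨(2 * R)⁻¹, h2.le⟩) (fun n => by
      calc ‖p n‖ * ((2 * R)⁻¹) ^ n ≤ C * (2 * R) ^ n * ((2 * R)⁻¹) ^ n := by gcongr; exact hp n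
        _ = C := by rw [mul_assoc, ← mul_pow, mul_inv_cancel₀ (by positivity), one_pow, mul_one])
    refine lt_of_lt_of_le ?_ this
    exact ENNReal.coe_pos.mpr (show (0 : NNReal) < ⟨(2 * R)⁻¹, h2.le⟩ from h2)
  obtain ⟨ε, hε, hball⟩ := EMetric.mem_nhds_iff.mp hs
  refine ⟨p, min p.radius ε, ⟨min_le_left _ _, lt_min hr hε, fun {y} hy => ?_⟩⟩
  have hy' : y ∈ Metric.eball (0 : ℂ × ℂ) ε := Metric.eball_subset_eball (min_le_right _ _) hy
  have e : ∀ n, p n (fun _ => y) = ∑ q ∈ Finset.HasAntidiagonal.antidiagonal n,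
      a q.1 q.2 * (y.1 ^ q.1 * y.2 ^ q.2) := by
    intro n
    have hpn : p n (fun _ => y) = ∑ q ∈ Finset.HasAntidiagonal.antidiagonal n,
      (a q.1 q.2 • monomialMap n q.1) (fun _ => y) := sum_apply ..
    rw [hpn]
    refine Finset.sum_congr rfl fun q hq => ?_
    rw [← Finset.HasAntidiagonal.mem_antidiagonal.mp hq, smul_apply, monomialMap_apply,
      smul_eq_mul]
  rw [zero_add]
  simp only [e]
  exact hasSum_antidiagonal (hball hy')

/-- Expand the `n`-linear term at `v.1 • (1, 0) + v.2 • (0, 1)`: the coefficient of `x ^ i * w ^ (n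
- i)` is a sum over the `i`-element subsets of the `n` slots. There are at most `2 ^ n` subsets,
whence the ratio `2 * R`. -/
theorem _root_.AnalyticAt.exists_hasDoubleSeries {f : ℂ × ℂ → ℂ} (h : AnalyticAt ℂ f 0) :
    ∃ a, HasDoubleSeries f a := by
  obtain ⟨p, r, hp⟩ := h
  obtain ⟨C, R, hC, hR, hb⟩ := p.le_mul_pow_of_radius_pos hp.radius_pos
  let m (n : ℕ) (s : Finset (Fin n)) : ℂ :=
    p n (s.piecewise (fun _ => ((1, 0) : ℂ × ℂ)) (fun _ => (0, 1)))
  let B (n i : ℕ) : ℂ := ∑ s : Finset (Fin n) with s.card = i, m n s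
  have hm : ∀ n s, ‖m n s‖ ≤ C * R ^ n := by
    intro n s
    refine ((p n).le_opNorm _).trans ?_
    calc _ ≤ ‖p n‖ * 1 := by
          gcongr
          refine Finset.prod_le_one (fun _ _ => norm_nonneg _) fun k _ => ?_
          by_cases hk : k ∈ s <;> simp [hk]
      _ ≤ _ := by rw [mul_one]; exact hb n
  have hB : ∀ i j, ‖B (i + j) i‖ ≤ C * (2 * R) ^ (i + j) := by
    intro i j
    calc ‖B (i + j) i‖ ≤ ∑ s : Finset (Fin (i + j)) with s.card = i, C * R ^ (i + j) :=
          norm_sum_le_of_le _ fun s _ => hm _ s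
      _ ≤ ∑ s : Finset (Fin (i + j)), C * R ^ (i + j) :=
          Finset.sum_le_sum_of_subset_of_nonneg (Finset.filter_subset _ _)
            fun _ _ _ => by positivity
      _ = _ := by simp [mul_pow]; ring
  have key : ∀ (n : ℕ) (v : ℂ × ℂ), ∑ q ∈ Finset.HasAntidiagonal.antidiagonal n,
      B (q.1 + q.2) q.1 * (v.1 ^ q.1 * v.2 ^ q.2) = p n (fun _ => v) := by
    intro n v
    have h1 : (fun _ : Fin n => v) = (fun _ => v.1 • ((1, 0) : ℂ × ℂ)) +
        (fun _ => v.2 • ((0, 1) : ℂ × ℂ)) := by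
      ext k <;> simp
    rw [h1, ContinuousMultilinearMap.map_add_univ]
    have h2 : ∀ s : Finset (Fin n), p n (s.piecewise (fun _ => v.1 • ((1, 0) : ℂ × ℂ))
        (fun _ => v.2 • ((0, 1) : ℂ × ℂ))) = v.1 ^ s.card * v.2 ^ (n - s.card) * m n s := by
      intro s
      have : s.piecewise (fun _ => v.1 • ((1, 0) : ℂ × ℂ)) (fun _ => v.2 • ((0, 1) : ℂ × ℂ)) =
          fun k => (if k ∈ s then v.1 else v.2) •
            (s.piecewise (fun _ => ((1, 0) : ℂ × ℂ)) (fun _ => (0, 1)) k) := by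
        funext k
        by_cases hk : k ∈ s <;> simp [hk]
      rw [this, ContinuousMultilinearMap.map_smul_univ, Finset.prod_ite, smul_eq_mul]
      simp only [Finset.prod_const, m]
      congr 3
      · simp
      · rw [show (Finset.univ.filter fun k => k ∉ s) = sᶜ by ext; simp, Finset.card_compl,
          Fintype.card_fin]
    simp_rw [h2]
    rw [← Finset.sum_fiberwise_of_maps_to (s := Finset.univ) (t := Finset.HasAntidiagonal.antidiagonal n)
      (g := fun s : Finset (Fin n) => (s.card, n - s.card))]
    · refine Finset.sum_congr rfl fun q hq => ?_
      have hq' := Finset.HasAntidiagonal.mem_antidiagonal.mp hq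
      rw [hq', mul_comm, Finset.mul_sum]
      refine Finset.sum_congr ?_ fun s hs => ?_
      · ext s
        simp only [Finset.mem_filter, Finset.mem_univ, true_and, Prod.ext_iff]
        omega
      · simp only [Finset.mem_filter, Finset.mem_univ, true_and, Prod.ext_iff] at hs
        rw [← hs.1, ← hs.2, mul_comm]
    · intro s _
      have := s.card_le_univ
      simp only [Fintype.card_fin] at this
      simp only [Finset.HasAntidiagonal.mem_antidiagonal]
      omega
  refine ⟨fun i j => B (i + j) i, ⟨C, 2 * R, hC, by positivity, hB⟩, ?_⟩
  filter_upwards [summable_of_geometric_bound (by positivity) hB, hp.eventually_hasSum] with v hv hv'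
  have h3 := hasSum_antidiagonal hv.hasSum
  simp only [key, zero_add] at h3 hv'
  rw [← h3.unique hv']
  exact hv.hasSum

/-! ### Closure properties of map-germs -/

section MapGerm

variable {E F G : Type*} [NormedAddCommGroup E] [NormedSpace ℂ E]
  [NormedAddCommGroup F] [NormedSpace ℂ F] [NormedAddCommGroup G] [NormedSpace ℂ G]

theorem IsMapGerm.tendsto {f : E → F} (h : IsMapGerm f) : Tendsto f (𝓝 0) (𝓝 0) := by
  simpa [h.2] using h.1.continuousAt.tendsto

theorem IsMapGerm.eventually {f : E → F} (h : IsMapGerm f) {P : F → Prop}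
    (hP : ∀ᶠ y in 𝓝 0, P y) : ∀ᶠ x in 𝓝 0, P (f x) :=
  h.tendsto.eventually hP

theorem IsMapGerm.analyticAt_comp {f : E → F} (h : IsMapGerm f) {g : F → G}
    (hg : AnalyticAt ℂ g 0) : AnalyticAt ℂ (fun x => g (f x)) 0 :=
  hg.comp_of_eq h.1 h.2

theorem IsMapGerm.comp {g : F → G} (hg : IsMapGerm g) {f : E → F} (h : IsMapGerm f) :
    IsMapGerm (fun x => g (f x)) :=
  ⟨h.analyticAt_comp hg.1, by simp [h.2, hg.2]⟩

theorem IsMapGerm.prodMk {f : E → F} (h : IsMapGerm f) {g : E → G} (hg : IsMapGerm g) :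
    IsMapGerm (fun x => (f x, g x)) :=
  ⟨h.1.prod hg.1, by simp [h.2, hg.2]⟩

theorem isMapGerm_fst : IsMapGerm (fun p : E × F => p.1) := ⟨analyticAt_fst, rfl⟩

theorem isMapGerm_snd : IsMapGerm (fun p : E × F => p.2) := ⟨analyticAt_snd, rfl⟩

theorem isMapGerm_id : IsMapGerm (fun x : E => x) := ⟨analyticAt_id, rfl⟩

theorem isMapGerm_zero : IsMapGerm (fun _ : E => (0 : F)) := ⟨analyticAt_const, rfl⟩

theorem isMapGerm_clm (l : E →L[ℂ] F) : IsMapGerm (fun x => l x) := ⟨l.analyticAt 0, map_zero l⟩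

theorem isMapGerm_const_smul (c : ℂ) : IsMapGerm (fun x : E => c • x) :=
  isMapGerm_clm (c • ContinuousLinearMap.id ℂ E)

theorem isMapGerm_smul_const (v : E) : IsMapGerm (fun s : ℂ => s • v) :=
  isMapGerm_clm ((ContinuousLinearMap.id ℂ ℂ).smulRight v)

theorem isMapGerm_const_mul (c : ℂ) : IsMapGerm (fun x : ℂ => c * x) := isMapGerm_const_smul c

theorem isMapGerm_pow {n : ℕ} (hn : n ≠ 0) : IsMapGerm (fun x : ℂ => x ^ n) :=
  ⟨analyticAt_id.pow n, zero_pow hn⟩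

theorem IsMapGerm.add {f g : E → F} (hf : IsMapGerm f) (hg : IsMapGerm g) :
    IsMapGerm (fun x => f x + g x) := ⟨hf.1.add hg.1, by simp [hf.2, hg.2]⟩

theorem IsMapGerm.sub {f g : E → F} (hf : IsMapGerm f) (hg : IsMapGerm g) :
    IsMapGerm (fun x => f x - g x) := ⟨hf.1.sub hg.1, by simp [hf.2, hg.2]⟩

end MapGerm

/-! ### Division and invariants -/

/-- The quotient is the double series with its second index shifted by one. All later divisions rest
on this one. -/
theorem exists_eq_add_snd_mul {f : ℂ × ℂ → ℂ} (hf : AnalyticAt ℂ f 0) :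
    ∃ g, AnalyticAt ℂ g 0 ∧ ∀ᶠ p in 𝓝 (0 : ℂ × ℂ), f p = f (p.1, 0) + p.2 * g p := by
  obtain ⟨a, ⟨C, R, hC, hR, hb⟩, hs⟩ := hf.exists_hasDoubleSeries
  have hb' : ∀ i j, ‖a i (j + 1)‖ ≤ C * R * R ^ (i + j) := fun i j =>
    (hb i (j + 1)).trans_eq (by ring)
  let g : ℂ × ℂ → ℂ := fun p => ∑' q : ℕ × ℕ, a q.1 (q.2 + 1) * (p.1 ^ q.1 * p.2 ^ q.2)
  have hg : HasDoubleSeries g (fun i j => a i (j + 1)) :=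
    ⟨⟨C * R, R, by positivity, hR, hb'⟩,
      (summable_of_geometric_bound hR hb').mono fun p hp => hp.hasSum⟩
  refine ⟨g, hg.analyticAt, ?_⟩
  have hs0 := (isMapGerm_fst.prodMk isMapGerm_zero : IsMapGerm (fun p : ℂ × ℂ => (p.1, (0 : ℂ))))
    |>.eventually hs
  filter_upwards [hs, hs0, hg.2] with p h1 h2 h3
  have h4 := h1.sub h2
  have h5 := h3.mul_left p.2
  have hinj : Function.Injective (fun q : ℕ × ℕ => (q.1, q.2 + 1)) := by
    rintro ⟨i, j⟩ ⟨k, l⟩ h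
    simpa using h
  have h6 : HasSum ((fun q : ℕ × ℕ => a q.1 q.2 * (p.1 ^ q.1 * p.2 ^ q.2) -
      a q.1 q.2 * (p.1 ^ q.1 * 0 ^ q.2)) ∘ fun q : ℕ × ℕ => (q.1, q.2 + 1)) (f p - f (p.1, 0)) := by
    rw [hinj.hasSum_iff]
    · exact h4
    · rintro ⟨i, j⟩ hij
      cases j with
      | zero => simp
      | succ j => exact absurd ⟨(i, j), rfl⟩ hij
  have h7 : f p - f (p.1, 0) = p.2 * g p := by
    refine h6.unique ((congrArg (HasSum · (p.2 * g p)) (funext fun q => ?_)).mp h5)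
    simp
    ring
  rw [← h7]
  ring

/-- A shear moves the graph of `y` to the axis, where the remainder of the division vanishes. -/
theorem exists_eq_sub_mul {f : ℂ × ℂ → ℂ} (hf : AnalyticAt ℂ f 0) {y : ℂ → ℂ} (hy : IsMapGerm y)
    (h : ∀ᶠ t in 𝓝 0, f (t, y t) = 0) :
    ∃ g, AnalyticAt ℂ g 0 ∧ ∀ᶠ p in 𝓝 (0 : ℂ × ℂ), f p = (p.2 - y p.1) * g p := by
  have h1 : IsMapGerm (fun p : ℂ × ℂ => (p.1, p.2 + y p.1)) :=
    isMapGerm_fst.prodMk (isMapGerm_snd.add (hy.comp isMapGerm_fst))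
  have h2 : IsMapGerm (fun p : ℂ × ℂ => (p.1, p.2 - y p.1)) :=
    isMapGerm_fst.prodMk (isMapGerm_snd.sub (hy.comp isMapGerm_fst))
  obtain ⟨g, hg, hfg⟩ := exists_eq_add_snd_mul (h1.analyticAt_comp hf)
  refine ⟨fun p => g (p.1, p.2 - y p.1), h2.analyticAt_comp hg, ?_⟩
  filter_upwards [h2.eventually hfg, isMapGerm_fst.eventually h] with p hp hp'
  simpa [hp'] using hp

theorem eventually_eq_zero_or_of_mul {f g : ℂ → ℂ} (hf : AnalyticAt ℂ f 0) (hg : AnalyticAt ℂ g 0)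
    (h : ∀ᶠ t in 𝓝 0, f t * g t = 0) : (∀ᶠ t in 𝓝 0, f t = 0) ∨ ∀ᶠ t in 𝓝 0, g t = 0 := by
  rw [← analyticOrderAt_eq_top, ← analyticOrderAt_eq_top]
  have h1 : analyticOrderAt (f * g) 0 = ⊤ := analyticOrderAt_eq_top.mpr h
  rwa [analyticOrderAt_mul hf hg, ENat.add_eq_top] at h1

theorem exists_eventually_eq_zero_of_prod {ι : Type*} (s : Finset ι) {f : ι → ℂ → ℂ}
    (hf : ∀ i ∈ s, AnalyticAt ℂ (f i) 0) (h : ∀ᶠ t in 𝓝 0, ∏ i ∈ s, f i t = 0) :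
    ∃ i ∈ s, ∀ᶠ t in 𝓝 0, f i t = 0 := by
  classical
  induction s using Finset.induction_on with
  | empty => simpa using h.self_of_nhds
  | insert i s hi ih =>
    simp only [Finset.prod_insert hi] at h
    rcases eventually_eq_zero_or_of_mul (hf i (by simp))
      (Finset.analyticAt_fun_prod s fun j hj => hf j (by simp [hj])) h with h | h
    · exact ⟨i, by simp, h⟩
    · obtain ⟨j, hj, h⟩ := ih (fun j hj => hf j (by simp [hj])) h
      exact ⟨j, by simp [hj], h⟩

/-- Linear factors are split off one at a time. On the next graph the factors already removed do not
vanish identically, and germs in one variable have no zero divisors, so the quotient still vanishes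
there. -/
theorem exists_eq_prod_mul {ι : Type*} (s : Finset ι) {y : ι → ℂ → ℂ} (hy : ∀ i, IsMapGerm (y i))
    (hne : ∀ i ∈ s, ∀ j ∈ s, i ≠ j → ¬ ∀ᶠ t in 𝓝 0, y i t = y j t)
    {f : ℂ × ℂ → ℂ} (hf : AnalyticAt ℂ f 0) (h : ∀ i ∈ s, ∀ᶠ t in 𝓝 0, f (t, y i t) = 0) :
    ∃ g, AnalyticAt ℂ g 0 ∧ ∀ᶠ p in 𝓝 (0 : ℂ × ℂ), f p = (∏ i ∈ s, (p.2 - y i p.1)) * g p := by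
  classical
  induction s using Finset.induction_on with
  | empty => exact ⟨f, hf, by simp⟩
  | insert i s hi ih =>
    obtain ⟨g, hg, hfg⟩ := ih (fun j hj k hk => hne j (by simp [hj]) k (by simp [hk]))
      (fun j hj => h j (by simp [hj]))
    have hyi : IsMapGerm (fun t => (t, y i t)) := isMapGerm_id.prodMk (hy i)
    have h1 : ∀ᶠ t in 𝓝 0, (∏ j ∈ s, (y i t - y j t)) * g (t, y i t) = 0 := by
      filter_upwards [hyi.eventually hfg, h i (by simp)] with t ht ht'
      rw [← ht', ht]
    have h2 : ∀ᶠ t in 𝓝 0, g (t, y i t) = 0 := by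
      refine (eventually_eq_zero_or_of_mul (Finset.analyticAt_fun_prod s
        fun j _ => (hy i).1.sub (hy j).1) (hyi.analyticAt_comp hg) h1).resolve_left fun h3 => ?_
      obtain ⟨j, hj, h4⟩ := exists_eventually_eq_zero_of_prod s
        (fun j _ => (hy i).1.sub (hy j).1) h3
      refine hne i (by simp) j (by simp [hj]) (fun e => hi (e ▸ hj)) ?_
      filter_upwards [h4] with t ht using sub_eq_zero.mp ht
    obtain ⟨g', hg', hgg'⟩ := exists_eq_sub_mul hg (hy i) h2
    refine ⟨g', hg', ?_⟩
    filter_upwards [hfg, hgg'] with p hp hp'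
    rw [hp, hp', Finset.prod_insert hi]
    ring

/-- Averaging the double series over the rotations by powers of `η` kills each monomial whose
exponent of `x` is not divisible by `n`. -/
theorem exists_eq_pow_fst {n : ℕ} (hn : 0 < n) {η : ℂ} (hη : IsPrimitiveRoot η n)
    {f : ℂ × ℂ → ℂ} (hf : AnalyticAt ℂ f 0)
    (h : ∀ᶠ p in 𝓝 (0 : ℂ × ℂ), f (η * p.1, p.2) = f p) :
    ∃ g, AnalyticAt ℂ g 0 ∧ ∀ᶠ p in 𝓝 (0 : ℂ × ℂ), f p = g (p.1 ^ n, p.2) := by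
  obtain ⟨a, ⟨C, R, hC, hR, hb⟩, hs⟩ := hf.exists_hasDoubleSeries
  -- The maximum with `1` allows the exponent `n * i + j` to be raised to `n * (i + j)`.
  have hb' : ∀ i j, ‖a (n * i) j‖ ≤ C * ((max 1 R) ^ n) ^ (i + j) := fun i j => by
    refine (hb _ j).trans ?_
    rw [← pow_mul]
    calc C * R ^ (n * i + j) ≤ C * (max 1 R) ^ (n * i + j) := by gcongr; exact le_max_right _ _
      _ ≤ C * (max 1 R) ^ (n * (i + j)) := by
        gcongr
        · exact le_max_left _ _
        · nlinarith
  have hR' : 0 < (max 1 R) ^ n := by positivity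
  let g : ℂ × ℂ → ℂ := fun p => ∑' q : ℕ × ℕ, a (n * q.1) q.2 * (p.1 ^ q.1 * p.2 ^ q.2)
  have hg : HasDoubleSeries g (fun i j => a (n * i) j) :=
    ⟨⟨C, _, hC, hR', hb'⟩, (summable_of_geometric_bound hR' hb').mono fun p hp => hp.hasSum⟩
  refine ⟨g, hg.analyticAt, ?_⟩
  have hrot : ∀ k : ℕ, IsMapGerm (fun p : ℂ × ℂ => (η ^ k * p.1, p.2)) := fun k =>
    ((isMapGerm_const_mul _).comp isMapGerm_fst).prodMk isMapGerm_snd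
  have hinv : ∀ k : ℕ, ∀ᶠ p in 𝓝 (0 : ℂ × ℂ), f (η ^ k * p.1, p.2) = f p := by
    intro k
    induction k with
    | zero => simp
    | succ k ih =>
      filter_upwards [ih, (hrot k).eventually h] with p h1 h2
      rw [← h1, ← h2, pow_succ']
      simp only [mul_assoc]
  have hall : ∀ᶠ p in 𝓝 (0 : ℂ × ℂ), ∀ k ∈ Finset.range n,
      f (η ^ k * p.1, p.2) = f p ∧
      HasSum (fun q : ℕ × ℕ => a q.1 q.2 * ((η ^ k * p.1) ^ q.1 * p.2 ^ q.2))
        (f (η ^ k * p.1, p.2)) := by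
    rw [Filter.eventually_all_finset]
    intro k _
    exact (hinv k).and ((hrot k).eventually hs)
  have hpow : IsMapGerm (fun p : ℂ × ℂ => (p.1 ^ n, p.2)) :=
    ((isMapGerm_pow hn.ne').comp isMapGerm_fst).prodMk isMapGerm_snd
  filter_upwards [hall, hpow.eventually hg.2] with p h1 h2
  have h3 := hasSum_sum fun k hk => (h1 k hk).2
  rw [Finset.sum_congr rfl fun k hk => (h1 k hk).1, Finset.sum_const, Finset.card_range,
    nsmul_eq_mul] at h3
  have hinj : Function.Injective (fun q : ℕ × ℕ => (n * q.1, q.2)) := by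
    rintro ⟨i, j⟩ ⟨k, l⟩ hikl
    simp only [Prod.mk.injEq, mul_eq_mul_left_iff, hn.ne', or_false] at hikl
    simp [hikl]
  rw [← hinj.hasSum_iff] at h3
  · have h4 := h2.mul_left (n : ℂ)
    have h5 : (n : ℂ) * f p = n * g (p.1 ^ n, p.2) := by
      refine h3.unique ((congrArg (HasSum · (n * g (p.1 ^ n, p.2))) (funext fun q => ?_)).mp h4)
      have : ∀ k ∈ Finset.range n, a (n * q.1) q.2 * ((η ^ k * p.1) ^ (n * q.1) * p.2 ^ q.2) =
          a (n * q.1) q.2 * ((p.1 ^ n) ^ q.1 * p.2 ^ q.2) := by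
        intro k _
        rw [mul_pow, ← pow_mul, mul_left_comm k, pow_mul, hη.pow_eq_one, one_pow, one_mul, pow_mul]
      simp only [Function.comp_apply]
      rw [Finset.sum_congr rfl this, Finset.sum_const, Finset.card_range, nsmul_eq_mul]
    exact mul_left_cancel₀ (by exact_mod_cast hn.ne') h5
  · rintro ⟨i, j⟩ hij
    have hni : ¬ n ∣ i := by
      rintro ⟨k, rfl⟩
      exact hij ⟨(k, j), rfl⟩
    have h6 : η ^ i ≠ 1 := fun h => hni (hη.dvd_of_pow_eq_one _ h)
    have h7 : ∑ k ∈ Finset.range n, (η ^ i) ^ k = 0 := by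
      have := mul_geom_sum (η ^ i) n
      rw [← pow_mul, mul_comm i, pow_mul, hη.pow_eq_one, one_pow, sub_self] at this
      exact (mul_eq_zero.mp this).resolve_left (sub_ne_zero.mpr h6)
    have h8 : ∀ k ∈ Finset.range n, a i j * ((η ^ k * p.1) ^ i * p.2 ^ j) =
        (η ^ i) ^ k * (a i j * (p.1 ^ i * p.2 ^ j)) := by
      intro k _
      rw [mul_pow, ← pow_mul, ← pow_mul, mul_comm k]
      ring
    rw [Finset.sum_congr rfl h8, ← Finset.sum_mul, h7, zero_mul]

/-! ### Implicit functions, local inverses, roots -/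

theorem exists_implicit {f : ℂ × ℂ → ℂ} (hf : IsMapGerm f) (h : fderiv ℂ f 0 (0, 1) ≠ 0) :
    ∃ y : ℂ → ℂ, IsMapGerm y ∧ ∀ᶠ t in 𝓝 0, f (t, y t) = 0 := by
  have hc : ContDiffAt ℂ ⊤ f 0 := hf.1.contDiffAt
  have hinv : (fderiv ℂ f 0 ∘L .inr ℂ ℂ ℂ).IsInvertible := by
    refine ⟨ContinuousLinearEquiv.unitsEquivAut ℂ (Units.mk0 _ h), ?_⟩
    ext
    simp
  have h0 : hc.implicitFunction (by simp) hinv 0 = 0 := hc.implicitFunction_apply_self (by simp) hinv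
  refine ⟨hc.implicitFunction (by simp) hinv, ⟨?_, h0⟩, ?_⟩
  · exact (hc.contDiffAt_implicitFunction (by simp) hinv).analyticAt
  · simpa [hf.2] using hc.eventually_apply_implicitFunction (by simp) hinv

theorem exists_local_inverse {x : ℂ → ℂ} (hx : IsMapGerm x) (h : deriv x 0 ≠ 0) :
    ∃ σ : ℂ → ℂ, IsMapGerm σ ∧ deriv σ 0 ≠ 0 ∧ (∀ᶠ t in 𝓝 0, x (σ t) = t) ∧
      ∀ᶠ t in 𝓝 0, σ (x t) = t := by
  have hd := hx.1.hasStrictDerivAt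
  have h1 := hx.1.analyticAt_localInverse h
  have h2 := hd.to_localInverse (hf' := h)
  have h3 := HasStrictFDerivAt.localInverse_apply_image
    (hf := (hd.hasStrictFDerivAt_equiv h))
  have h4 := HasStrictFDerivAt.eventually_right_inverse (hf := (hd.hasStrictFDerivAt_equiv h))
  have h5 := HasStrictFDerivAt.eventually_left_inverse (hf := (hd.hasStrictFDerivAt_equiv h))
  have key : ∀ σ : ℂ → ℂ, AnalyticAt ℂ σ (x 0) → HasStrictDerivAt σ (deriv x 0)⁻¹ (x 0) →
      σ (x 0) = 0 → (∀ᶠ t in 𝓝 (x 0), x (σ t) = t) → (∀ᶠ t in 𝓝 0, σ (x t) = t) →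
      ∃ σ : ℂ → ℂ, IsMapGerm σ ∧ deriv σ 0 ≠ 0 ∧ (∀ᶠ t in 𝓝 0, x (σ t) = t) ∧
        ∀ᶠ t in 𝓝 0, σ (x t) = t := by
    intro σ h1 h2 h3 h4 h5
    rw [hx.2] at h1 h2 h3 h4
    exact ⟨σ, ⟨h1, h3⟩, by rw [h2.hasDerivAt.deriv]; exact inv_ne_zero h, h4, h5⟩
  exact key _ h1 h2 h3 h4 h5

/-- In `x = t ^ k * g` the quotient `g / g 0` is close to `1`, where the principal branch of the
`k`-th root is analytic; `c` is a root of the constant `g 0`. In the coordinate `τ` the function is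
a pure power. -/
theorem exists_root_of_order {x : ℂ → ℂ} (hx : AnalyticAt ℂ x 0) {k : ℕ} (hk : 0 < k)
    (h : analyticOrderAt x 0 = k) :
    ∃ τ : ℂ → ℂ, IsMapGerm τ ∧ deriv τ 0 ≠ 0 ∧ ∀ᶠ t in 𝓝 0, x t = τ t ^ k := by
  obtain ⟨g, hg, hg0, hxg⟩ := hx.analyticOrderAt_eq_natCast.mp h
  obtain ⟨c, hc⟩ := IsAlgClosed.exists_pow_nat_eq (g 0) hk
  have hc0 : c ≠ 0 := fun h => hg0 (by rw [← hc, h, zero_pow hk.ne'])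
  have hr : AnalyticAt ℂ (fun t => (g t / g 0) ^ ((k : ℂ)⁻¹)) 0 := by
    refine (hg.div_const).cpow analyticAt_const ?_
    rw [div_self hg0]
    exact Complex.one_mem_slitPlane
  have hτ : HasDerivAt (fun t : ℂ => t * (c * (g t / g 0) ^ ((k : ℂ)⁻¹))) c 0 := by
    have := (hasDerivAt_id (0 : ℂ)).mul (analyticAt_const.mul hr : AnalyticAt ℂ
      (fun t => c * (g t / g 0) ^ ((k : ℂ)⁻¹)) 0).differentiableAt.hasDerivAt
    simpa [div_self hg0, Pi.mul_def] using! this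
  refine ⟨fun t => t * (c * (g t / g 0) ^ ((k : ℂ)⁻¹)),
    ⟨analyticAt_id.mul (analyticAt_const.mul hr), by simp⟩, by rwa [hτ.deriv], ?_⟩
  filter_upwards [hxg] with t ht
  rw [ht, mul_pow, mul_pow, hc, Complex.cpow_nat_inv_pow _ hk.ne']
  simp [field]

/-! ### Orders of functions of one variable -/

theorem order_mul {f g : ℂ → ℂ} (hf : AnalyticAt ℂ f 0) (hg : AnalyticAt ℂ g 0) :
    analyticOrderAt (fun t => f t * g t) 0 = analyticOrderAt f 0 + analyticOrderAt g 0 :=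
  analyticOrderAt_mul hf hg

theorem order_eq_zero {f : ℂ → ℂ} (h : f 0 ≠ 0) : analyticOrderAt f 0 = 0 :=
  analyticOrderAt_eq_zero.mpr (Or.inr h)

theorem order_comp {f g : ℂ → ℂ} (hf : AnalyticAt ℂ f 0) (hg : IsMapGerm g) :
    analyticOrderAt (fun t => f (g t)) 0 = analyticOrderAt f 0 * analyticOrderAt g 0 := by
  have h := AnalyticAt.analyticOrderAt_comp (f := f) (g := g) (z₀ := 0) (by rwa [hg.2]) hg.1
  simpa [hg.2, Function.comp_def] using h

theorem order_pow (n : ℕ) : analyticOrderAt (fun t : ℂ => t ^ n) 0 = n := by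
  have h := analyticOrderAt_centeredMonomial (𝕜 := ℂ) (z₀ := 0) (n := n)
  simp only [sub_zero] at h
  exact h

theorem order_pow_mul {g : ℂ → ℂ} (hg : AnalyticAt ℂ g 0) (n : ℕ) :
    analyticOrderAt (fun t => t ^ n * g t) 0 = n + analyticOrderAt g 0 := by
  have h : AnalyticAt ℂ (fun t : ℂ => t ^ n) 0 := analyticAt_id.pow n
  rw [order_mul h hg, order_pow]

theorem order_comp_pow {f : ℂ → ℂ} (hf : AnalyticAt ℂ f 0) {n : ℕ} (hn : n ≠ 0) :
    analyticOrderAt (fun t => f (t ^ n)) 0 = analyticOrderAt f 0 * n := by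
  rw [order_comp hf (isMapGerm_pow hn), order_pow]

theorem order_of_deriv_ne_zero {f : ℂ → ℂ} (hf : IsMapGerm f) (h : deriv f 0 ≠ 0) :
    analyticOrderAt f 0 = 1 :=
  hf.1.analyticOrderAt_eq_one_of_zero_deriv_ne_zero hf.2 h

theorem order_comp_of_deriv_ne_zero {f g : ℂ → ℂ} (hf : AnalyticAt ℂ f 0) (hg : IsMapGerm g)
    (h : deriv g 0 ≠ 0) : analyticOrderAt (fun t => f (g t)) 0 = analyticOrderAt f 0 := by
  rw [order_comp hf hg, order_of_deriv_ne_zero hg h, mul_one]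

theorem one_le_order {f : ℂ → ℂ} (hf : IsMapGerm f) : 1 ≤ analyticOrderAt f 0 :=
  Order.one_le_iff_ne_zero.mpr (hf.1.analyticOrderAt_ne_zero.mpr hf.2)

theorem deriv_comp_curve {f : ℂ × ℂ → ℂ} {α : ℂ → ℂ × ℂ} {t : ℂ} (hf : AnalyticAt ℂ f (α t))
    {v : ℂ × ℂ} (hα : HasDerivAt α v t) :
    deriv (fun s => f (α s)) t = fderiv ℂ f (α t) v :=
  (hf.differentiableAt.hasFDerivAt.comp_hasDerivAt t hα).deriv

theorem hasDerivAt_vertical (a b c : ℂ) :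
    HasDerivAt (fun w : ℂ => ((a, b + w) : ℂ × ℂ)) (0, 1) c :=
  (hasDerivAt_const c a).prodMk ((hasDerivAt_id c).const_add b)

theorem deriv_vertical {f : ℂ × ℂ → ℂ} {a b c : ℂ} (hf : AnalyticAt ℂ f (a, b + c)) :
    deriv (fun w => f (a, b + w)) c = fderiv ℂ f (a, b + c) (0, 1) :=
  deriv_comp_curve (α := fun w => (a, b + w)) hf (hasDerivAt_vertical a b c)

theorem tendsto_axis : IsMapGerm (fun w : ℂ => ((0, w) : ℂ × ℂ)) :=
  isMapGerm_zero.prodMk isMapGerm_id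

theorem analyticAt_fderiv_apply {f : ℂ × ℂ → ℂ} (hf : AnalyticAt ℂ f 0) (v : ℂ × ℂ) :
    AnalyticAt ℂ (fun p => fderiv ℂ f p v) 0 :=
  ((ContinuousLinearMap.apply ℂ ℂ v).analyticAt _).comp hf.fderiv

theorem order_partial {f : ℂ × ℂ → ℂ} (hf : AnalyticAt ℂ f 0) {d : ℕ}
    (h : analyticOrderAt (fun w => f (0, w)) 0 = (d + 1 : ℕ)) :
    analyticOrderAt (fun w => fderiv ℂ f (0, w) (0, 1)) 0 = d := by
  have h1 := analyticOrderAt_deriv_of_pos (tendsto_axis.analyticAt_comp hf) (n := d) (by simpa using h)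
  rw [← h1]
  refine analyticOrderAt_congr ?_
  filter_upwards [tendsto_axis.eventually hf.eventually_analyticAt] with w hw
  have := deriv_vertical (f := f) (a := 0) (b := 0) (c := w) (by simpa using hw)
  simpa using this.symm

/-- Weierstrass-type expansion of a germ that is regular of order `d` in the second variable. -/
theorem exists_expansion (d : ℕ) {f : ℂ × ℂ → ℂ} (hf : AnalyticAt ℂ f 0)
    (h : analyticOrderAt (fun w => f (0, w)) 0 = d) :
    ∃ (a : ℕ → ℂ → ℂ) (u : ℂ × ℂ → ℂ), (∀ i, IsMapGerm (a i)) ∧ AnalyticAt ℂ u 0 ∧ u 0 ≠ 0 ∧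
      ∀ᶠ p in 𝓝 (0 : ℂ × ℂ), f p = ∑ i ∈ Finset.range d, a i p.1 * p.2 ^ i + p.2 ^ d * u p := by
  induction d generalizing f with
  | zero =>
    refine ⟨fun _ _ => 0, f, fun _ => isMapGerm_zero, hf, ?_, by simp⟩
    have := (tendsto_axis.analyticAt_comp hf).analyticOrderAt_eq_zero.mp h
    exact this
  | succ d ih =>
    obtain ⟨g, hg, hfg⟩ := exists_eq_add_snd_mul hf
    have hx : IsMapGerm (fun x : ℂ => ((x, 0) : ℂ × ℂ)) := isMapGerm_id.prodMk isMapGerm_zero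
    have h0 : f (0, 0) = 0 := by
      refine apply_eq_zero_of_analyticOrderAt_ne_zero (f := fun w => f (0, w)) (z₀ := 0) ?_
      rw [h]
      exact_mod_cast Nat.succ_ne_zero d
    have h1 : analyticOrderAt (fun w => g (0, w)) 0 = d := by
      have h2 : analyticOrderAt (fun w => w ^ 1 * g (0, w)) 0 = (d + 1 : ℕ) := by
        rw [← h]
        refine analyticOrderAt_congr ?_
        filter_upwards [tendsto_axis.eventually hfg] with w hw
        simp [hw, h0]
      rw [order_pow_mul (tendsto_axis.analyticAt_comp hg)] at h2
      have h3 : (1 : ℕ∞) + analyticOrderAt (fun w => g (0, w)) 0 = 1 + d := by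
        rw [add_comm 1 (d : ℕ∞)]; exact_mod_cast h2
      exact ENat.add_right_injective_of_ne_top (by simp) h3
    obtain ⟨a, u, ha, hu, hu0, hga⟩ := ih hg h1
    refine ⟨fun i => i.casesOn (fun x => f (x, 0)) a, u, fun i => ?_, hu, hu0, ?_⟩
    · cases i with
      | zero => exact ⟨hx.analyticAt_comp hf, h0⟩
      | succ i => exact ha i
    · filter_upwards [hfg, hga] with p h4 h5
      have hs : p.2 * ∑ i ∈ Finset.range d, a i p.1 * p.2 ^ i =
          ∑ i ∈ Finset.range d, a i p.1 * p.2 ^ (i + 1) := by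
        rw [Finset.mul_sum]
        exact Finset.sum_congr rfl fun i _ => by ring
      rw [h4, h5, Finset.sum_range_succ']
      change _ = ∑ i ∈ Finset.range d, a i p.1 * p.2 ^ (i + 1) + f (p.1, 0) * p.2 ^ 0 + _
      rw [← hs]
      ring

/-- Since `d ≥ 2`, only the linear term contributes to the `w`-derivative at `w = 0`. -/
theorem expansion_coeff_one {d : ℕ} (hd : 2 ≤ d) {f u : ℂ × ℂ → ℂ} {a : ℕ → ℂ → ℂ}
    (hu : AnalyticAt ℂ u 0)
    (h : ∀ᶠ p in 𝓝 (0 : ℂ × ℂ), f p = ∑ i ∈ Finset.range d, a i p.1 * p.2 ^ i + p.2 ^ d * u p) :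
    ∀ᶠ t in 𝓝 0, deriv (fun w => f (t, w)) 0 = a 1 t := by
  have hx : IsMapGerm (fun x : ℂ => ((x, 0) : ℂ × ℂ)) := isMapGerm_id.prodMk isMapGerm_zero
  filter_upwards [hx.eventually h.eventually_nhds, hx.eventually hu.eventually_analyticAt]
    with t ht hut
  have hv : HasDerivAt (fun w : ℂ => ((t, w) : ℂ × ℂ)) (0, 1) 0 :=
    (hasDerivAt_const _ _).prodMk (hasDerivAt_id _)
  have h1 : (fun w => f (t, w)) =ᶠ[𝓝 0]
      fun w => ∑ i ∈ Finset.range d, a i t * w ^ i + w ^ d * u (t, w) :=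
    hv.continuousAt.eventually ht
  have h2 : HasDerivAt (fun w => u (t, w)) (fderiv ℂ u (t, 0) (0, 1)) 0 :=
    hut.differentiableAt.hasFDerivAt.comp_hasDerivAt 0 hv
  have h3 := (HasDerivAt.fun_sum fun i (_ : i ∈ Finset.range d) =>
    ((hasDerivAt_pow i (0 : ℂ)).const_mul (a i t))).fun_add ((hasDerivAt_pow d (0 : ℂ)).fun_mul h2)
  rw [h1.deriv_eq, h3.deriv, Finset.sum_eq_single 1]
  · simp [show d ≠ 0 by omega, show d - 1 ≠ 0 by omega]
  · intro i _ hi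
    rcases i with _ | _ | i
    · simp
    · exact absurd rfl hi
    · simp
  · intro h4
    exact absurd (Finset.mem_range.mpr (by omega)) h4

theorem exists_min_slope {d : ℕ} (S : Finset ℕ) (hS : S.Nonempty) (hSd : ∀ i ∈ S, i < d)
    (o : ℕ → ℕ) (ho : ∀ i ∈ S, 0 < o i) :
    ∃ N ν : ℕ, 0 < N ∧ 0 < ν ∧ (∀ i ∈ S, ν * (d - i) ≤ o i * N) ∧
      ∃ i ∈ S, ν * (d - i) = o i * N := by
  obtain ⟨i, hi, hmin⟩ := S.exists_min_image (fun i => (o i : ℚ) / (d - i : ℕ)) hS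
  have hid := hSd i hi
  refine ⟨d - i, o i, by omega, ho i hi, fun j hj => ?_, i, hi, rfl⟩
  have h1 := hmin j hj
  have hjd := hSd j hj
  rw [div_le_div_iff₀ (by exact_mod_cast Nat.sub_pos_of_lt hid)
    (by exact_mod_cast Nat.sub_pos_of_lt hjd)] at h1
  exact_mod_cast h1


/-- A polynomial of degree `d` with a `d`-fold root `z` is `k * (X - z) ^ d`. Its linear coefficient
vanishes only for `z = 0`, and then all lower coefficients vanish, which `c i₀ ≠ 0` excludes. -/
theorem exists_root_not_full {d : ℕ} (hd : 2 ≤ d) (c : ℕ → ℂ) {k : ℂ} (hk : k ≠ 0)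
    (h1 : c 1 = 0) {i₀ : ℕ} (hi₀ : i₀ < d) (hc : c i₀ ≠ 0) :
    ∃ (z : ℂ) (e : ℕ) (R : Polynomial ℂ), 1 ≤ e ∧ e < d ∧ R.eval z ≠ 0 ∧
      ∀ w, ∑ i ∈ Finset.range d, c i * (z + w) ^ i + (z + w) ^ d * k = w ^ e * R.eval (z + w) := by
  open Polynomial in
  let Q : ℂ[X] := ∑ i ∈ Finset.range d, C (c i) * X ^ i + C k * X ^ d
  have hcoeff : ∀ j < d, Q.coeff j = c j := by
    intro j hj
    simp only [Q, coeff_add, finsetSum_coeff, coeff_C_mul, coeff_X_pow, hj.ne, if_false,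
      mul_ite, mul_one, mul_zero, add_zero]
    rw [Finset.sum_ite_eq, if_pos (Finset.mem_range.mpr hj)]
  have hdeg : Q.natDegree = d := by
    rw [natDegree_add_eq_right_of_degree_lt, natDegree_C_mul_X_pow d k hk]
    rw [degree_C_mul_X_pow d hk]
    refine (degree_sum_le _ _).trans_lt ((Finset.sup_lt_iff (WithBot.bot_lt_coe d)).mpr ?_)
    intro i hi
    exact (degree_C_mul_X_pow_le _ _).trans_lt (Nat.cast_lt.mpr (Finset.mem_range.mp hi))
  have hQ0 : Q ≠ 0 := fun h => by rw [h] at hdeg; simp at hdeg; omega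
  obtain ⟨z, hz⟩ := IsAlgClosed.exists_root Q (by
    rw [degree_eq_natDegree hQ0, hdeg]; exact_mod_cast (by omega : d ≠ 0))
  obtain ⟨R, hQR, hR⟩ := exists_eq_pow_rootMultiplicity_mul_and_not_dvd Q hQ0 z
  have hR0 : R ≠ 0 := fun h => hR (h ▸ dvd_zero _)
  have hdegR : Q.rootMultiplicity z + R.natDegree = d := by
    rw [← hdeg]
    conv_rhs => rw [hQR]
    rw [natDegree_mul (pow_ne_zero _ (X_sub_C_ne_zero z)) hR0, natDegree_pow, natDegree_X_sub_C,
      mul_one]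
  refine ⟨z, Q.rootMultiplicity z, R, (rootMultiplicity_pos hQ0).mpr hz, ?_,
    fun h => hR (dvd_iff_isRoot.mpr h), fun w => ?_⟩
  · refine lt_of_le_of_ne (by omega) fun he => ?_
    obtain ⟨r, hr⟩ := natDegree_eq_zero.mp (by omega : R.natDegree = 0)
    rw [he, ← hr] at hQR
    have hr0 : r ≠ 0 := fun h => hR0 (by rw [← hr, h, C_0])
    have h2 : z = 0 := by
      have h3 := hcoeff 1 (by omega)
      rw [hQR, h1, coeff_mul_C, sub_eq_add_neg, ← C_neg, coeff_X_add_C_pow] at h3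
      have h4 := (mul_eq_zero.mp h3).resolve_right hr0
      have h5 := (mul_eq_zero.mp h4).resolve_right (by
        rw [Nat.choose_one_right]; exact_mod_cast (by omega : d ≠ 0))
      exact neg_eq_zero.mp (pow_eq_zero_iff (by omega : d - 1 ≠ 0) |>.mp h5)
    have h6 := hcoeff i₀ hi₀
    rw [hQR, h2, C_0, sub_zero, coeff_mul_C, coeff_X_pow, if_neg hi₀.ne, zero_mul] at h6
    exact hc h6.symm
  · have h7 := congrArg (eval (z + w)) hQR
    simp only [Q, eval_add, eval_finsetSum, eval_mul, eval_C, eval_pow, eval_X, eval_sub,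
      add_sub_cancel_left] at h7
    rw [← h7, mul_comm k]

/-- **Puiseux**: a germ that is regular of positive order in the second variable has a root
which is a convergent fractional power series. -/
theorem exists_puiseux_root (d : ℕ) (hd : 1 ≤ d) {f : ℂ × ℂ → ℂ} (hf : AnalyticAt ℂ f 0)
    (h : analyticOrderAt (fun w => f (0, w)) 0 = d) :
    ∃ (n : ℕ) (y : ℂ → ℂ), 0 < n ∧ IsMapGerm y ∧ ∀ᶠ t in 𝓝 0, f (t ^ n, y t) = 0 := by
  induction d using Nat.strong_induction_on generalizing f with
  | _ d ih =>
  obtain rfl | hd2 : d = 1 ∨ 2 ≤ d := by omega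
  · have h0 : f 0 = 0 := apply_eq_zero_of_analyticOrderAt_ne_zero (f := fun w => f (0, w)) (z₀ := 0)
      (by rw [h]; simp)
    have h1 := order_partial hf (d := 0) h
    have h2 : fderiv ℂ f 0 (0, 1) ≠ 0 := by
      rw [Nat.cast_zero, analyticOrderAt_eq_zero] at h1
      refine h1.resolve_left (not_not.mpr ?_)
      exact tendsto_axis.analyticAt_comp (analyticAt_fderiv_apply hf (0, 1))
    obtain ⟨y, hy, hfy⟩ := exists_implicit ⟨hf, h0⟩ h2
    exact ⟨1, y, one_pos, hy, by simpa using hfy⟩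
  obtain ⟨d, rfl⟩ : ∃ e, d = e + 1 := ⟨d - 1, by omega⟩
  -- The `w`-derivative is regular of order one less, so by induction it has a root `y₁`.
  -- Translating `w` by `y₁` makes the linear coefficient `a 1` vanish.
  obtain ⟨n₁, y₁, hn₁, hy₁, hfy₁⟩ := ih d (by omega) (by omega)
    (analyticAt_fderiv_apply hf (0, 1))
    (order_partial hf h)
  have hsh : IsMapGerm (fun p : ℂ × ℂ => (p.1 ^ n₁, y₁ p.1 + p.2)) :=
    ((isMapGerm_pow hn₁.ne').comp isMapGerm_fst).prodMk
      ((hy₁.comp isMapGerm_fst).add isMapGerm_snd)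
  let F : ℂ × ℂ → ℂ := fun p => f (p.1 ^ n₁, y₁ p.1 + p.2)
  have hF : AnalyticAt ℂ F 0 := hsh.analyticAt_comp hf
  have hF0 : analyticOrderAt (fun w => F (0, w)) 0 = (d + 1 : ℕ) := by
    rw [← h]
    simp [F, hy₁.2, hn₁.ne']
  obtain ⟨a, u, ha, hu, hu0, hFa⟩ := exists_expansion (d + 1) hF hF0
  have ha1 : ∀ᶠ t in 𝓝 0, a 1 t = 0 := by
    have hc : IsMapGerm (fun t => (t ^ n₁, y₁ t)) := (isMapGerm_pow hn₁.ne').prodMk hy₁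
    filter_upwards [expansion_coeff_one hd2 hu hFa, hc.eventually hf.eventually_analyticAt, hfy₁]
      with t h1 h2 h3
    rw [← h1]
    have := deriv_vertical (f := f) (a := t ^ n₁) (b := y₁ t) (c := 0) (by simpa using h2)
    simpa [h3] using this
  -- a root of `F` gives a root of `f`
  suffices hroot : ∃ (n : ℕ) (y : ℂ → ℂ), 0 < n ∧ IsMapGerm y ∧ ∀ᶠ t in 𝓝 0, F (t ^ n, y t) = 0 by
    obtain ⟨n, y, hn, hy, hFy⟩ := hroot
    refine ⟨n * n₁, fun t => y₁ (t ^ n) + y t, by positivity,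
      (hy₁.comp (isMapGerm_pow hn.ne')).add hy, ?_⟩
    filter_upwards [hFy] with t ht
    rw [pow_mul]
    exact ht
  classical
  let S := (Finset.range (d + 1)).filter fun i => analyticOrderAt (a i) 0 ≠ ⊤
  by_cases hS : S.Nonempty
  swap
  -- All lower coefficients are zero germs, so `F` is `w ^ (d + 1)` times a unit and `w = 0` is a
  -- root.
  · have hall : ∀ᶠ t in 𝓝 0, ∀ i ∈ Finset.range (d + 1), a i t = 0 := by
      rw [Filter.eventually_all_finset]
      intro i hi
      by_contra hne
      refine hS ⟨i, Finset.mem_filter.mpr ⟨hi, fun htop => hne (analyticOrderAt_eq_top.mp htop)⟩⟩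
    refine ⟨1, fun _ => 0, one_pos, isMapGerm_zero, ?_⟩
    have hx : IsMapGerm (fun x : ℂ => ((x, 0) : ℂ × ℂ)) := isMapGerm_id.prodMk isMapGerm_zero
    filter_upwards [hall, hx.eventually hFa] with t h1 h2
    rw [pow_one, h2, Finset.sum_eq_zero fun i hi => by rw [h1 i hi, zero_mul]]
    simp
  have ho : ∀ i ∈ S, (analyticOrderNatAt (a i) 0 : ℕ∞) = analyticOrderAt (a i) 0 := fun i hi =>
    Nat.cast_analyticOrderNatAt (Finset.mem_filter.mp hi).2
  obtain ⟨N, ν, hN, hν, hle, i₀, hi₀, heq⟩ := exists_min_slope (d := d + 1) S hS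
    (fun i hi => Finset.mem_range.mp (Finset.mem_filter.mp hi).1)
    (fun i => analyticOrderNatAt (a i) 0) (fun i hi => by
      have := one_le_order (ha i)
      rw [← ho i hi] at this
      exact_mod_cast this)
  have hapow : ∀ i, AnalyticAt ℂ (fun t => a i (t ^ N)) 0 := fun i =>
    (isMapGerm_pow hN.ne').analyticAt_comp (ha i).1
  -- The slope inequality says exactly that these powers of `t` can be divided out; equality at `i₀`
  -- makes `b i₀` a unit.
  have hb : ∀ i ∈ Finset.range (d + 1), ∃ b : ℂ → ℂ, AnalyticAt ℂ b 0 ∧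
      ∀ᶠ t in 𝓝 0, a i (t ^ N) = t ^ (ν * (d + 1 - i)) * b t := by
    intro i hi
    have : ((ν * (d + 1 - i) : ℕ) : ℕ∞) ≤ analyticOrderAt (fun t => a i (t ^ N)) 0 := by
      rw [order_comp_pow (ha i).1 hN.ne']
      by_cases hiS : i ∈ S
      · rw [← ho i hiS]
        exact_mod_cast hle i hiS
      · have : analyticOrderAt (a i) 0 = ⊤ := by
          by_contra hne
          exact hiS (Finset.mem_filter.mpr ⟨hi, hne⟩)
        rw [this, ENat.top_mul (by exact_mod_cast hN.ne')]
        exact le_top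
    obtain ⟨b, hb, hab⟩ := (natCast_le_analyticOrderAt (hapow i)).mp this
    exact ⟨b, hb, by simpa using hab⟩
  choose! b hb hab using hb
  have hi₀' := (Finset.mem_filter.mp hi₀).1
  have hb0 : b i₀ 0 ≠ 0 := by
    have h1 : analyticOrderAt (fun t => t ^ (ν * (d + 1 - i₀)) * b i₀ t) 0 =
        (ν * (d + 1 - i₀) : ℕ) := by
      rw [← analyticOrderAt_congr (hab i₀ hi₀'), order_comp_pow (ha i₀).1 hN.ne', ← ho i₀ hi₀, heq]
      push_cast
      rfl
    rw [order_pow_mul (hb i₀ hi₀')] at h1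
    have h2 : analyticOrderAt (b i₀) 0 = 0 := by
      have h3 : ((ν * (d + 1 - i₀) : ℕ) : ℕ∞) + analyticOrderAt (b i₀) 0 =
        (ν * (d + 1 - i₀) : ℕ) + 0 := by rw [add_zero]; exact h1
      exact ENat.add_right_injective_of_ne_top (ENat.natCast_ne_top _) h3
    exact ((hb i₀ hi₀').analyticOrderAt_eq_zero).mp h2
  have h1mem : 1 ∈ Finset.range (d + 1) := Finset.mem_range.mpr (by omega)
  have hb1 : b 1 0 = 0 := by
    have h1 : ∀ᶠ t in 𝓝 0, t ^ (ν * (d + 1 - 1)) * b 1 t = 0 := by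
      filter_upwards [hab 1 h1mem, (isMapGerm_pow hN.ne').eventually ha1] with t h1 h2
      rw [← h1, h2]
    rcases eventually_eq_zero_or_of_mul (analyticAt_id.pow _) (hb 1 h1mem) h1 with h2 | h2
    · have h3 := analyticOrderAt_eq_top.mpr h2
      rw [show (id ^ (ν * (d + 1 - 1)) : ℂ → ℂ) = fun t => t ^ (ν * (d + 1 - 1)) from rfl,
        order_pow] at h3
      exact absurd h3 (ENat.natCast_ne_top _)
    · exact h2.self_of_nhds
  -- At `t = 0` the rescaled germ is a polynomial without linear term but with a nonzero lower
  -- coefficient. Around the root `z` its order `e` is smaller than `d + 1`, so the induction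
  -- applies.
  obtain ⟨z, e, R, he1, hed, hRz, hQ⟩ := exists_root_not_full hd2 (fun i => b i 0) hu0 hb1
    (Finset.mem_range.mp hi₀') hb0
  have hscale : IsMapGerm (fun p : ℂ × ℂ => (p.1 ^ N, p.1 ^ ν * (z + p.2))) :=
    ⟨(analyticAt_fst.pow N).prod ((analyticAt_fst.pow ν).mul (analyticAt_const.add analyticAt_snd)),
      by simp [hN.ne', hν.ne']⟩
  let G : ℂ × ℂ → ℂ := fun p => ∑ i ∈ Finset.range (d + 1), b i p.1 * (z + p.2) ^ i +
    (z + p.2) ^ (d + 1) * u (p.1 ^ N, p.1 ^ ν * (z + p.2))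
  have hG : AnalyticAt ℂ G 0 := by
    refine (Finset.analyticAt_fun_sum _ fun i hi => ?_).add
      (((analyticAt_const.add analyticAt_snd).pow _).mul (hscale.analyticAt_comp hu))
    exact (isMapGerm_fst.analyticAt_comp (hb i hi)).mul
      ((analyticAt_const.add analyticAt_snd).pow _)
  have hG0 : analyticOrderAt (fun w => G (0, w)) 0 = e := by
    have h1 : (fun w => G (0, w)) = fun w => w ^ e * R.eval (z + w) := by
      funext w
      rw [← hQ w]
      simp only [G, zero_pow hN.ne', zero_pow hν.ne', zero_mul]
      rfl
    have h2 : AnalyticAt ℂ (fun w => R.eval (z + w)) 0 :=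
      (R.differentiable.comp (differentiable_id.const_add z)).analyticAt 0
    rw [h1, order_pow_mul h2, order_eq_zero (by simpa using hRz),
      add_zero]
  obtain ⟨n₂, y₂, hn₂, hy₂, hGy⟩ := ih e hed he1 hG hG0
  have hFG : ∀ᶠ p in 𝓝 (0 : ℂ × ℂ),
      F (p.1 ^ N, p.1 ^ ν * (z + p.2)) = p.1 ^ (ν * (d + 1)) * G p := by
    have hall : ∀ᶠ p in 𝓝 (0 : ℂ × ℂ), ∀ i ∈ Finset.range (d + 1),
        a i (p.1 ^ N) = p.1 ^ (ν * (d + 1 - i)) * b i p.1 := by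
      rw [Filter.eventually_all_finset]
      exact fun i hi => isMapGerm_fst.eventually (hab i hi)
    filter_upwards [hscale.eventually hFa, hall] with p h1 h2
    rw [h1]
    simp only [G]
    rw [mul_add (p.1 ^ (ν * (d + 1))), Finset.mul_sum]
    congr 1
    · refine Finset.sum_congr rfl fun i hi => ?_
      have h3 : ν * (d + 1) = ν * (d + 1 - i) + ν * i := by
        rw [← Nat.mul_add, Nat.sub_add_cancel (Finset.mem_range.mp hi).le]
      rw [h2 i hi, h3, pow_add, mul_pow, pow_mul p.1 ν i]
      ring
    · rw [mul_pow, pow_mul, mul_assoc]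
  have hc : IsMapGerm (fun t => (t ^ n₂, y₂ t)) := (isMapGerm_pow hn₂.ne').prodMk hy₂
  refine ⟨n₂ * N, fun t => (t ^ n₂) ^ ν * (z + y₂ t), by positivity,
    ⟨((analyticAt_id.pow n₂).pow ν).mul (analyticAt_const.add hy₂.1),
      by simp [hn₂.ne', hν.ne']⟩, ?_⟩
  filter_upwards [hc.eventually hFG, hGy] with t h1 h2
  rw [pow_mul, h1, h2, mul_zero]

/-! ### Multiplicity and tangent cone -/

/-- If the order were some `k < n`, then `g = s ^ k * u` with `u 0 ≠ 0`, but the bound forces `u` to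
tend to `0`. -/
theorem natCast_le_order_of_isBigO {g : ℂ → ℂ} (hg : AnalyticAt ℂ g 0) {n : ℕ}
    (h : g =O[𝓝 0] fun s => ‖s‖ ^ n) : (n : ℕ∞) ≤ analyticOrderAt g 0 := by
  by_contra hlt
  push Not at hlt
  obtain ⟨k, hk⟩ := ENat.ne_top_iff_exists.mp hlt.ne_top
  rw [← hk] at hlt
  have hkn : k < n := by exact_mod_cast hlt
  obtain ⟨u, hu, hu0, hgu⟩ := hg.analyticOrderAt_eq_natCast.mp hk.symm
  obtain ⟨C, hC⟩ := h.bound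
  have h1 : ∀ᶠ s in 𝓝[≠] (0 : ℂ), ‖u s‖ ≤ C * ‖s‖ ^ (n - k) := by
    filter_upwards [hC.filter_mono nhdsWithin_le_nhds, hgu.filter_mono nhdsWithin_le_nhds,
      self_mem_nhdsWithin] with s h2 h3 hs
    have hs' : 0 < ‖s‖ := norm_pos_iff.mpr hs
    rw [h3, sub_zero, norm_smul, norm_pow, norm_pow, norm_norm, ← Nat.sub_add_cancel hkn.le,
      pow_add, ← mul_assoc, mul_comm] at h2
    exact le_of_mul_le_mul_right h2 (by positivity)
  have h4 : Tendsto (fun s : ℂ => C * ‖s‖ ^ (n - k)) (𝓝[≠] 0) (𝓝 0) := by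
    have : Continuous fun s : ℂ => C * ‖s‖ ^ (n - k) := by fun_prop
    have h5 := this.tendsto 0
    simp only [norm_zero, zero_pow (by omega : n - k ≠ 0), mul_zero] at h5
    exact h5.mono_left nhdsWithin_le_nhds
  have h6 : Tendsto u (𝓝[≠] 0) (𝓝 0) := squeeze_zero_norm' h1 h4
  exact hu0 (tendsto_nhds_unique (hu.continuousAt.tendsto.mono_left nhdsWithin_le_nhds) h6)

theorem isMapGerm_curve_factor {α : ℂ → ℂ × ℂ} (hα : IsMapGerm α) :
    ∃ β : ℂ → ℂ × ℂ, AnalyticAt ℂ β 0 ∧ β 0 = deriv α 0 ∧ ∀ᶠ s in 𝓝 0, α s = s • β s := by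
  have h1 : ((1 : ℕ) : ℕ∞) ≤ analyticOrderAt α 0 := by
    rw [Nat.cast_one, Order.one_le_iff_ne_zero]
    exact hα.1.analyticOrderAt_ne_zero.mpr hα.2
  obtain ⟨β, hβ, hαβ⟩ := (natCast_le_analyticOrderAt hα.1).mp h1
  have h2 : ∀ᶠ s in 𝓝 0, α s = s • β s := by simpa using hαβ
  refine ⟨β, hβ, ?_, h2⟩
  have h3 : HasDerivAt (fun s : ℂ => s • β s) ((0 : ℂ) • deriv β 0 + (1 : ℂ) • β 0) 0 :=
    (hasDerivAt_id (0 : ℂ)).fun_smul hβ.differentiableAt.hasDerivAt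
  rw [Filter.EventuallyEq.deriv_eq h2, h3.deriv]
  simp

/-- Below degree `mult f` all derivatives vanish, so the partial sum of the Taylor series is the
initial form alone. The zero germ is covered as well: there `mult f` is `sInf ∅ = 0` and the initial
form is zero. -/
theorem exists_initialForm_expansion {f : ℂ × ℂ → ℂ} (hf : AnalyticAt ℂ f 0) :
    AnalyticOnNhd ℂ (initialForm f) Set.univ ∧
      (∀ (c : ℂ) v, initialForm f (c • v) = c ^ mult f * initialForm f v) ∧
      (fun y => f y - initialForm f y) =O[𝓝 0] fun y => ‖y‖ ^ (mult f + 1) := by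
  obtain ⟨p, r, hp⟩ := hf
  have hdiag : ∀ k y, p k (fun _ => y) = (k.factorial : ℂ)⁻¹ * iteratedFDeriv ℂ k f 0 (fun _ => y) := by
    intro k y
    rw [← hp.factorial_smul, nsmul_eq_mul, inv_mul_cancel_left₀]
    exact_mod_cast k.factorial_ne_zero
  have hI : initialForm f = fun y => p (mult f) (fun _ => y) := by
    funext y
    rw [hdiag]
    rfl
  refine ⟨?_, ?_, ?_⟩
  · rw [hI]
    intro y _
    have h1 : AnalyticAt ℂ (fun y : ℂ × ℂ => fun _ : Fin (mult f) => y) y :=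
      AnalyticAt.pi fun _ => analyticAt_id
    have h2 := ((p (mult f)).analyticAt (x := fun _ => y)).comp h1
    exact h2
  · intro c v
    rw [hI]
    have := (p (mult f)).map_smul_univ (fun _ => c) (fun _ => v)
    simpa using this
  · have h1 := hp.hasFPowerSeriesAt.isBigO_sub_partialSum_pow (mult f + 1)
    have h2 : ∀ y, p.partialSum (mult f + 1) y = initialForm f y := by
      intro y
      rw [FormalMultilinearSeries.partialSum, Finset.sum_range_succ, Finset.sum_eq_zero, zero_add,
        hI]
      intro k hk
      rw [hdiag]
      have h3 : iteratedFDeriv ℂ k f 0 = 0 := by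
        by_contra h
        exact Nat.notMem_of_lt_sInf (Finset.mem_range.mp hk) h
      rw [h3]
      simp
    simpa [h2] using h1

/-- With `α s = s • β s` and `β 0 = deriv α 0`, homogeneity makes the initial form along `α` equal
to `s ^ mult f` times its value at `β s`. The remaining terms have larger order. -/
theorem order_curve {f : ℂ × ℂ → ℂ} (hf : AnalyticAt ℂ f 0) {α : ℂ → ℂ × ℂ} (hα : IsMapGerm α) :
    (mult f : ℕ∞) ≤ analyticOrderAt (fun s => f (α s)) 0 ∧
      (analyticOrderAt (fun s => f (α s)) 0 = mult f ↔ deriv α 0 ∉ tangentCone f) := by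
  obtain ⟨hI, hhom, hO⟩ := exists_initialForm_expansion hf
  obtain ⟨β, hβ, hβ0, hαβ⟩ := isMapGerm_curve_factor hα
  have hIβ : AnalyticAt ℂ (fun s => initialForm f (β s)) 0 := (hI _ (Set.mem_univ _)).comp hβ
  have hIα : AnalyticAt ℂ (fun s => initialForm f (α s)) 0 := (hI _ (Set.mem_univ _)).comp hα.1
  have h1 : analyticOrderAt (fun s => initialForm f (α s)) 0 =
      mult f + analyticOrderAt (fun s => initialForm f (β s)) 0 := by
    rw [← order_pow_mul hIβ]
    refine analyticOrderAt_congr ?_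
    filter_upwards [hαβ] with s hs
    rw [hs, hhom]
  have h2 : ((mult f + 1 : ℕ) : ℕ∞) ≤
      analyticOrderAt ((fun s => f (α s)) - fun s => initialForm f (α s)) 0 := by
    refine natCast_le_order_of_isBigO ((hα.analyticAt_comp hf).sub hIα) ?_
    refine (hO.comp_tendsto hα.tendsto).trans ?_
    have : α =O[𝓝 0] fun s => s := by
      have h3 : (fun s => s • β s) =O[𝓝 (0 : ℂ)] fun s => s • (1 : ℂ) :=
        (Asymptotics.isBigO_refl _ _).smul (hβ.continuousAt.isBigO_one ℂ)
      exact (h3.congr' (hαβ.mono fun _ h => h.symm) (by simp))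
    exact (this.norm_left.norm_right).pow _
  have h3 : (fun s => f (α s)) = (fun s => initialForm f (α s)) +
      ((fun s => f (α s)) - fun s => initialForm f (α s)) := by
    funext s
    simp
  have h4 : deriv α 0 ∉ tangentCone f ↔ analyticOrderAt (fun s => initialForm f (β s)) 0 = 0 := by
    rw [hIβ.analyticOrderAt_eq_zero, hβ0]
    rfl
  rw [h4]
  have hlt : (mult f : ℕ∞) < ((mult f + 1 : ℕ) : ℕ∞) := by exact_mod_cast Nat.lt_succ_self _
  by_cases h0 : analyticOrderAt (fun s => initialForm f (β s)) 0 = 0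
  · have h5 : analyticOrderAt (fun s => f (α s)) 0 = mult f := by
      rw [h0, add_zero] at h1
      rw [h3, analyticOrderAt_add_eq_left_of_lt, h1]
      rw [h1]
      exact hlt.trans_le h2
    exact ⟨h5.ge, by simp [h5, h0]⟩
  · have h5 : ((mult f + 1 : ℕ) : ℕ∞) ≤ analyticOrderAt (fun s => f (α s)) 0 := by
      rw [h3]
      refine le_trans (le_min ?_ h2) le_analyticOrderAt_add
      rw [h1, Nat.cast_add, Nat.cast_one]
      gcongr
      exact Order.one_le_iff_ne_zero.mpr h0
    exact ⟨hlt.le.trans h5, by simp [h0, (hlt.trans_le h5).ne']⟩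

/-- The iterated derivative is the symmetrisation of the corresponding term of any power series of
`f`. Terms that vanish on the diagonal may be replaced by zero, so a derivative whose form is
identically zero is itself zero. -/
theorem exists_notMem_tangentCone {f : ℂ × ℂ → ℂ} (hf : AnalyticAt ℂ f 0)
    (h : ¬ ∀ᶠ p in 𝓝 0, f p = 0) : ∃ v, v ∉ tangentCone f := by
  classical
  by_contra hall
  push Not at hall
  obtain ⟨p, r, hp⟩ := hf
  have hdiag : ∀ k y, p k (fun _ => y) = (k.factorial : ℂ)⁻¹ * iteratedFDeriv ℂ k f 0 (fun _ => y) := by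
    intro k y
    rw [← hp.factorial_smul, nsmul_eq_mul, inv_mul_cancel_left₀]
    exact_mod_cast k.factorial_ne_zero
  -- drop the terms of the series that vanish on the diagonal
  let q : FormalMultilinearSeries ℂ (ℂ × ℂ) ℂ := fun n => if ∀ y, p n (fun _ => y) = 0 then 0 else p n
  have hq : HasFPowerSeriesOnBall f q 0 r := by
    refine ⟨hp.r_le.trans (FormalMultilinearSeries.radius_le_of_le fun n => ?_), hp.r_pos,
      fun {y} hy => ?_⟩
    · simp only [q]
      split_ifs
      · simp
      · exact le_rfl
    · have : ∀ n, q n (fun _ => y) = p n (fun _ => y) := by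
        intro n
        simp only [q]
        split_ifs with hn
        · rw [hn y]; rfl
        · rfl
      simp only [this]
      exact hp.hasSum hy
  have hq0 : ∀ n, (∀ y, p n (fun _ => y) = 0) → iteratedFDeriv ℂ n f 0 = 0 := by
    intro n hn
    ext v
    rw [hq.iteratedFDeriv_eq_sum_of_completeSpace]
    simp [q, hn]
  by_cases hne : {k : ℕ | iteratedFDeriv ℂ k f 0 ≠ 0}.Nonempty
  · refine Nat.sInf_mem hne (hq0 _ fun y => ?_)
    rw [hdiag]
    exact hall y
  · refine h ?_
    have h0 : ∀ k, iteratedFDeriv ℂ k f 0 = 0 := fun k => by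
      by_contra hk
      exact hne ⟨k, hk⟩
    filter_upwards [hp.hasFPowerSeriesAt.eventually_hasSum] with y hy
    simp only [hdiag, h0] at hy
    rw [zero_add] at hy
    refine hy.unique ?_
    simp

theorem deriv_smul_const (v : ℂ × ℂ) : deriv (fun s : ℂ => s • v) 0 = v := by
  simpa using ((hasDerivAt_id (0 : ℂ)).smul_const v).deriv

theorem order_line {f : ℂ × ℂ → ℂ} (hf : AnalyticAt ℂ f 0) (v : ℂ × ℂ) :
    (mult f : ℕ∞) ≤ analyticOrderAt (fun s : ℂ => f (s • v)) 0 ∧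
      (analyticOrderAt (fun s : ℂ => f (s • v)) 0 = mult f ↔ v ∉ tangentCone f) := by
  have := order_curve hf (isMapGerm_smul_const v)
  rwa [deriv_smul_const] at this

theorem one_le_mult {f : ℂ × ℂ → ℂ} (hf : IsMapGerm f) (h : ¬ ∀ᶠ p in 𝓝 0, f p = 0) :
    1 ≤ mult f := by
  obtain ⟨v, hv⟩ := exists_notMem_tangentCone hf.1 h
  have h1 := (order_line hf.1 v).2.mpr hv
  have h2 := one_le_order (hf.comp (isMapGerm_smul_const v))
  rw [h1] at h2
  exact_mod_cast h2

theorem mult_eq_one_iff {f : ℂ × ℂ → ℂ} (hf : IsMapGerm f) (h : ¬ ∀ᶠ p in 𝓝 0, f p = 0) :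
    mult f = 1 ↔ fderiv ℂ f 0 ≠ 0 := by
  have key : ∀ v, analyticOrderAt (fun s : ℂ => f (s • v)) 0 = 1 ↔ fderiv ℂ f 0 v ≠ 0 := by
    intro v
    have h1 := hf.comp (isMapGerm_smul_const v)
    have h2 : deriv (fun s : ℂ => f (s • v)) 0 = fderiv ℂ f 0 v := by
      have h3 : HasDerivAt (fun s : ℂ => s • v) v 0 := by
        simpa using (hasDerivAt_id (0 : ℂ)).smul_const v
      have h4 := deriv_comp_curve (f := f) (by simpa using hf.1) h3
      simpa using h4
    rw [← Nat.cast_one, analyticOrderAt_eq_nat_iff_iteratedDeriv_eq_zero h1.1, iteratedDeriv_one, h2]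
    simp [hf.2]
  constructor
  · intro h1 h2
    obtain ⟨v, hv⟩ := exists_notMem_tangentCone hf.1 h
    have h3 := (order_line hf.1 v).2.mpr hv
    rw [h1, Nat.cast_one, key, h2] at h3
    exact h3 rfl
  · intro h1
    obtain ⟨v, hv⟩ : ∃ v, fderiv ℂ f 0 v ≠ 0 := by
      by_contra hall
      push Not at hall
      exact h1 (ContinuousLinearMap.ext hall)
    have h2 := (order_line hf.1 v).1
    rw [(key v).mpr hv] at h2
    have h3 : mult f ≤ 1 := by exact_mod_cast h2
    exact le_antisymm h3 (one_le_mult hf h)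

/-! ### The ring of germs -/

section Ring

variable {f g : ℂ × ℂ → ℂ}

theorem germOf_eq_iff (hf : AnalyticAt ℂ f 0) (hg : AnalyticAt ℂ g 0) :
    germOf f hf = germOf g hg ↔ f =ᶠ[𝓝 0] g :=
  Subtype.ext_iff.trans Germ.coe_eq

theorem germOf_mul (hf : AnalyticAt ℂ f 0) (hg : AnalyticAt ℂ g 0) :
    germOf f hf * germOf g hg = germOf (fun p => f p * g p) (hf.mul hg) := rfl

theorem exists_germOf (a : holoGerms) : ∃ (f : ℂ × ℂ → ℂ) (hf : AnalyticAt ℂ f 0), a = germOf f hf := by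
  obtain ⟨_, f, hf, rfl⟩ := a
  exact ⟨f, hf, rfl⟩

theorem germOf_eq_zero_iff (hf : AnalyticAt ℂ f 0) : germOf f hf = 0 ↔ ∀ᶠ p in 𝓝 0, f p = 0 :=
  germOf_eq_iff hf analyticAt_const

theorem isUnit_germOf_iff (hf : AnalyticAt ℂ f 0) : IsUnit (germOf f hf) ↔ f 0 ≠ 0 := by
  constructor
  · intro h
    obtain ⟨b, hb⟩ := h.exists_right_inv
    obtain ⟨g, hg, rfl⟩ := exists_germOf b
    have h1 : (fun p => f p * g p) =ᶠ[𝓝 0] fun _ => 1 :=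
      (germOf_eq_iff (hf.mul hg) analyticAt_const).mp hb
    exact left_ne_zero_of_mul_eq_one h1.self_of_nhds
  · intro h
    refine IsUnit.of_mul_eq_one (germOf (fun p => (f p)⁻¹) (hf.inv h)) ?_
    refine (germOf_eq_iff (hf.mul (hf.inv h)) analyticAt_const).mpr ?_
    filter_upwards [hf.continuousAt.eventually_ne h] with p hp using mul_inv_cancel₀ hp

theorem germOf_dvd_iff (hf : AnalyticAt ℂ f 0) (hg : AnalyticAt ℂ g 0) :
    germOf f hf ∣ germOf g hg ↔ ∃ q, AnalyticAt ℂ q 0 ∧ ∀ᶠ p in 𝓝 0, g p = f p * q p := by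
  constructor
  · rintro ⟨c, hc⟩
    obtain ⟨q, hq, rfl⟩ := exists_germOf c
    exact ⟨q, hq, (germOf_eq_iff hg (hf.mul hq)).mp hc⟩
  · rintro ⟨q, hq, h⟩
    exact ⟨germOf q hq, (germOf_eq_iff hg (hf.mul hq)).mpr h⟩

theorem isIrreducibleGerm_iff (hf : AnalyticAt ℂ f 0) :
    IsIrreducibleGerm f ↔ f 0 = 0 ∧ ∀ a b : ℂ × ℂ → ℂ, AnalyticAt ℂ a 0 → AnalyticAt ℂ b 0 →
      (∀ᶠ p in 𝓝 0, f p = a p * b p) → a 0 ≠ 0 ∨ b 0 ≠ 0 := by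
  constructor
  · rintro ⟨hf, hirr⟩
    refine ⟨not_not.mp fun h => hirr.not_isUnit ((isUnit_germOf_iff hf).mpr h),
      fun a b ha hb hab => ?_⟩
    have := hirr.isUnit_or_isUnit (a := germOf a ha) (b := germOf b hb)
      ((germOf_eq_iff hf (ha.mul hb)).mpr hab)
    rwa [isUnit_germOf_iff, isUnit_germOf_iff] at this
  · rintro ⟨h0, h⟩
    refine ⟨hf, ⟨fun hu => (isUnit_germOf_iff hf).mp hu h0, fun a b hab => ?_⟩⟩
    obtain ⟨a, ha, rfl⟩ := exists_germOf a
    obtain ⟨b, hb, rfl⟩ := exists_germOf b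
    rw [isUnit_germOf_iff, isUnit_germOf_iff]
    exact h a b ha hb ((germOf_eq_iff hf (ha.mul hb)).mp hab)

theorem IsIrreducibleGerm.isMapGerm (h : IsIrreducibleGerm f) : IsMapGerm f :=
  ⟨h.1, ((isIrreducibleGerm_iff h.1).mp h).1⟩

theorem IsIrreducibleGerm.ne_zero (h : IsIrreducibleGerm f) : ¬ ∀ᶠ p in 𝓝 0, f p = 0 := by
  obtain ⟨hf, hirr⟩ := h
  rw [← germOf_eq_zero_iff hf]
  exact hirr.ne_zero

theorem IsReducedGerm.isMapGerm (h : IsReducedGerm f) : IsMapGerm f := ⟨h.2.1, h.1⟩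

theorem IsReducedGerm.ne_zero (h : IsReducedGerm f) : ¬ ∀ᶠ p in 𝓝 0, f p = 0 := by
  obtain ⟨_, hf, hsq⟩ := h
  rw [← germOf_eq_zero_iff hf]
  exact hsq.ne_zero

theorem IsReducedGerm.of_sq_dvd (h : IsReducedGerm f) {q : ℂ × ℂ → ℂ} (hg : AnalyticAt ℂ g 0)
    (hq : AnalyticAt ℂ q 0) (hfg : ∀ᶠ p in 𝓝 0, f p = g p * g p * q p) : g 0 ≠ 0 := by
  obtain ⟨_, hf, hsq⟩ := h
  rw [← isUnit_germOf_iff hg]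
  refine hsq _ ?_
  rw [germOf_mul, germOf_dvd_iff]
  exact ⟨q, hq, hfg⟩

end Ring

/-! ### Conjugate roots -/

/-- Every complex number has an `m`-th root, and a number of norm below `ε ^ m` has its roots of
norm below `ε`. -/
theorem descend_pow {m : ℕ} (hm : 0 < m) {A : ℂ × ℂ → Prop}
    (h : ∀ᶠ p in 𝓝 (0 : ℂ × ℂ), A (p.1 ^ m, p.2)) : ∀ᶠ p in 𝓝 (0 : ℂ × ℂ), A p := by
  obtain ⟨ε, hε, hA⟩ := Metric.eventually_nhds_iff.mp h
  refine Metric.eventually_nhds_iff.mpr ⟨min ε (ε ^ m), by positivity, fun {p} hp => ?_⟩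
  rw [dist_zero_right] at hp
  obtain ⟨t, ht⟩ := IsAlgClosed.exists_pow_nat_eq p.1 hm
  have h1 : ‖t‖ < ε := by
    refine lt_of_pow_lt_pow_left₀ m hε.le ?_
    rw [← norm_pow, ht]
    exact (norm_fst_le p).trans_lt (hp.trans_le (min_le_right _ _))
  have h2 : ‖p.2‖ < ε := (norm_snd_le p).trans_lt (hp.trans_le (min_le_left _ _))
  have h3 := @hA (t, p.2) (by rw [dist_zero_right]; exact max_lt h1 h2)
  rwa [ht] at h3

theorem descend_pow_one {m : ℕ} (hm : 0 < m) {A : ℂ → Prop} (h : ∀ᶠ t in 𝓝 (0 : ℂ), A (t ^ m)) :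
    ∀ᶠ x in 𝓝 (0 : ℂ), A x := by
  have h1 : ∀ᶠ p in 𝓝 (0 : ℂ × ℂ), A p.1 :=
    descend_pow hm (A := fun p => A p.1) (isMapGerm_fst.eventually h)
  exact (isMapGerm_id.prodMk (isMapGerm_zero (F := ℂ))).eventually h1

/-- The `m`-th roots of unity. -/
noncomputable abbrev unityRoots (m : ℕ) : Finset ℂ := Polynomial.nthRootsFinset m (1 : ℂ)

theorem mem_unityRoots {m : ℕ} (hm : 0 < m) {ζ : ℂ} : ζ ∈ unityRoots m ↔ ζ ^ m = 1 :=
  Polynomial.mem_nthRootsFinset hm 1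

theorem card_unityRoots {m : ℕ} (hm : 0 < m) : (unityRoots m).card = m :=
  (Complex.isPrimitiveRoot_exp m hm.ne').card_nthRootsFinset

/-- The product of `w - y (ζ t)` over all conjugates of `y`. -/
noncomputable def conjProd (m : ℕ) (y : ℂ → ℂ) (p : ℂ × ℂ) : ℂ :=
  ∏ ζ ∈ unityRoots m, (p.2 - y (ζ * p.1))

theorem conjProd_rotate {m : ℕ} (hm : 0 < m) (y : ℂ → ℂ) {η : ℂ} (hη : η ^ m = 1) (t w : ℂ) :
    conjProd m y (η * t, w) = conjProd m y (t, w) := by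
  have hη0 : η ≠ 0 := fun h => by simp [h, hm.ne'] at hη
  refine Finset.prod_nbij' (· * η) (· * η⁻¹) ?_ ?_ ?_ ?_ ?_
  · intro ζ hζ
    rw [mem_unityRoots hm] at hζ ⊢
    rw [mul_pow, hζ, hη, one_mul]
  · intro ζ hζ
    rw [mem_unityRoots hm] at hζ ⊢
    rw [mul_pow, hζ, inv_pow, hη, inv_one, one_mul]
  · intro ζ _; simp [hη0]
  · intro ζ _; simp [hη0]
  · intro ζ _; simp [mul_assoc]

theorem IsMapGerm.rotate {y : ℂ → ℂ} (hy : IsMapGerm y) (ζ : ℂ) : IsMapGerm (fun t => y (ζ * t)) :=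
  hy.comp (isMapGerm_const_mul ζ)

theorem conjProd_isMapGerm {m : ℕ} (hm : 0 < m) {y : ℂ → ℂ} (hy : IsMapGerm y) :
    IsMapGerm (conjProd m y) := by
  constructor
  · exact Finset.analyticAt_fun_prod _ fun ζ _ =>
      (isMapGerm_snd.sub ((hy.rotate ζ).comp isMapGerm_fst)).1
  · exact Finset.prod_eq_zero ((mem_unityRoots hm).mpr (one_pow m)) (by simp [hy.2])

/-- Rotating `t` by a root of unity permutes the conjugates, so the product is a germ in `t ^ m` and
`w`: the minimal polynomial of `y` when the conjugates are distinct. -/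
theorem exists_conjProd_descends {m : ℕ} (hm : 0 < m) {y : ℂ → ℂ} (hy : IsMapGerm y) :
    ∃ P, IsMapGerm P ∧ ∀ᶠ p in 𝓝 (0 : ℂ × ℂ), P (p.1 ^ m, p.2) = conjProd m y p := by
  have hη := Complex.isPrimitiveRoot_exp m hm.ne'
  have hc := conjProd_isMapGerm hm hy
  obtain ⟨P, hP, h⟩ := exists_eq_pow_fst hm hη hc.1
    (Eventually.of_forall fun p => conjProd_rotate hm y hη.pow_eq_one p.1 p.2)
  refine ⟨P, ⟨hP, ?_⟩, h.mono fun p hp => hp.symm⟩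
  have h0 : P ((0 : ℂ) ^ m, 0) = 0 := h.self_of_nhds.symm.trans hc.2
  rwa [zero_pow hm.ne'] at h0

/-- The conjugates `y (ζ t)` of `y` are pairwise distinct germs. -/
def ConjDistinct (m : ℕ) (y : ℂ → ℂ) : Prop :=
  ∀ ζ : ℂ, ζ ^ m = 1 → (∀ᶠ t in 𝓝 0, y (ζ * t) = y t) → ζ = 1

theorem ConjDistinct.pairwise {m : ℕ} (hm : 0 < m) {y : ℂ → ℂ} (h : ConjDistinct m y) {ζ ξ : ℂ}
    (hζ : ζ ∈ unityRoots m) (hξ : ξ ∈ unityRoots m) (hne : ζ ≠ ξ) :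
    ¬ ∀ᶠ t in 𝓝 0, y (ζ * t) = y (ξ * t) := by
  rw [mem_unityRoots hm] at hζ hξ
  have hξ0 : ξ ≠ 0 := fun h => by simp [h, hm.ne'] at hξ
  intro he
  have h1 : ζ * ξ⁻¹ = 1 := by
    refine h _ (by rw [mul_pow, hζ, inv_pow, hξ, inv_one, one_mul]) ?_
    filter_upwards [(isMapGerm_const_mul ξ⁻¹).eventually he] with t ht
    rw [mul_assoc, ht, mul_inv_cancel_left₀ hξ0]
  exact hne ((mul_inv_eq_one₀ hξ0).mp h1)

/-- On each vertical line the product has finitely many zeros, so `b` vanishes off these points and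
by continuity also at them. This serves to cancel `conjProd`. -/
theorem eventually_eq_zero_of_conjProd_mul {m : ℕ} {y : ℂ → ℂ} {b : ℂ × ℂ → ℂ}
    (hb : AnalyticAt ℂ b 0) (h : ∀ᶠ p in 𝓝 (0 : ℂ × ℂ), conjProd m y p * b p = 0) :
    ∀ᶠ p in 𝓝 (0 : ℂ × ℂ), b p = 0 := by
  filter_upwards [h.eventually_nhds, hb.eventually_analyticAt] with p hp hbp
  have hv : ContinuousAt (fun w : ℂ => ((p.1, w) : ℂ × ℂ)) p.2 := by fun_prop
  have h1 : Tendsto (fun w => b (p.1, w)) (𝓝[≠] p.2) (𝓝 (b p)) :=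
    (ContinuousAt.comp (f := fun w : ℂ => ((p.1, w) : ℂ × ℂ)) hbp.continuousAt hv).tendsto.mono_left
      nhdsWithin_le_nhds
  have h2 : ∀ᶠ w in 𝓝[≠] p.2, ∀ ζ ∈ unityRoots m, w ≠ y (ζ * p.1) := by
    rw [Filter.eventually_all_finset]
    intro ζ _
    by_cases hc : p.2 = y (ζ * p.1)
    · rw [← hc]
      exact self_mem_nhdsWithin
    · exact (continuousAt_id.eventually_ne hc).filter_mono nhdsWithin_le_nhds
  have h3 : ∀ᶠ w in 𝓝[≠] p.2, (0 : ℂ) = b (p.1, w) := by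
    filter_upwards [h2, (hv.eventually hp).filter_mono nhdsWithin_le_nhds] with w h4 h5
    refine ((mul_eq_zero.mp h5).resolve_left ?_).symm
    exact Finset.prod_ne_zero_iff.mpr fun ζ hζ => sub_ne_zero.mpr (h4 ζ hζ)
  exact (tendsto_nhds_unique (tendsto_const_nhds.congr' h3) h1).symm

/-- After the substitution of `x ^ m`, `F` vanishes on the graphs of all conjugates and is divisible
by their product. Cancellation shows that the quotient is invariant under rotation, so it descends.
-/
theorem dvd_of_vanishes {m : ℕ} (hm : 0 < m) {y : ℂ → ℂ} (hy : IsMapGerm y)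
    (hd : ConjDistinct m y) {P F : ℂ × ℂ → ℂ} (hF : AnalyticAt ℂ F 0)
    (hP : ∀ᶠ p in 𝓝 (0 : ℂ × ℂ), P (p.1 ^ m, p.2) = conjProd m y p)
    (h : ∀ᶠ t in 𝓝 0, F (t ^ m, y t) = 0) :
    ∃ Q, AnalyticAt ℂ Q 0 ∧ ∀ᶠ p in 𝓝 (0 : ℂ × ℂ), F p = P p * Q p := by
  have hpow : IsMapGerm (fun p : ℂ × ℂ => (p.1 ^ m, p.2)) :=
    ((isMapGerm_pow hm.ne').comp isMapGerm_fst).prodMk isMapGerm_snd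
  obtain ⟨g, hg, hFg⟩ := exists_eq_prod_mul (unityRoots m) (y := fun ζ t => y (ζ * t))
    (fun ζ => hy.rotate ζ) (fun ζ hζ ξ hξ hne => hd.pairwise hm hζ hξ hne)
    (hpow.analyticAt_comp hF) (fun ζ hζ => by
      filter_upwards [(isMapGerm_const_mul ζ).eventually h] with t ht
      rwa [mul_pow, (mem_unityRoots hm).mp hζ, one_mul] at ht)
  have hη := Complex.isPrimitiveRoot_exp m hm.ne'
  set η := Complex.exp (2 * Real.pi * Complex.I / m)
  have hrot : IsMapGerm (fun p : ℂ × ℂ => (η * p.1, p.2)) :=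
    ((isMapGerm_const_mul η).comp isMapGerm_fst).prodMk isMapGerm_snd
  have hinv : ∀ᶠ p in 𝓝 (0 : ℂ × ℂ), g (η * p.1, p.2) - g p = 0 := by
    refine eventually_eq_zero_of_conjProd_mul (m := m) (y := y)
      ((hrot.analyticAt_comp hg).sub hg) ?_
    filter_upwards [hFg, hrot.eventually hFg] with p h1 h2
    rw [mul_pow, hη.pow_eq_one, one_mul, h1] at h2
    have h3 := conjProd_rotate hm y hη.pow_eq_one p.1 p.2
    simp only [conjProd] at h3 ⊢
    rw [h3] at h2
    rw [mul_sub, ← h2, sub_self]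
  obtain ⟨Q, hQ, hgQ⟩ := exists_eq_pow_fst hm hη hg (hinv.mono fun p hp => sub_eq_zero.mp hp)
  refine ⟨Q, hQ, descend_pow hm ?_⟩
  filter_upwards [hFg, hgQ, hP] with p h1 h2 h3
  rw [h3, ← h2, h1]
  rfl

theorem order_prod {ι : Type*} (s : Finset ι) {f : ι → ℂ → ℂ} (hf : ∀ i ∈ s, AnalyticAt ℂ (f i) 0) :
    analyticOrderAt (fun t => ∏ i ∈ s, f i t) 0 = ∑ i ∈ s, analyticOrderAt (f i) 0 := by
  classical
  induction s using Finset.induction_on with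
  | empty => simpa using order_eq_zero (f := fun _ => 1) one_ne_zero
  | insert i s hi ih =>
    simp only [Finset.prod_insert hi]
    rw [Finset.sum_insert hi, ← ih fun j hj => hf j (by simp [hj]), order_mul (hf i (by simp))
      (Finset.analyticAt_fun_prod s fun j hj => hf j (by simp [hj]))]

theorem order_const_mul_arg {y : ℂ → ℂ} (hy : AnalyticAt ℂ y 0) {c : ℂ} (hc : c ≠ 0) :
    analyticOrderAt (fun t => y (c * t)) 0 = analyticOrderAt y 0 := by
  refine order_comp_of_deriv_ne_zero hy (isMapGerm_const_mul c) ?_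
  simpa using hc

/-- The order of `conjProd` along the graph of a function of `t ^ m`. -/
theorem order_conjProd {m : ℕ} (hm : 0 < m) {y : ℂ → ℂ} (hy : IsMapGerm y) {a : ℂ → ℂ}
    (ha : IsMapGerm a) :
    analyticOrderAt (fun t => conjProd m y (t, a (t ^ m))) 0 =
      m * analyticOrderAt (fun t => a (t ^ m) - y t) 0 := by
  have ham := ha.comp (isMapGerm_pow hm.ne')
  have h1 := order_prod (unityRoots m) (f := fun ζ t => a (t ^ m) - y (ζ * t))
    fun ζ _ => (ham.sub (hy.rotate ζ)).1
  refine h1.trans ?_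
  have h2 : ∀ ζ ∈ unityRoots m, analyticOrderAt (fun t => a (t ^ m) - y (ζ * t)) 0 =
      analyticOrderAt (fun t => a (t ^ m) - y t) 0 := by
    intro ζ hζ
    rw [mem_unityRoots hm] at hζ
    have hζ0 : ζ ≠ 0 := fun h => by simp [h, hm.ne'] at hζ
    rw [← order_const_mul_arg (ham.sub hy).1 hζ0]
    simp only [mul_pow, hζ, one_mul]
  rw [Finset.sum_congr rfl h2, Finset.sum_const, card_unityRoots hm, nsmul_eq_mul]

/-! ### Puiseux charts of irreducible germs -/

theorem enat_mul_right_cancel {a b : ℕ∞} {m : ℕ} (hm : 0 < m) (h : a * m = b * m) : a = b :=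
  (ENat.mul_left_strictMono (by exact_mod_cast hm.ne') (ENat.natCast_ne_top m)).injective h

theorem enat_mul_left_cancel {a b : ℕ∞} {m : ℕ} (hm : 0 < m) (h : m * a = m * b) : a = b :=
  enat_mul_right_cancel hm (by rwa [mul_comm a, mul_comm b])

/-- In the linear coordinates `φ`, the germ `f` is a unit times the minimal polynomial of the
fractional power series `y (x ^ (1 / m))`, whose order is larger than `1`. -/
structure IsPuiseuxChart (f : ℂ × ℂ → ℂ) (φ : (ℂ × ℂ) ≃L[ℂ] (ℂ × ℂ)) (m : ℕ) (y : ℂ → ℂ) :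
    Prop where
  pos : 0 < m
  isMapGerm : IsMapGerm y
  lt_order : (m : ℕ∞) < analyticOrderAt y 0
  distinct : ConjDistinct m y
  factor : ∃ u, AnalyticAt ℂ u 0 ∧ u 0 ≠ 0 ∧
    ∀ᶠ p in 𝓝 (0 : ℂ × ℂ), f (φ (p.1 ^ m, p.2)) = conjProd m y p * u p

theorem isMapGerm_cle (φ : (ℂ × ℂ) ≃L[ℂ] (ℂ × ℂ)) : IsMapGerm (fun p => φ p) :=
  isMapGerm_clm (φ : (ℂ × ℂ) →L[ℂ] (ℂ × ℂ))

/-- Take `n` minimal. If `y` were invariant under a root of unity of order `e > 1`, it would be a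
series in `t ^ e`, giving a root with `n / e` in place of `n`. -/
theorem exists_distinct_root {f : ℂ × ℂ → ℂ} (hf : AnalyticAt ℂ f 0) {d : ℕ} (hd : 1 ≤ d)
    (h : analyticOrderAt (fun w => f (0, w)) 0 = d) :
    ∃ (n : ℕ) (y : ℂ → ℂ), 0 < n ∧ IsMapGerm y ∧ ConjDistinct n y ∧
      ∀ᶠ t in 𝓝 0, f (t ^ n, y t) = 0 := by
  classical
  have hex : ∃ n : ℕ, ∃ y : ℂ → ℂ, 0 < n ∧ IsMapGerm y ∧ ∀ᶠ t in 𝓝 0, f (t ^ n, y t) = 0 :=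
    exists_puiseux_root d hd hf h
  obtain ⟨y, hn, hy, hfy⟩ := Nat.find_spec hex
  have hmin := fun k (hk : k < Nat.find hex) => Nat.find_min hex hk
  generalize Nat.find hex = n at *
  refine ⟨n, y, hn, hy, fun ζ hζ hyζ => ?_, hfy⟩
  by_contra hne
  have hprim := IsPrimitiveRoot.orderOf ζ
  have he0 : 0 < orderOf ζ := orderOf_pos_iff.mpr (isOfFinOrder_iff_pow_eq_one.mpr ⟨n, hn, hζ⟩)
  have he1 : orderOf ζ ≠ 1 := fun h => hne (orderOf_eq_one_iff.mp h)
  obtain ⟨k, hk⟩ := orderOf_dvd_of_pow_eq_one hζ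
  generalize orderOf ζ = e at *
  obtain ⟨g, hg, hyg⟩ := exists_eq_pow_fst he0 hprim (isMapGerm_fst.analyticAt_comp hy.1)
    (isMapGerm_fst.eventually hyζ)
  have hx : IsMapGerm (fun x : ℂ => ((x, 0) : ℂ × ℂ)) := isMapGerm_id.prodMk isMapGerm_zero
  have hyg' : ∀ᶠ t in 𝓝 0, y t = g (t ^ e, 0) := hx.eventually hyg
  have hk0 : 0 < k := Nat.pos_of_ne_zero fun h => by simp [h] at hk; omega
  have hkn : k < n := by
    rw [hk]
    exact lt_mul_of_one_lt_left hk0 (by omega)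
  refine hmin k hkn ⟨fun x => g (x, 0), hk0, ⟨hx.analyticAt_comp hg, ?_⟩, ?_⟩
  · have := hyg'.self_of_nhds
    rw [hy.2, zero_pow he0.ne'] at this
    exact this.symm
  · refine descend_pow_one he0 ?_
    filter_upwards [hfy, hyg'] with t h1 h2
    rw [← pow_mul, ← hk, ← h2, h1]

theorem eventually_comp_cle_iff (φ : (ℂ × ℂ) ≃L[ℂ] (ℂ × ℂ)) {A : ℂ × ℂ → Prop} :
    (∀ᶠ p in 𝓝 (0 : ℂ × ℂ), A (φ p)) ↔ ∀ᶠ p in 𝓝 (0 : ℂ × ℂ), A p := by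
  refine ⟨fun h => ?_, fun h => (isMapGerm_cle φ).eventually h⟩
  have := (isMapGerm_cle φ.symm).eventually h
  simpa using this

/-- A direction `v` outside the tangent cone becomes the `w`-axis, so `f` is regular of order `mult
f` in `w`. The minimal polynomial of a Puiseux root divides `f` and irreducibility makes the
cofactor a unit. Comparing orders on the `w`-axis identifies `n` with `mult f`. -/
theorem IsIrreducibleGerm.exists_chart {f : ℂ × ℂ → ℂ} (h : IsIrreducibleGerm f) :
    ∃ φ y, IsPuiseuxChart f φ (mult f) y := by
  have hfm := h.isMapGerm
  have hf := hfm.1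
  obtain ⟨v, hv⟩ := exists_notMem_tangentCone hf h.ne_zero
  have hord := (order_line hf v).2.mpr hv
  have hv0 : v ≠ 0 := by
    rintro rfl
    simp only [smul_zero, hfm.2] at hord
    rw [analyticOrderAt_eq_top.mpr (by simp)] at hord
    exact (ENat.natCast_ne_top _) hord.symm
  obtain ⟨φ, hφ⟩ := SeparatingDual.exists_continuousLinearEquiv_apply_eq (R := ℂ)
    (show ((0, 1) : ℂ × ℂ) ≠ 0 by simp) hv0
  have hm1 := one_le_mult hfm h.ne_zero
  set m := mult f with hm
  have hφw : ∀ w : ℂ, φ (0, w) = w • v := fun w => by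
    rw [← hφ, ← map_smul]
    simp
  have hf0 : AnalyticAt ℂ (fun p => f (φ p)) 0 := (isMapGerm_cle φ).analyticAt_comp hf
  have hord0 : analyticOrderAt (fun w => f (φ (0, w))) 0 = m := by simpa only [hφw] using hord
  obtain ⟨n, y, hn, hy, hdist, hroot⟩ := exists_distinct_root hf0 hm1 hord0
  obtain ⟨P, hP, hPn⟩ := exists_conjProd_descends hn hy
  obtain ⟨Q, hQ, hfPQ⟩ := dvd_of_vanishes hn hy hdist hf0 hPn hroot
  have hQ0 : Q 0 ≠ 0 := by
    have h1 := ((isIrreducibleGerm_iff hf).mp h).2 (fun p => P (φ.symm p)) (fun p => Q (φ.symm p))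
      ((isMapGerm_cle φ.symm).analyticAt_comp hP.1) ((isMapGerm_cle φ.symm).analyticAt_comp hQ)
      ((eventually_comp_cle_iff φ).mp (by simpa using hfPQ))
    simpa [hP.2] using h1
  have hpow : IsMapGerm (fun p : ℂ × ℂ => (p.1 ^ n, p.2)) :=
    ((isMapGerm_pow hn.ne').comp isMapGerm_fst).prodMk isMapGerm_snd
  have hfac : ∀ᶠ p in 𝓝 (0 : ℂ × ℂ), f (φ (p.1 ^ n, p.2)) = conjProd n y p * Q (p.1 ^ n, p.2) := by
    filter_upwards [hpow.eventually hfPQ, hPn] with p h1 h2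
    rw [h1, h2]
  have hQn : AnalyticAt ℂ (fun p : ℂ × ℂ => Q (p.1 ^ n, p.2)) 0 := hpow.analyticAt_comp hQ
  have hQn0 : Q ((0 : ℂ) ^ n, 0) ≠ 0 := by rwa [zero_pow hn.ne']
  have hnm : n = m := by
    have h1 : analyticOrderAt (fun w => f (φ (0, w))) 0 = n := by
      have h2 : (fun w => f (φ (0, w))) =ᶠ[𝓝 0] fun w => w ^ n * Q ((0 : ℂ) ^ n, w) := by
        filter_upwards [tendsto_axis.eventually hfac] with w hw
        rw [zero_pow hn.ne'] at hw ⊢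
        rw [hw]
        simp [conjProd, hy.2, card_unityRoots hn]
      rw [analyticOrderAt_congr h2, order_pow_mul (tendsto_axis.analyticAt_comp hQn),
        order_eq_zero hQn0, add_zero]
    rw [hord0] at h1
    exact_mod_cast h1.symm
  clear_value m
  subst hnm
  have hx : IsMapGerm (fun x : ℂ => ((x, 0) : ℂ × ℂ)) := isMapGerm_id.prodMk isMapGerm_zero
  -- On the `x`-axis the product formula gives `f` the order of `y`, and no curve meets `f` with
  -- order below `mult f`.
  have hyn : (n : ℕ∞) ≤ analyticOrderAt y 0 := by
    have h1 := (order_curve hf ((isMapGerm_cle φ).comp hx)).1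
    rw [← hm] at h1
    have h2 : analyticOrderAt (fun t => f (φ (t ^ n, 0))) 0 = n * analyticOrderAt y 0 := by
      have h3 : (fun t => f (φ (t ^ n, 0))) =ᶠ[𝓝 0]
          fun t => conjProd n y (t, 0) * Q (t ^ n, 0) := hx.eventually hfac
      have h4 := order_conjProd hn hy (isMapGerm_zero (E := ℂ) (F := ℂ))
      rw [analyticOrderAt_congr h3, order_mul (hx.analyticAt_comp (conjProd_isMapGerm hn hy).1)
        (hx.analyticAt_comp hQn), order_eq_zero (f := fun t => Q (t ^ n, 0)) hQn0, add_zero, h4]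
      congr 1
      rw [← analyticOrderAt_neg]
      congr 1
      funext t
      simp
    have h3 := order_comp_pow (((isMapGerm_cle φ).comp hx).analyticAt_comp hf) hn.ne'
    rw [h3, mul_comm] at h2
    rw [← enat_mul_left_cancel hn h2]
    exact h1
  obtain ⟨g, hg, hyg⟩ := (natCast_le_analyticOrderAt hy.1).mp hyn
  simp only [sub_zero, smul_eq_mul] at hyg
  let c := g 0
  have hct : IsMapGerm (fun t : ℂ => c * t ^ n) := (isMapGerm_const_mul c).comp (isMapGerm_pow hn.ne')
  -- A shear removes the term `c * t ^ n`, making the order larger than `n`. This term is invariant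
  -- under `t ↦ ζ * t`, so the conjugates stay distinct and their product keeps its form.
  let σ : (ℂ × ℂ) ≃L[ℂ] (ℂ × ℂ) := (ContinuousLinearEquiv.refl ℂ ℂ).skewProd
    (ContinuousLinearEquiv.refl ℂ ℂ) (c • ContinuousLinearMap.id ℂ ℂ)
  have hσ : ∀ x w, σ (x, w) = (x, w + c * x) := fun x w => by simp [σ]
  have hshear : IsMapGerm (fun p : ℂ × ℂ => (p.1, p.2 + c * p.1 ^ n)) :=
    isMapGerm_fst.prodMk (isMapGerm_snd.add (hct.comp isMapGerm_fst))
  refine ⟨σ.trans φ, fun t => y t - c * t ^ n, hn, hy.sub hct, ?_, ?_,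
    fun p => Q (p.1 ^ n, p.2 + c * p.1 ^ n), hshear.analyticAt_comp hQn, ?_, ?_⟩
  · have h1 : (fun t => y t - c * t ^ n) =ᶠ[𝓝 0] fun t => t ^ n * (g t - c) := by
      filter_upwards [hyg] with t ht
      rw [ht]
      ring
    have h2 : IsMapGerm (fun t => g t - c) := ⟨hg.sub analyticAt_const, sub_self _⟩
    rw [analyticOrderAt_congr h1, order_pow_mul h2.1]
    have h3 := one_le_order h2
    calc (n : ℕ∞) < ((n + 1 : ℕ) : ℕ∞) := by exact_mod_cast Nat.lt_succ_self n
      _ = n + 1 := by push_cast; rfl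
      _ ≤ _ := by gcongr
  · intro ζ hζ h1
    refine hdist ζ hζ ?_
    filter_upwards [h1] with t ht
    rw [mul_pow, hζ, one_mul] at ht
    exact sub_left_injective ht
  · change Q ((0 : ℂ) ^ n, 0 + c * 0 ^ n) ≠ 0
    rwa [zero_pow hn.ne', mul_zero, add_zero]
  · filter_upwards [hshear.eventually hfac] with p hp
    rw [ContinuousLinearEquiv.trans_apply, hσ, hp]
    congr 1
    refine Finset.prod_congr rfl fun ζ hζ => ?_
    simp only [mul_pow, (mem_unityRoots hn).mp hζ]
    ring

namespace IsPuiseuxChart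

variable {f : ℂ × ℂ → ℂ} {φ : (ℂ × ℂ) ≃L[ℂ] (ℂ × ℂ)} {m : ℕ} {y : ℂ → ℂ}

theorem isMapGerm_curve (h : IsPuiseuxChart f φ m y) : IsMapGerm (fun t => φ (t ^ m, y t)) :=
  (isMapGerm_cle φ).comp ((isMapGerm_pow h.pos.ne').prodMk h.isMapGerm)

theorem vanishes (h : IsPuiseuxChart f φ m y) : ∀ᶠ t in 𝓝 0, f (φ (t ^ m, y t)) = 0 := by
  obtain ⟨u, hu, hu0, hfac⟩ := h.factor
  filter_upwards [(isMapGerm_id.prodMk h.isMapGerm).eventually hfac] with t ht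
  rw [ht, conjProd, Finset.prod_eq_zero ((mem_unityRoots h.pos).mpr (one_pow m)) (by simp),
    zero_mul]

/-- Both `F` and `f` are multiples of the minimal polynomial `P`. The cofactor `R` of `f` agrees
with the unit of the chart after cancelling `conjProd`, hence is invertible, and the quotient is `Q
/ R`. -/
theorem dvd (h : IsPuiseuxChart f φ m y) (hf : AnalyticAt ℂ f 0) {F : ℂ × ℂ → ℂ}
    (hF : AnalyticAt ℂ F 0) (hFy : ∀ᶠ t in 𝓝 0, F (φ (t ^ m, y t)) = 0) :
    ∃ Q, AnalyticAt ℂ Q 0 ∧ ∀ᶠ p in 𝓝 (0 : ℂ × ℂ), F p = f p * Q p := by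
  obtain ⟨u, hu, hu0, hfac⟩ := h.factor
  obtain ⟨P, hP, hPn⟩ := exists_conjProd_descends h.pos h.isMapGerm
  obtain ⟨Q, hQ, hFQ⟩ := dvd_of_vanishes h.pos h.isMapGerm h.distinct
    ((isMapGerm_cle φ).analyticAt_comp hF) hPn hFy
  obtain ⟨R, hR, hfR⟩ := dvd_of_vanishes h.pos h.isMapGerm h.distinct
    ((isMapGerm_cle φ).analyticAt_comp hf) hPn h.vanishes
  have hpow : IsMapGerm (fun p : ℂ × ℂ => (p.1 ^ m, p.2)) :=
    ((isMapGerm_pow h.pos.ne').comp isMapGerm_fst).prodMk isMapGerm_snd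
  have hR0 : R 0 ≠ 0 := by
    have h1 : ∀ᶠ p in 𝓝 (0 : ℂ × ℂ), R (p.1 ^ m, p.2) - u p = 0 := by
      refine eventually_eq_zero_of_conjProd_mul (m := m) (y := y)
        ((hpow.analyticAt_comp hR).sub hu) ?_
      filter_upwards [hpow.eventually hfR, hfac, hPn] with p h1 h2 h3
      rw [mul_sub, ← h2, h1, h3, sub_self]
    have h2 : R ((0 : ℂ) ^ m, 0) - u 0 = 0 := h1.self_of_nhds
    rw [zero_pow h.pos.ne'] at h2
    intro h3
    rw [show R (0, 0) = 0 from h3, zero_sub, neg_eq_zero] at h2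
    exact hu0 h2
  have hQR : AnalyticAt ℂ (fun p => Q p / R p) 0 := hQ.div hR hR0
  refine ⟨fun p => Q (φ.symm p) / R (φ.symm p), (isMapGerm_cle φ.symm).analyticAt_comp hQR,
    (eventually_comp_cle_iff φ).mp ?_⟩
  filter_upwards [hFQ, hfR, hR.continuousAt.eventually_ne hR0] with p h1 h2 h3
  rw [ContinuousLinearEquiv.symm_apply_apply, h1, h2]
  field_simp

/-- Substituting `s = t ^ m` multiplies the order by `m`. The product then has `m` factors of equal
order, since they differ by rotations of `t`; the factor `m` cancels. -/
theorem order_graph (h : IsPuiseuxChart f φ m y) (hf : AnalyticAt ℂ f 0) {a : ℂ → ℂ}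
    (ha : IsMapGerm a) :
    analyticOrderAt (fun s => f (φ (s, a s))) 0 = analyticOrderAt (fun t => a (t ^ m) - y t) 0 := by
  obtain ⟨u, hu, hu0, hfac⟩ := h.factor
  have hc : IsMapGerm (fun t => (t, a (t ^ m))) :=
    isMapGerm_id.prodMk (ha.comp (isMapGerm_pow h.pos.ne'))
  have h1 := order_comp_pow
    (((isMapGerm_cle φ).comp (isMapGerm_id.prodMk ha)).analyticAt_comp hf) h.pos.ne'
  have h2 : (fun t => f (φ (t ^ m, a (t ^ m)))) =ᶠ[𝓝 0]
      fun t => conjProd m y (t, a (t ^ m)) * u (t, a (t ^ m)) := hc.eventually hfac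
  have hu1 : u (0, a (0 ^ m)) ≠ 0 := by
    have := hc.2
    simp only at this
    rwa [this]
  rw [analyticOrderAt_congr h2, order_mul
    (hc.analyticAt_comp (conjProd_isMapGerm h.pos h.isMapGerm).1) (hc.analyticAt_comp hu),
    order_eq_zero (f := fun t => u (t, a (t ^ m))) hu1, add_zero, order_conjProd h.pos h.isMapGerm ha, mul_comm] at h1
  exact (enat_mul_right_cancel h.pos h1).symm

/-- Put `s = t ^ m` and `c ^ m = a`. Each factor `b * t ^ m - y (ζ * (c * t))` has order `m` because
`ord y > m`, so the product has order `m * m`. -/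
theorem order_transversal (h : IsPuiseuxChart f φ m y) (hf : AnalyticAt ℂ f 0) (a : ℂ) {b : ℂ}
    (hb : b ≠ 0) : analyticOrderAt (fun s : ℂ => f (s • φ (a, b))) 0 = m := by
  obtain ⟨u, hu, hu0, hfac⟩ := h.factor
  obtain ⟨c, hc⟩ := IsAlgClosed.exists_pow_nat_eq a h.pos
  have hbt : IsMapGerm (fun t : ℂ => b * t ^ m) :=
    (isMapGerm_const_mul b).comp (isMapGerm_pow h.pos.ne')
  have hcv : IsMapGerm (fun t => (c * t, b * t ^ m)) := (isMapGerm_const_mul c).prodMk hbt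
  have h1 := order_comp_pow ((isMapGerm_smul_const (φ (a, b))).analyticAt_comp hf) h.pos.ne'
  have h2 : (fun t : ℂ => f (t ^ m • φ (a, b))) =ᶠ[𝓝 0]
      fun t => conjProd m y (c * t, b * t ^ m) * u (c * t, b * t ^ m) := by
    filter_upwards [hcv.eventually hfac] with t ht
    rw [← ht, ← map_smul]
    simp [mul_pow, hc, mul_comm]
  have hu1 : u (c * 0, b * 0 ^ m) ≠ 0 := by
    have := hcv.2
    simp only at this
    rwa [this]
  have hord : ∀ ζ ∈ unityRoots m,
      analyticOrderAt (fun t => b * t ^ m - y (ζ * (c * t))) 0 = m := by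
    intro ζ _
    have hyo : (m : ℕ∞) < analyticOrderAt (fun t => y (ζ * (c * t))) 0 := by
      have hzc : IsMapGerm (fun t : ℂ => ζ * (c * t)) :=
        (isMapGerm_const_mul ζ).comp (isMapGerm_const_mul c)
      rw [order_comp h.isMapGerm.1 hzc]
      exact h.lt_order.trans_le (ENat.self_le_mul_right _
        (Order.one_le_iff_ne_zero.mp (one_le_order hzc)))
    have hbo : analyticOrderAt (fun t : ℂ => b * t ^ m) 0 = m := by
      rw [order_mul analyticAt_const (isMapGerm_pow h.pos.ne').1, order_pow, order_eq_zero hb,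
        zero_add]
    have h3 := analyticOrderAt_add_eq_left_of_lt (f := fun t : ℂ => b * t ^ m)
      (g := -fun t => y (ζ * (c * t))) (z₀ := 0) (by rwa [analyticOrderAt_neg, hbo])
    rw [hbo] at h3
    rw [← h3]
    congr 1
  have h4 : analyticOrderAt (fun t => conjProd m y (c * t, b * t ^ m)) 0 = m * m := by
    have := order_prod (unityRoots m) (f := fun ζ t => b * t ^ m - y (ζ * (c * t)))
      fun ζ _ => (hbt.sub ((h.isMapGerm.rotate ζ).comp (isMapGerm_const_mul c))).1
    refine this.trans ?_
    rw [Finset.sum_congr rfl hord, Finset.sum_const, card_unityRoots h.pos, nsmul_eq_mul]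
  rw [analyticOrderAt_congr h2, order_mul
    (hcv.analyticAt_comp (conjProd_isMapGerm h.pos h.isMapGerm).1) (hcv.analyticAt_comp hu),
    order_eq_zero (f := fun t => u (c * t, b * t ^ m)) hu1, add_zero, h4] at h1
  exact (enat_mul_right_cancel h.pos h1).symm

/-- Lines off the `x`-axis meet `f` with order `mult f`; on the axis the order is at least `ord y`,
which is larger. -/
theorem mem_tangentCone_iff (h : IsPuiseuxChart f φ (mult f) y) (hf : AnalyticAt ℂ f 0)
    (v : ℂ × ℂ) : v ∈ tangentCone f ↔ (φ.symm v).2 = 0 := by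
  obtain ⟨⟨a, b⟩, rfl⟩ := φ.surjective v
  rw [ContinuousLinearEquiv.symm_apply_apply]
  constructor
  · intro hv
    by_contra hb
    exact (order_line hf _).2.mp (h.order_transversal hf a hb) hv
  · rintro (rfl : b = 0)
    by_contra hv
    have h1 := (order_line hf _).2.mpr hv
    have h2 := h.order_graph hf (isMapGerm_zero (E := ℂ) (F := ℂ))
    have h3 : analyticOrderAt (fun t => 0 - y t) 0 = analyticOrderAt y 0 := by
      rw [← analyticOrderAt_neg]
      congr 1
      funext t
      simp
    rw [h3] at h2
    have h4 := order_comp (((isMapGerm_cle φ).comp (isMapGerm_id.prodMk isMapGerm_zero)).analyticAt_comp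
      hf) (isMapGerm_const_mul a)
    rw [h2] at h4
    have h5 : (fun s : ℂ => f (s • φ (a, 0))) = fun s => f (φ (a * s, 0)) := by
      funext s
      rw [← map_smul]
      simp [mul_comm]
    rw [h5, h4] at h1
    have h6 := h.lt_order.trans_le (ENat.self_le_mul_right (analyticOrderAt y 0)
      (Order.one_le_iff_ne_zero.mp (one_le_order (isMapGerm_const_mul a))))
    exact h6.ne' h1

/-- Two parameters with the same image differ by a root of unity `ζ` with `y (ζ * t) = y t`. For `ζ
≠ 1` the identity theorem excludes this on a punctured neighbourhood. Zeros of `f` are zeros of some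
factor of `conjProd`, hence lie on the curve. -/
theorem isParametrisation (h : IsPuiseuxChart f φ m y) :
    IsParametrisation (fun t => φ (t ^ m, y t)) f := by
  have hm := h.pos
  refine ⟨h.isMapGerm_curve, ?_, Set.univ, univ_mem, fun U hU _ => ?_⟩
  · have h1 : ∀ᶠ t in 𝓝[≠] (0 : ℂ), ∀ ζ ∈ unityRoots m, ζ ≠ 1 → y (ζ * t) ≠ y t := by
      rw [Filter.eventually_all_finset]
      intro ζ hζ
      by_cases hζ1 : ζ = 1
      · exact Eventually.of_forall fun t h => absurd hζ1 h
      · have h2 := ((h.isMapGerm.rotate ζ).1.eventually_eq_or_eventually_ne h.isMapGerm.1).resolve_left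
          fun h3 => hζ1 (h.distinct ζ ((mem_unityRoots hm).mp hζ) h3)
        exact h2.mono fun t ht _ => ht
    refine ⟨_, eventually_nhdsWithin_iff.mp h1, ?_⟩
    intro s hs t ht hst
    have hst' := φ.injective hst
    simp only [Prod.mk.injEq] at hst'
    by_cases ht0 : t = 0
    · rw [ht0, zero_pow hm.ne'] at hst'
      rw [ht0, pow_eq_zero_iff hm.ne' |>.mp hst'.1]
    · have h2 : (s / t) ^ m = 1 := by
        rw [div_pow, hst'.1, div_self (pow_ne_zero m ht0)]
      by_contra hne
      refine ht ht0 (s / t) ((mem_unityRoots hm).mpr h2) (fun h3 => hne ?_) ?_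
      · exact (div_eq_one_iff_eq ht0).mp h3
      · rw [div_mul_cancel₀ _ ht0, hst'.2]
  · obtain ⟨u, hu, hu0, hfac⟩ := h.factor
    refine (eventually_comp_cle_iff φ).mp (descend_pow hm ?_)
    have hζU : ∀ᶠ p in 𝓝 (0 : ℂ × ℂ), ∀ ζ ∈ unityRoots m, ζ * p.1 ∈ U := by
      rw [Filter.eventually_all_finset]
      exact fun ζ _ => isMapGerm_fst.eventually ((isMapGerm_const_mul ζ).eventually hU)
    filter_upwards [hfac, hu.continuousAt.eventually_ne hu0, hζU] with p h1 h2 h3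
    rw [h1, mul_eq_zero, or_iff_left h2, conjProd, Finset.prod_eq_zero_iff]
    constructor
    · rintro ⟨ζ, hζ, h4⟩
      refine ⟨ζ * p.1, h3 ζ hζ, ?_⟩
      simp only [mul_pow, (mem_unityRoots hm).mp hζ, one_mul, sub_eq_zero.mp h4]
    · rintro ⟨s, _, h4⟩
      have h5 := φ.injective h4
      simp only [Prod.mk.injEq] at h5
      by_cases hp0 : p.1 = 0
      · rw [hp0, zero_pow hm.ne'] at h5
        rw [pow_eq_zero_iff hm.ne' |>.mp h5.1] at h5
        exact ⟨1, (mem_unityRoots hm).mpr (one_pow m), by rw [hp0, mul_zero, h5.2, sub_self]⟩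
      · refine ⟨s / p.1, (mem_unityRoots hm).mpr ?_, ?_⟩
        · rw [div_pow, h5.1, div_self (pow_ne_zero m hp0)]
        · rw [div_mul_cancel₀ _ hp0, h5.2, sub_self]

end IsPuiseuxChart

/-! ### Contact orders in Puiseux coordinates -/

/-- The number `m` together with the orders of contact of `(t ^ m, y t)` with graphs. -/
def graphOrders (m : ℕ) (y : ℂ → ℂ) : Set ℕ :=
  {m} ∪ {n | ∃ a, IsMapGerm a ∧ analyticOrderAt (fun t => a (t ^ m) - y t) 0 = n}

theorem order_neg_sub (f g : ℂ → ℂ) :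
    analyticOrderAt (fun t => f t - g t) 0 = analyticOrderAt (fun t => g t - f t) 0 := by
  rw [← analyticOrderAt_neg]
  congr 1
  funext t
  simp

theorem hasDerivAt_graph {a : ℂ → ℂ} (ha : IsMapGerm a) :
    HasDerivAt (fun s => (s, a s)) ((1 : ℂ), deriv a 0) 0 :=
  (hasDerivAt_id (0 : ℂ)).prodMk ha.1.differentiableAt.hasDerivAt

theorem hasDerivAt_cle_comp (φ : (ℂ × ℂ) ≃L[ℂ] (ℂ × ℂ)) {α : ℂ → ℂ × ℂ} {v : ℂ × ℂ}
    (h : HasDerivAt α v 0) : HasDerivAt (fun s => φ (α s)) (φ v) 0 :=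
  (φ : (ℂ × ℂ) →L[ℂ] (ℂ × ℂ)).hasFDerivAt.comp_hasDerivAt 0 h

namespace IsPuiseuxChart

variable {f : ℂ × ℂ → ℂ} {φ : (ℂ × ℂ) ≃L[ℂ] (ℂ × ℂ)} {m : ℕ} {y : ℂ → ℂ}

theorem isImmersionGerm_graph (φ : (ℂ × ℂ) ≃L[ℂ] (ℂ × ℂ)) {a : ℂ → ℂ} (ha : IsMapGerm a) :
    IsImmersionGerm (fun s => φ (s, a s)) := by
  refine ⟨(isMapGerm_cle φ).comp (isMapGerm_id.prodMk ha), ?_⟩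
  rw [(hasDerivAt_cle_comp φ (hasDerivAt_graph ha)).deriv]
  simp

/-- The tangent vector is horizontal in the chart, so the first coordinate of `α` is a local
parameter and `α` is a reparametrised graph. -/
theorem exists_graph_of_mem_tangentCone (h : IsPuiseuxChart f φ (mult f) y)
    (hf : AnalyticAt ℂ f 0) {α : ℂ → ℂ × ℂ} (hα : IsImmersionGerm α)
    (hv : deriv α 0 ∈ tangentCone f) :
    ∃ a, IsMapGerm a ∧ analyticOrderAt (fun s => f (α s)) 0 =
      analyticOrderAt (fun t => a (t ^ mult f) - y t) 0 := by
  obtain ⟨hα, hα0⟩ := hα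
  have hd := hasDerivAt_cle_comp φ.symm hα.1.differentiableAt.hasDerivAt
  have hβ := (isMapGerm_cle φ.symm).comp hα
  have hx := isMapGerm_fst.comp hβ
  have hw := isMapGerm_snd.comp hβ
  have h2 := (h.mem_tangentCone_iff hf _).mp hv
  have hx0 : deriv (fun s => (φ.symm (α s)).1) 0 ≠ 0 := by
    have h3 : deriv (fun s => (φ.symm (α s)).1) 0 = (φ.symm (deriv α 0)).1 :=
      ((ContinuousLinearMap.fst ℂ ℂ ℂ).hasFDerivAt.comp_hasDerivAt (0 : ℂ) hd).deriv
    rw [h3]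
    intro h1
    exact hα0 (φ.symm.map_eq_zero_iff.mp (Prod.ext h1 h2))
  obtain ⟨σ, hσ, hσ0, -, hσx⟩ := exists_local_inverse hx hx0
  have ha : IsMapGerm (fun x => (φ.symm (α (σ x))).2) := hw.comp hσ
  refine ⟨_, ha, ?_⟩
  rw [← h.order_graph hf ha, ← order_comp_of_deriv_ne_zero
    (((isMapGerm_cle φ).comp (isMapGerm_id.prodMk ha)).analyticAt_comp hf) hx hx0]
  refine analyticOrderAt_congr ?_
  filter_upwards [hσx] with s hs
  rw [hs, Prod.mk.eta, ContinuousLinearEquiv.apply_symm_apply]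

theorem contactOrders_eq (h : IsPuiseuxChart f φ (mult f) y) (hf : AnalyticAt ℂ f 0) :
    contactOrders f = graphOrders (mult f) y := by
  ext n
  constructor
  · rintro ⟨α, hα, hn⟩
    by_cases hv : deriv α 0 ∈ tangentCone f
    · obtain ⟨a, ha, h1⟩ := h.exists_graph_of_mem_tangentCone hf hα hv
      exact Or.inr ⟨a, ha, h1.symm.trans hn⟩
    · have h1 := (order_curve hf hα.1).2.mpr hv
      exact Or.inl (by exact_mod_cast hn.symm.trans h1)
  · rintro (rfl | ⟨a, ha, hn⟩)
    · have hv : φ (0, 1) ∉ tangentCone f := by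
        rw [h.mem_tangentCone_iff hf]
        simp
      refine ⟨fun s => s • φ (0, 1), ⟨isMapGerm_smul_const _, ?_⟩, (order_line hf _).2.mpr hv⟩
      rw [deriv_smul_const]
      simp
    · exact ⟨_, isImmersionGerm_graph φ ha, (h.order_graph hf ha).trans hn⟩

end IsPuiseuxChart

/-! ### Parametrised curves in normal form -/

section Param

variable {m : ℕ} {y : ℂ → ℂ}

theorem fderiv_snd_ne_zero_factor {h g : ℂ × ℂ → ℂ} {a : ℂ → ℂ} (hh : IsMapGerm h)
    (h1 : fderiv ℂ h 0 (0, 1) ≠ 0) (ha : IsMapGerm a) (hg : AnalyticAt ℂ g 0)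
    (hhg : ∀ᶠ p in 𝓝 (0 : ℂ × ℂ), h p = (p.2 - a p.1) * g p) : g 0 ≠ 0 := by
  intro hg0
  have h2 : analyticOrderAt (fun w => h (0, w)) 0 = 1 := by
    refine order_of_deriv_ne_zero (hh.comp tendsto_axis) ?_
    have := deriv_vertical (f := h) (a := 0) (b := 0) (c := 0)
      (by rw [zero_add]; exact hh.1)
    simp only [zero_add] at this
    rw [this]
    exact h1
  have h3 : (fun w => h (0, w)) =ᶠ[𝓝 0] fun w => w ^ 1 * g (0, w) := by
    filter_upwards [tendsto_axis.eventually hhg] with w hw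
    rw [hw, ha.2, sub_zero, pow_one]
  have h4 : IsMapGerm (fun w => g (0, w)) := ⟨tendsto_axis.analyticAt_comp hg, hg0⟩
  rw [analyticOrderAt_congr h3, order_pow_mul h4.1] at h2
  have h5 := one_le_order h4
  have h6 : (1 : ℕ∞) + 1 ≤ 1 := by
    conv_rhs => rw [← h2]
    gcongr
    simp
  exact absurd h6 (by decide)

/-- If the `w`-derivative of the submersion vanishes, its linear part is a multiple of `x` and the
order is `m`, because `ord y > m`. Otherwise its zero set is a graph `w = a x` and it is a unit
times `w - a x`. -/
theorem paramContactOrders_eq (hm : 0 < m) (hy : IsMapGerm y)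
    (hmy : (m : ℕ∞) < analyticOrderAt y 0) :
    paramContactOrders (fun t => (t ^ m, y t)) = graphOrders m y := by
  have hγ : IsMapGerm (fun t => (t ^ m, y t)) := (isMapGerm_pow hm.ne').prodMk hy
  ext n
  constructor
  · rintro ⟨h, ⟨hh, hh0⟩, hn⟩
    change analyticOrderAt (fun t => h (t ^ m, y t)) 0 = n at hn
    by_cases h1 : fderiv ℂ h 0 (0, 1) = 0
    · left
      obtain ⟨g, hg, hhg⟩ := exists_eq_add_snd_mul hh.1
      have hx : IsMapGerm (fun x : ℂ => ((x, 0) : ℂ × ℂ)) := isMapGerm_id.prodMk isMapGerm_zero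
      have h2 : fderiv ℂ h 0 (1, 0) ≠ 0 := by
        intro h3
        refine hh0 (ContinuousLinearMap.ext fun v => ?_)
        have h4 : v = v.1 • ((1, 0) : ℂ × ℂ) + v.2 • ((0, 1) : ℂ × ℂ) := by ext <;> simp
        rw [h4, map_add, map_smul, map_smul, h1, h3]
        simp
      have h3 : analyticOrderAt (fun x => h (x, 0)) 0 = 1 := by
        refine order_of_deriv_ne_zero (hh.comp hx) ?_
        have h4 : HasDerivAt (fun x : ℂ => ((x, 0) : ℂ × ℂ)) (1, 0) 0 :=
          (hasDerivAt_id (0 : ℂ)).prodMk (hasDerivAt_const _ _)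
        rw [deriv_comp_curve (f := h) (α := fun x : ℂ => (x, 0)) hh.1 h4]
        exact h2
      have h4 := order_comp_pow (hx.analyticAt_comp hh.1) hm.ne'
      rw [h3, one_mul] at h4
      have h5 : (fun t => h (t ^ m, y t)) =ᶠ[𝓝 0]
          (fun t => h (t ^ m, 0)) + fun t => y t * g (t ^ m, y t) := hγ.eventually hhg
      have h6 : (m : ℕ∞) < analyticOrderAt (fun t => y t * g (t ^ m, y t)) 0 := by
        rw [order_mul hy.1 (hγ.analyticAt_comp hg)]
        exact hmy.trans_le le_self_add
      rw [analyticOrderAt_congr h5, analyticOrderAt_add_eq_left_of_lt (by rwa [h4]), h4] at hn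
      exact (by exact_mod_cast hn.symm : n = m)
    · right
      obtain ⟨a, ha, hha⟩ := exists_implicit hh h1
      obtain ⟨g, hg, hhg⟩ := exists_eq_sub_mul hh.1 ha hha
      have hg0 := fderiv_snd_ne_zero_factor hh h1 ha hg hhg
      refine ⟨a, ha, ?_⟩
      have h5 : (fun t => h (t ^ m, y t)) =ᶠ[𝓝 0]
          fun t => (y t - a (t ^ m)) * g (t ^ m, y t) := hγ.eventually hhg
      have hg1 : g (0 ^ m, y 0) ≠ 0 := by
        have := hγ.2
        simp only at this
        rwa [this]
      rw [analyticOrderAt_congr h5, order_mul (hy.sub (ha.comp (isMapGerm_pow hm.ne'))).1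
        (hγ.analyticAt_comp hg), order_eq_zero (f := fun t => g (t ^ m, y t)) hg1, add_zero] at hn
      rw [order_neg_sub, hn]
  · rintro (rfl | ⟨a, ha, hn⟩)
    · refine ⟨fun p => p.1, ⟨isMapGerm_fst, ?_⟩, order_pow n⟩
      intro h1
      have h2 : fderiv ℂ (fun p : ℂ × ℂ => p.1) 0 = ContinuousLinearMap.fst ℂ ℂ ℂ :=
        hasFDerivAt_fst.fderiv
      rw [h2] at h1
      simpa using congrArg (fun l => l ((1, 0) : ℂ × ℂ)) h1
    · have hh : IsMapGerm (fun p : ℂ × ℂ => p.2 - a p.1) := isMapGerm_snd.sub (ha.comp isMapGerm_fst)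
      refine ⟨fun p => p.2 - a p.1, ⟨hh, fun h1 => ?_⟩, ?_⟩
      · have h2 := deriv_vertical (f := fun p : ℂ × ℂ => p.2 - a p.1) (a := 0) (b := 0) (c := 0)
          (by rw [zero_add]; exact hh.1)
        simp only [zero_add] at h2
        rw [show ((0, 0) : ℂ × ℂ) = 0 from rfl, h1] at h2
        simp at h2
      · rw [← hn, order_neg_sub]
        rfl

/-- Truncate the Taylor series of `a` after degree `k`: the substitution leaves powers of `t ^ m`
and a remainder divisible by `t ^ (k + 1)`. -/
theorem iteratedDeriv_comp_pow_eq_zero {a : ℂ → ℂ} (ha : AnalyticAt ℂ a 0) (hm : 0 < m) {k : ℕ}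
    (hk : ¬ m ∣ k) : iteratedDeriv k (fun t => a (t ^ m)) 0 = 0 := by
  obtain ⟨F, hF, haF⟩ := ha.exists_eventuallyEq_sum_add_pow_mul (k + 1)
  have hpow : IsMapGerm (fun t : ℂ => t ^ m) := isMapGerm_pow hm.ne'
  set c : ℕ → ℂ := fun i => iteratedDeriv i a 0 / i.factorial with hc
  have hg : AnalyticAt ℂ (fun t => t ^ ((m - 1) * (k + 1)) * F (t ^ m)) 0 :=
    (analyticAt_id.pow _).mul (hpow.analyticAt_comp hF)
  have hr : AnalyticAt ℂ (fun t => t ^ (k + 1) * (t ^ ((m - 1) * (k + 1)) * F (t ^ m))) 0 := by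
    exact (isMapGerm_pow (Nat.succ_ne_zero k)).1.mul hg
  have h1 : (fun t => a (t ^ m)) =ᶠ[𝓝 0] fun t => (∑ i ∈ Finset.range (k + 1), c i * t ^ (m * i)) +
      t ^ (k + 1) * (t ^ ((m - 1) * (k + 1)) * F (t ^ m)) := by
    filter_upwards [hpow.eventually haF] with t ht
    rw [ht]
    congr 1
    · refine Finset.sum_congr rfl fun i _ => ?_
      rw [hc, pow_mul, smul_eq_mul]
      ring
    · rw [smul_eq_mul, ← mul_assoc, ← pow_add, ← pow_mul]
      congr 2
      obtain ⟨j, rfl⟩ : ∃ j, m = j + 1 := ⟨m - 1, by omega⟩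
      simp only [Nat.add_sub_cancel]
      ring
  have h2 : iteratedDeriv k (fun t => t ^ (k + 1) * (t ^ ((m - 1) * (k + 1)) * F (t ^ m))) 0 = 0 := by
    refine (natCast_le_analyticOrderAt_iff_iteratedDeriv_eq_zero (n := k + 1) hr).mp ?_ k (by omega)
    rw [order_pow_mul hg]
    exact le_self_add
  have h3 : AnalyticAt ℂ (fun t : ℂ => ∑ i ∈ Finset.range (k + 1), c i * t ^ (m * i)) 0 := by
    fun_prop
  rw [Filter.EventuallyEq.iteratedDeriv_eq k h1, iteratedDeriv_fun_add h3.contDiffAt hr.contDiffAt,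
    h2, add_zero, iteratedDeriv_fun_sum fun i _ => AnalyticAt.contDiffAt (by fun_prop)]
  refine Finset.sum_eq_zero fun i _ => ?_
  rw [iteratedDeriv_const_mul_field (c i) (fun t => t ^ (m * i)), iteratedDeriv_fun_pow_zero,
    if_neg (fun h => hk ⟨i, h⟩), Nat.cast_zero, mul_zero]

theorem natCast_le_lowestNonMultiple_iff {n : ℕ} : (n : ℕ∞) ≤ lowestNonMultiple m y ↔
    ∀ k < n, ¬ m ∣ k → iteratedDeriv k y 0 = 0 := by
  simp only [lowestNonMultiple, le_iInf_iff]
  constructor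
  · intro h k hk hmk
    by_contra hne
    exact absurd (h k ⟨hmk, hne⟩) (by exact_mod_cast not_le.mpr hk)
  · rintro h k ⟨hmk, hne⟩
    by_contra hlt
    exact hne (h k (by exact_mod_cast not_le.mp hlt) hmk)

theorem lowestNonMultiple_eq_natCast_iff {n : ℕ} : lowestNonMultiple m y = n ↔
    (∀ k < n, ¬ m ∣ k → iteratedDeriv k y 0 = 0) ∧ ¬ m ∣ n ∧ iteratedDeriv n y 0 ≠ 0 := by
  rw [← natCast_le_lowestNonMultiple_iff]
  constructor
  · intro h
    refine ⟨h.ge, ?_⟩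
    by_contra hn
    have h1 : ((n + 1 : ℕ) : ℕ∞) ≤ lowestNonMultiple m y := by
      rw [natCast_le_lowestNonMultiple_iff]
      intro k hk hmk
      rcases Nat.lt_succ_iff_lt_or_eq.mp hk with hk | rfl
      · exact natCast_le_lowestNonMultiple_iff.mp h.ge k hk hmk
      · by_contra hne
        exact hn ⟨hmk, hne⟩
    rw [h] at h1
    exact absurd h1 (by exact_mod_cast not_le.mpr (Nat.lt_succ_self n))
  · rintro ⟨h1, h2⟩
    exact le_antisymm (iInf₂_le n h2) h1

theorem lt_lowestNonMultiple (hy : AnalyticAt ℂ y 0) (hmy : (m : ℕ∞) < analyticOrderAt y 0) :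
    (m : ℕ∞) < lowestNonMultiple m y := by
  have h1 : ((m + 1 : ℕ) : ℕ∞) ≤ analyticOrderAt y 0 := by
    push_cast
    exact Order.add_one_le_of_lt hmy
  have h2 : ((m + 1 : ℕ) : ℕ∞) ≤ lowestNonMultiple m y := by
    rw [natCast_le_lowestNonMultiple_iff]
    exact fun k hk _ => (natCast_le_analyticOrderAt_iff_iteratedDeriv_eq_zero hy).mp h1 k hk
  exact lt_of_lt_of_le (by exact_mod_cast Nat.lt_succ_self m) h2

/-- Below the first exponent that is not divisible by `m`, the series `y t` is a polynomial
in `t ^ m`. -/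
theorem exists_truncation (hm : 0 < m) (hy : IsMapGerm y) {n : ℕ}
    (hn : (n : ℕ∞) ≤ lowestNonMultiple m y) :
    ∃ (a F : ℂ → ℂ), IsMapGerm a ∧ AnalyticAt ℂ F 0 ∧
      ∀ᶠ t in 𝓝 0, y t = a (t ^ m) + t ^ n * F t := by
  obtain ⟨F, hF, hyF⟩ := hy.1.exists_eventuallyEq_sum_add_pow_mul n
  rw [natCast_le_lowestNonMultiple_iff] at hn
  refine ⟨fun x => ∑ i ∈ Finset.range n,
    (x ^ (i / m) / i.factorial) * if m ∣ i then iteratedDeriv i y 0 else 0, F,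
    ⟨by fun_prop, ?_⟩, hF, ?_⟩
  · refine Finset.sum_eq_zero fun i _ => ?_
    split_ifs with h
    · obtain ⟨j, rfl⟩ := h
      rw [Nat.mul_div_cancel_left j hm]
      rcases Nat.eq_zero_or_pos j with rfl | hj
      · simp [hy.2]
      · simp [hj.ne']
    · simp
  · filter_upwards [hyF] with t ht
    rw [ht]
    congr 1
    refine Finset.sum_congr rfl fun i hi => ?_
    split_ifs with h
    · rw [← pow_mul, Nat.mul_div_cancel' h, smul_eq_mul]
    · rw [hn i (Finset.mem_range.mp hi) h, smul_zero, mul_zero]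

/-- Subtracting `a (t ^ m)` leaves the coefficients of `y` at exponents not divisible by `m`
untouched, while all others can be prescribed, apart from the zero constant term. -/
theorem graphOrders_eq (hm : 0 < m) (hy : IsMapGerm y) (hmy : (m : ℕ∞) < analyticOrderAt y 0) :
    graphOrders m y = {n | ∃ k, 1 ≤ k ∧ n = k * m ∧ (n : ℕ∞) < lowestNonMultiple m y} ∪
      {n | lowestNonMultiple m y = n} := by
  ext n
  constructor
  · rintro (rfl | ⟨a, ha, hn⟩)
    · exact Or.inl ⟨1, le_rfl, (one_mul _).symm, lt_lowestNonMultiple hy.1 hmy⟩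
    · have ham := ha.comp (isMapGerm_pow hm.ne')
      have hder : ∀ k, ¬ m ∣ k → iteratedDeriv k (fun t => a (t ^ m) - y t) 0 =
          - iteratedDeriv k y 0 := fun k hk => by
        rw [iteratedDeriv_fun_sub ham.1.contDiffAt hy.1.contDiffAt,
          iteratedDeriv_comp_pow_eq_zero ha.1 hm hk, zero_sub]
      have h1 := (natCast_le_analyticOrderAt_iff_iteratedDeriv_eq_zero (ham.sub hy).1).mp hn.ge
      have hle : ∀ k < n, ¬ m ∣ k → iteratedDeriv k y 0 = 0 := fun k hk hmk =>
        neg_eq_zero.mp ((hder k hmk).symm.trans (h1 k hk))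
      by_cases hmn : m ∣ n
      · left
        obtain ⟨k, rfl⟩ := hmn
        refine ⟨k, ?_, mul_comm _ _, lt_of_le_of_ne (natCast_le_lowestNonMultiple_iff.mpr hle) ?_⟩
        · have h2 := one_le_order (ham.sub hy)
          rw [hn] at h2
          by_contra hk
          simp [show k = 0 by omega] at h2
        · intro h2
          exact (lowestNonMultiple_eq_natCast_iff.mp h2.symm).2.1 (dvd_mul_right m k)
      · right
        refine lowestNonMultiple_eq_natCast_iff.mpr ⟨hle, hmn, fun h2 => ?_⟩
        have h3 : ((n + 1 : ℕ) : ℕ∞) ≤ analyticOrderAt (fun t => a (t ^ m) - y t) 0 := by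
          refine (natCast_le_analyticOrderAt_iff_iteratedDeriv_eq_zero (ham.sub hy).1).mpr ?_
          intro k hk
          rcases Nat.lt_succ_iff_lt_or_eq.mp hk with hk | rfl
          · exact h1 k hk
          · rw [hder k hmn, h2, neg_zero]
        rw [hn] at h3
        exact absurd h3 (by exact_mod_cast not_le.mpr (Nat.lt_succ_self n))
  · rintro (⟨k, hk, rfl, hlt⟩ | hn)
    · right
      obtain ⟨a, F, ha, hF, hyF⟩ := exists_truncation hm hy hlt.le
      -- The coefficient `F 0 + 1` makes the difference start with `1 * t ^ (k * m)`.
      refine ⟨fun x => a x + (F 0 + 1) * x ^ k,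
        ha.add ((isMapGerm_const_mul _).comp (isMapGerm_pow (by omega))), ?_⟩
      have h1 : (fun t => a (t ^ m) + (F 0 + 1) * (t ^ m) ^ k - y t) =ᶠ[𝓝 0]
          fun t => t ^ (k * m) * (F 0 + 1 - F t) := by
        filter_upwards [hyF] with t ht
        rw [ht, ← pow_mul, mul_comm m k]
        ring
      rw [analyticOrderAt_congr h1, order_pow_mul (by fun_prop),
        order_eq_zero (f := fun t => F 0 + 1 - F t) (by simp), add_zero]
    · right
      have hn' : lowestNonMultiple m y = n := hn
      obtain ⟨a, F, ha, hF, hyF⟩ := exists_truncation hm hy hn'.ge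
      have ham := ha.comp (isMapGerm_pow hm.ne')
      refine ⟨a, ha, ?_⟩
      have h1 : (fun t => y t - a (t ^ m)) =ᶠ[𝓝 0] fun t => t ^ n * F t := by
        filter_upwards [hyF] with t ht
        rw [ht]
        ring
      obtain ⟨-, hmn, hder⟩ := lowestNonMultiple_eq_natCast_iff.mp hn'
      refine le_antisymm ?_ ?_
      · by_contra hlt
        have h2 : ((n + 1 : ℕ) : ℕ∞) ≤ analyticOrderAt (fun t => a (t ^ m) - y t) 0 := by
          push_cast
          exact Order.add_one_le_of_lt (not_le.mp hlt)
        have h3 := (natCast_le_analyticOrderAt_iff_iteratedDeriv_eq_zero (ham.sub hy).1).mp h2 n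
          (Nat.lt_succ_self n)
        rw [iteratedDeriv_fun_sub ham.1.contDiffAt hy.1.contDiffAt,
          iteratedDeriv_comp_pow_eq_zero ha.1 hm hmn, zero_sub, neg_eq_zero] at h3
        exact hder h3
      · rw [order_neg_sub, analyticOrderAt_congr h1, order_pow_mul hF]
        exact le_self_add

/-- The set determines both data: `m` is its minimum, and the exponent is its only element not
divisible by `m`, or `⊤` if there is none. This shows that all normal forms yield the same Puiseux
exponent. -/
theorem lowestNonMultiple_eq_of_graphOrders_eq {m' : ℕ} {y' : ℂ → ℂ} (hm : 0 < m)
    (hy : IsMapGerm y) (hmy : (m : ℕ∞) < analyticOrderAt y 0) (hm' : 0 < m')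
    (hy' : IsMapGerm y') (hmy' : (m' : ℕ∞) < analyticOrderAt y' 0)
    (h : graphOrders m y = graphOrders m' y') :
    lowestNonMultiple m y = lowestNonMultiple m' y' := by
  have hmin : ∀ {m : ℕ} {y : ℂ → ℂ}, 0 < m → IsMapGerm y → (m : ℕ∞) < analyticOrderAt y 0 →
      ∀ n ∈ graphOrders m y, m ≤ n := by
    intro m y hm hy hmy n hn
    rw [graphOrders_eq hm hy hmy] at hn
    rcases hn with ⟨k, hk, rfl, -⟩ | hn
    · exact Nat.le_mul_of_pos_left m hk
    · have h1 := lt_lowestNonMultiple hy.1 hmy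
      rw [show lowestNonMultiple m y = n from hn] at h1
      exact_mod_cast h1.le
  have hchar : ∀ {m : ℕ} {y : ℂ → ℂ}, 0 < m → IsMapGerm y → (m : ℕ∞) < analyticOrderAt y 0 →
      ∀ n : ℕ, lowestNonMultiple m y = n ↔ n ∈ graphOrders m y ∧ ¬ m ∣ n := by
    intro m y hm hy hmy n
    rw [graphOrders_eq hm hy hmy]
    constructor
    · exact fun hn => ⟨Or.inr hn, (lowestNonMultiple_eq_natCast_iff.mp hn).2.1⟩
    · rintro ⟨⟨k, -, rfl, -⟩ | hn, hmn⟩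
      · exact absurd (dvd_mul_left m k) hmn
      · exact hn
  have hmm : m = m' := le_antisymm (hmin hm hy hmy m' (h ▸ Or.inl rfl))
    (hmin hm' hy' hmy' m (h ▸ Or.inl rfl))
  have hiff : ∀ n : ℕ, lowestNonMultiple m y = n ↔ lowestNonMultiple m' y' = n := fun n => by
    rw [hchar hm hy hmy, hchar hm' hy' hmy', h, hmm]
  cases h1 : lowestNonMultiple m y with
  | top =>
    cases h2 : lowestNonMultiple m' y' with
    | top => rfl
    | coe n => exact absurd ((hiff n).mpr h2) (by simp [h1])
  | coe n => exact ((hiff n).mp h1).symm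

end Param

/-! ### Invariance of the contact orders -/

section Diffeo

variable {E F : Type*} [NormedAddCommGroup E] [NormedSpace ℂ E]
  [NormedAddCommGroup F] [NormedSpace ℂ F]

theorem IsDiffeoGerm.exists_inverse {φ : E → E} (h : IsDiffeoGerm φ) :
    ∃ χ, IsDiffeoGerm χ ∧ (∀ᶠ x in 𝓝 0, χ (φ x) = x) ∧ ∀ᶠ x in 𝓝 0, φ (χ x) = x := by
  obtain ⟨hφ, χ, hχ, h1, h2⟩ := h
  exact ⟨χ, ⟨hχ, φ, hφ, h2, h1⟩, h1, h2⟩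

theorem isDiffeoGerm_id : IsDiffeoGerm (fun x : E => x) :=
  ⟨isMapGerm_id, fun x => x, isMapGerm_id, EventuallyEq.rfl, EventuallyEq.rfl⟩

theorem isDiffeoGerm_cle (φ : (ℂ × ℂ) ≃L[ℂ] (ℂ × ℂ)) : IsDiffeoGerm (fun p => φ p) :=
  ⟨isMapGerm_cle φ, fun p => φ.symm p, isMapGerm_cle φ.symm,
    Eventually.of_forall fun p => φ.symm_apply_apply p,
    Eventually.of_forall fun p => φ.apply_symm_apply p⟩

theorem IsDiffeoGerm.comp {φ ψ : E → E} (hφ : IsDiffeoGerm φ) (hψ : IsDiffeoGerm ψ) :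
    IsDiffeoGerm (fun x => φ (ψ x)) := by
  obtain ⟨φ', hφ', h1, h2⟩ := hφ.exists_inverse
  obtain ⟨ψ', hψ', h3, h4⟩ := hψ.exists_inverse
  refine ⟨hφ.1.comp hψ.1, fun x => ψ' (φ' x), hψ'.1.comp hφ'.1, ?_, ?_⟩
  · filter_upwards [hψ.1.eventually h1, h3] with x h5 h6
    simp only [Function.comp_apply, h5, h6, id]
  · filter_upwards [hφ'.1.eventually h4, h2] with x h5 h6
    simp only [Function.comp_apply, h5, h6, id]

theorem IsMapGerm.hasFDerivAt {f : E → F} (h : IsMapGerm f) : HasFDerivAt f (fderiv ℂ f 0) 0 :=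
  h.1.differentiableAt.hasFDerivAt

theorem IsMapGerm.fderiv_comp {f : E → F} (hf : IsMapGerm f) {G : Type*} [NormedAddCommGroup G]
    [NormedSpace ℂ G] {g : F → G} (hg : AnalyticAt ℂ g 0) :
    fderiv ℂ (fun x => g (f x)) 0 = (fderiv ℂ g 0).comp (fderiv ℂ f 0) := by
  have h1 : HasFDerivAt g (fderiv ℂ g 0) (f 0) := by
    rw [hf.2]
    exact hg.differentiableAt.hasFDerivAt
  exact (h1.comp 0 hf.hasFDerivAt).fderiv

theorem fderiv_comp_inverse {φ χ : E → E} (hφ : IsMapGerm φ) (hχ : IsMapGerm χ)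
    (h : ∀ᶠ x in 𝓝 0, φ (χ x) = x) (v : E) : fderiv ℂ φ 0 (fderiv ℂ χ 0 v) = v := by
  have h1 := hχ.fderiv_comp hφ.1
  rw [Filter.EventuallyEq.fderiv_eq h] at h1
  have h2 := congrArg (fun l => l v) h1
  simp only [ContinuousLinearMap.comp_apply] at h2
  rw [← h2]
  simp

theorem IsDiffeoGerm.deriv_ne_zero {φ : ℂ → ℂ} (h : IsDiffeoGerm φ) : deriv φ 0 ≠ 0 := by
  obtain ⟨χ, hχ, -, h2⟩ := h.exists_inverse
  intro h0
  have h3 := fderiv_comp_inverse h.1 hχ.1 h2 1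
  have h4 : fderiv ℂ φ 0 = 0 := by
    ext
    simpa using h0
  simp [h4] at h3

theorem IsSubmersionGerm.comp {h : ℂ × ℂ → ℂ} (hh : IsSubmersionGerm h) {ψ : ℂ × ℂ → ℂ × ℂ}
    (hψ : IsDiffeoGerm ψ) : IsSubmersionGerm (fun p => h (ψ p)) := by
  obtain ⟨χ, hχ, -, h2⟩ := hψ.exists_inverse
  refine ⟨hh.1.comp hψ.1, fun h0 => hh.2 (ContinuousLinearMap.ext fun v => ?_)⟩
  rw [hψ.1.fderiv_comp hh.1.1] at h0
  rw [← fderiv_comp_inverse hψ.1 hχ.1 h2 v]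
  exact congrArg (fun l => l (fderiv ℂ χ 0 v)) h0

theorem IsImmersionGerm.comp {α : ℂ → ℂ × ℂ} (hα : IsImmersionGerm α) {ψ : ℂ × ℂ → ℂ × ℂ}
    (hψ : IsDiffeoGerm ψ) : IsImmersionGerm (fun s => ψ (α s)) := by
  obtain ⟨χ, hχ, h1, -⟩ := hψ.exists_inverse
  refine ⟨hψ.1.comp hα.1, fun h0 => hα.2 ?_⟩
  have h2 : deriv (fun s => ψ (α s)) 0 = fderiv ℂ ψ 0 (deriv α 0) := by
    rw [← fderiv_apply_one_eq_deriv, hα.1.fderiv_comp hψ.1.1, ContinuousLinearMap.comp_apply,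
      fderiv_apply_one_eq_deriv]
  rw [← fderiv_comp_inverse hχ.1 hψ.1 h1 (deriv α 0), ← h2, h0, map_zero]

end Diffeo

theorem AEquiv.paramContactOrders_eq {γ₁ γ₂ : ℂ → ℂ × ℂ} (h₁ : IsMapGerm γ₁)
    (h₂ : IsMapGerm γ₂)
    (h : AEquiv γ₁ γ₂) : paramContactOrders γ₁ = paramContactOrders γ₂ := by
  obtain ⟨φ, ψ, hφ, hψ, h⟩ := h
  have key : ∀ g : ℂ × ℂ → ℂ, IsMapGerm g →
      analyticOrderAt (fun t => g (ψ (γ₁ t))) 0 = analyticOrderAt (fun t => g (γ₂ t)) 0 := by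
    intro g hg
    rw [← order_comp_of_deriv_ne_zero (h₂.analyticAt_comp hg.1) hφ.1 hφ.deriv_ne_zero]
    refine analyticOrderAt_congr ?_
    filter_upwards [h] with t ht
    exact congrArg g ht.symm
  obtain ⟨χ, hχ, h3, -⟩ := hψ.exists_inverse
  ext n
  constructor
  · rintro ⟨g, hg, hn⟩
    refine ⟨fun p => g (χ p), hg.comp hχ, (key _ (hg.comp hχ).1).symm.trans (Eq.trans ?_ hn)⟩
    refine analyticOrderAt_congr ?_
    filter_upwards [h₁.eventually h3] with t ht
    rw [ht]
    rfl
  · rintro ⟨g, hg, hn⟩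
    exact ⟨fun p => g (ψ p), hg.comp hψ, (key g hg.1).trans hn⟩

theorem KEquiv.contactOrders_eq {f₁ f₂ : ℂ × ℂ → ℂ} (h₁ : AnalyticAt ℂ f₁ 0)
    (h : KEquiv f₁ f₂) : contactOrders f₁ = contactOrders f₂ := by
  obtain ⟨φ, A, hφ, hA, hA0, h⟩ := h
  have key : ∀ α, IsImmersionGerm α →
      analyticOrderAt (fun s => f₂ (α s)) 0 = analyticOrderAt (fun s => f₁ (φ (α s))) 0 := by
    intro α hα
    have h1 : (fun s => f₂ (α s)) =ᶠ[𝓝 0] fun s => A (α s) * f₁ (φ (α s)) := hα.1.eventually h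
    have hA1 : A (α 0) ≠ 0 := by rwa [hα.1.2]
    rw [analyticOrderAt_congr h1, order_mul (hα.1.analyticAt_comp hA)
      ((hφ.1.comp hα.1).analyticAt_comp h₁), order_eq_zero (f := fun s => A (α s)) hA1, zero_add]
  obtain ⟨χ, hχ, -, h4⟩ := hφ.exists_inverse
  ext n
  constructor
  · rintro ⟨α, hα, hn⟩
    refine ⟨fun s => χ (α s), hα.comp hχ, (key _ (hα.comp hχ)).trans (Eq.trans ?_ hn)⟩
    refine analyticOrderAt_congr ?_
    filter_upwards [hα.1.eventually h4] with s hs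
    rw [hs]
    rfl
  · rintro ⟨α, hα, hn⟩
    exact ⟨fun s => φ (α s), hα.comp hφ, (key α hα).symm.trans hn⟩

theorem contactOrders_unit_mul {f g u : ℂ × ℂ → ℂ} (hg : AnalyticAt ℂ g 0) (hu : AnalyticAt ℂ u 0)
    (hu0 : u 0 ≠ 0) (h : ∀ᶠ p in 𝓝 0, f p = u p * g p) : contactOrders f = contactOrders g :=
  (KEquiv.contactOrders_eq hg ⟨fun p => p, u, isDiffeoGerm_id, hu, hu0, h⟩).symm

theorem contactOrders_congr {f g : ℂ × ℂ → ℂ} (hg : AnalyticAt ℂ g 0) (h : f =ᶠ[𝓝 0] g) :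
    contactOrders f = contactOrders g :=
  contactOrders_unit_mul hg (u := fun _ => 1) analyticAt_const one_ne_zero
    (h.mono fun p hp => by rw [hp, one_mul])

/-! ### Factorisation into irreducible germs -/

theorem analyticAt_prod {ι : Type*} [Fintype ι] {F : ι → ℂ × ℂ → ℂ}
    (hF : ∀ i, AnalyticAt ℂ (F i) 0) : AnalyticAt ℂ (fun p => ∏ i, F i p) 0 :=
  Finset.analyticAt_fun_prod _ fun i _ => hF i

/-- Compare orders along a line outside the tangent cone of the product. The inequality suffices for
the induction below. -/
theorem mult_add_le {f a b : ℂ × ℂ → ℂ} (hf : AnalyticAt ℂ f 0) (hf0 : ¬ ∀ᶠ p in 𝓝 0, f p = 0)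
    (ha : AnalyticAt ℂ a 0) (hb : AnalyticAt ℂ b 0) (h : ∀ᶠ p in 𝓝 0, f p = a p * b p) :
    mult a + mult b ≤ mult f := by
  obtain ⟨v, hv⟩ := exists_notMem_tangentCone hf hf0
  have h1 := (order_line hf v).2.mpr hv
  have hl := isMapGerm_smul_const v
  have h2 : (fun s : ℂ => f (s • v)) =ᶠ[𝓝 0] fun s => a (s • v) * b (s • v) := hl.eventually h
  rw [analyticOrderAt_congr h2, order_mul (hl.analyticAt_comp ha) (hl.analyticAt_comp hb)] at h1
  have h3 := add_le_add (order_line ha v).1 (order_line hb v).1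
  rw [h1] at h3
  exact_mod_cast h3

/-- Nonunit factors of a nonzero germ have multiplicity at least `1`, so splitting lowers the
multiplicity and induction applies. -/
theorem exists_factorization {f : ℂ × ℂ → ℂ} (hf : AnalyticAt ℂ f 0)
    (hf0 : ¬ ∀ᶠ p in 𝓝 0, f p = 0) :
    ∃ (ι : Type) (_ : Fintype ι) (F : ι → ℂ × ℂ → ℂ) (u : ℂ × ℂ → ℂ),
      (∀ i, IsIrreducibleGerm (F i)) ∧ AnalyticAt ℂ u 0 ∧ u 0 ≠ 0 ∧
        ∀ᶠ p in 𝓝 0, f p = u p * ∏ i, F i p := by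
  induction hn : mult f using Nat.strong_induction_on generalizing f with
  | h n ih =>
    by_cases h0 : f 0 = 0
    · by_cases hirr : IsIrreducibleGerm f
      · exact ⟨Unit, inferInstance, fun _ => f, fun _ => 1, fun _ => hirr, analyticAt_const,
          one_ne_zero, Eventually.of_forall fun p => by simp⟩
      · rw [isIrreducibleGerm_iff hf] at hirr
        push Not at hirr
        obtain ⟨a, b, ha, hb, hab, ha0, hb0⟩ := hirr h0
        have ha1 : ¬ ∀ᶠ p in 𝓝 0, a p = 0 := fun h => hf0 (by
          filter_upwards [h, hab] with p h1 h2
          rw [h2, h1, zero_mul])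
        have hb1 : ¬ ∀ᶠ p in 𝓝 0, b p = 0 := fun h => hf0 (by
          filter_upwards [h, hab] with p h1 h2
          rw [h2, h1, mul_zero])
        have h1 := mult_add_le hf hf0 ha hb hab
        have h2 := one_le_mult ⟨ha, ha0⟩ ha1
        have h3 := one_le_mult ⟨hb, hb0⟩ hb1
        obtain ⟨ι, _, F, u, hF, hu, hu0, haF⟩ := ih (mult a) (by omega) ha ha1 rfl
        obtain ⟨κ, _, G, v, hG, hv, hv0, hbG⟩ := ih (mult b) (by omega) hb hb1 rfl
        refine ⟨ι ⊕ κ, inferInstance, Sum.elim F G, fun p => u p * v p, ?_, hu.mul hv,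
          mul_ne_zero hu0 hv0, ?_⟩
        · rintro (i | i)
          · exact hF i
          · exact hG i
        · filter_upwards [hab, haF, hbG] with p h4 h5 h6
          rw [h4, h5, h6, Fintype.prod_sum_type]
          simp only [Sum.elim_inl, Sum.elim_inr]
          ring
    · exact ⟨Empty, inferInstance, Empty.elim, f, fun i => i.elim, hf, h0,
        Eventually.of_forall fun p => by simp⟩

/-! ### Parametrisations -/

theorem IsParametrisation.vanishes {γ : ℂ → ℂ × ℂ} {f : ℂ × ℂ → ℂ} (h : IsParametrisation γ f) :
    ∀ᶠ t in 𝓝 0, f (γ t) = 0 := by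
  obtain ⟨hγ, -, U, hU, hc⟩ := h
  filter_upwards [hγ.eventually (hc U hU subset_rfl), hU] with t h1 h2
  exact h1.mpr ⟨t, h2, rfl⟩

theorem exists_isPrimitiveRoot {n : ℕ} (hn : 0 < n) : ∃ η : ℂ, IsPrimitiveRoot η n :=
  ⟨_, Complex.isPrimitiveRoot_exp n hn.ne'⟩

theorem isDiffeoGerm_const_mul {c : ℂ} (hc : c ≠ 0) : IsDiffeoGerm (fun x : ℂ => c * x) :=
  ⟨isMapGerm_const_mul c, fun x => c⁻¹ * x, isMapGerm_const_mul _,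
    Eventually.of_forall fun x => inv_mul_cancel_left₀ hc x,
    Eventually.of_forall fun x => mul_inv_cancel_left₀ hc x⟩

namespace IsPuiseuxChart

variable {f : ℂ × ℂ → ℂ} {φ : (ℂ × ℂ) ≃L[ℂ] (ℂ × ℂ)} {m : ℕ} {y : ℂ → ℂ}

/-- The product over the conjugates vanishes identically along the curve, hence one factor does. -/
theorem exists_conj_of_vanishes (h : IsPuiseuxChart f φ m y) {x w : ℂ → ℂ}
    (hx : IsMapGerm x) (hw : IsMapGerm w) (hfγ : ∀ᶠ t in 𝓝 0, f (φ (x t ^ m, w t)) = 0) :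
    ∃ ζ : ℂ, ζ ^ m = 1 ∧ ∀ᶠ t in 𝓝 0, w t = y (ζ * x t) := by
  obtain ⟨u, hu, hu0, hfac⟩ := h.factor
  have hc := hx.prodMk hw
  have hu1 : ∀ᶠ t in 𝓝 0, u (x t, w t) ≠ 0 := hc.eventually (hu.continuousAt.eventually_ne hu0)
  obtain ⟨ζ, hζ, h1⟩ := exists_eventually_eq_zero_of_prod (unityRoots m)
    (f := fun ζ t => w t - y (ζ * x t))
    (fun ζ _ => (hw.sub ((h.isMapGerm.rotate ζ).comp hx)).1) (by
      filter_upwards [hfγ, hu1, hc.eventually hfac] with t h1 h2 h3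
      rw [h3, mul_eq_zero, or_iff_left h2] at h1
      exact h1)
  exact ⟨ζ, (mem_unityRoots h.pos).mp hζ, h1.mono fun t ht => sub_eq_zero.mp ht⟩

/-- Choose the parameter so that the `x`-coordinate of `γ` is a pure power `s ^ k`. Distinctness of
the conjugates forces `m ∣ k`, and injectivity forces `k = m`. -/
theorem exists_reparametrisation (h : IsPuiseuxChart f φ m y) {γ : ℂ → ℂ × ℂ} (hγ : IsMapGerm γ)
    (hinj : ∃ U ∈ 𝓝 (0 : ℂ), Set.InjOn γ U) (hfγ : ∀ᶠ t in 𝓝 0, f (γ t) = 0) :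
    ∃ σ, IsDiffeoGerm σ ∧ ∀ᶠ t in 𝓝 0, γ (σ t) = φ (t ^ m, y t) := by
  obtain ⟨U, hU, hinj⟩ := hinj
  have hm := h.pos
  have hβ := (isMapGerm_cle φ.symm).comp hγ
  have hx : IsMapGerm (fun s => (φ.symm (γ s)).1) := isMapGerm_fst.comp hβ
  have hw : IsMapGerm (fun s => (φ.symm (γ s)).2) := isMapGerm_snd.comp hβ
  set x := fun s => (φ.symm (γ s)).1 with hxdef
  set w := fun s => (φ.symm (γ s)).2 with hwdef
  have hxw : ∀ s, γ s = φ (x s, w s) := fun s => by simp [x, w]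
  -- Otherwise the `w`-coordinate would vanish too and `γ` would be constant, contradicting
  -- injectivity.
  have hx0 : ¬ ∀ᶠ s in 𝓝 0, x s = 0 := by
    intro hx0
    obtain ⟨ζ, hζ, h1⟩ := h.exists_conj_of_vanishes isMapGerm_zero hw (by
      filter_upwards [hfγ, hx0] with s h1 h2
      rw [hxw, h2] at h1
      rwa [zero_pow hm.ne'])
    have h2 : ∀ᶠ s in 𝓝 0, s ∈ U ∧ γ s = 0 := by
      filter_upwards [hU, h1, hx0] with s h3 h4 h5
      refine ⟨h3, ?_⟩
      rw [hxw, h4, h5, mul_zero, h.isMapGerm.2]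
      exact map_zero φ
    have h3 := h2.self_of_nhds
    obtain ⟨s, hs0, hs⟩ := ((h2.filter_mono nhdsWithin_le_nhds).and
      (self_mem_nhdsWithin (s := {(0 : ℂ)}ᶜ))).exists
    exact hs (hinj hs0.1 h3.1 (hs0.2.trans h3.2.symm))
  obtain ⟨k, hk⟩ := ENat.ne_top_iff_exists.mp (fun h => hx0 (analyticOrderAt_eq_top.mp h))
  have hk0 : 0 < k := by
    have := one_le_order hx
    rw [← hk] at this
    exact_mod_cast this
  obtain ⟨τ, hτ, hτ0, hxτ⟩ := exists_root_of_order hx.1 hk0 hk.symm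
  obtain ⟨σ, hσ, hσ0, hτσ, hστ⟩ := exists_local_inverse hτ hτ0
  have hσd : IsDiffeoGerm σ := ⟨hσ, τ, hτ, hτσ, hστ⟩
  have hpm := isMapGerm_pow (n := m) hm.ne'
  have hpk := isMapGerm_pow (n := k) hk0.ne'
  have hwσ : IsMapGerm (fun s => w (σ s)) := hw.comp hσ
  have hxσ : ∀ᶠ s in 𝓝 0, x (σ s) = s ^ k := by
    filter_upwards [hσ.eventually hxτ, hτσ] with s h1 h2
    rw [h1, h2]
  -- With `s ^ m` as argument, the `x`-coordinate becomes the `m`-th power of `s ^ k`, as the chart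
  -- requires.
  obtain ⟨ζ, hζ, h1⟩ := h.exists_conj_of_vanishes hpk (hwσ.comp hpm) (by
    filter_upwards [(hσ.comp hpm).eventually hfγ, hpm.eventually hxσ] with s h1 h2
    rw [hxw, h2] at h1
    rwa [← pow_mul, mul_comm, pow_mul])
  have hζ0 : ζ ≠ 0 := fun h0 => by simp [h0, hm.ne'] at hζ
  obtain ⟨η, hη⟩ := exists_isPrimitiveRoot hm
  -- Replacing `s` by `η * s` fixes `s ^ m`, so `y (ζ * s ^ k)` is unchanged when its argument is
  -- multiplied by `η ^ k`.
  have hηk : η ^ k = 1 := by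
    refine h.distinct _ (by rw [← pow_mul, mul_comm, pow_mul, hη.pow_eq_one, one_pow]) ?_
    have h2 : ∀ᶠ t in 𝓝 (0 : ℂ), y (η ^ k * (ζ * t)) = y (ζ * t) := by
      refine descend_pow_one hk0 ?_
      filter_upwards [h1, (isMapGerm_const_mul η).eventually h1] with t h2 h3
      rw [← h2, ← mul_assoc, mul_comm (η ^ k), mul_assoc, ← mul_pow, ← h3, mul_pow, hη.pow_eq_one,
        one_mul]
    filter_upwards [(isMapGerm_const_mul ζ⁻¹).eventually h2] with t ht
    rwa [mul_inv_cancel_left₀ hζ0] at ht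
  obtain ⟨l, rfl⟩ := (hη.pow_eq_one_iff_dvd k).mp hηk
  have hl0 : 0 < l := Nat.pos_of_mul_pos_left hk0
  have hwl : ∀ᶠ s in 𝓝 0, w (σ s) = y (ζ * s ^ l) := by
    refine descend_pow_one hm ?_
    filter_upwards [h1] with s hs
    rw [hs, pow_mul]
  have hγσ : ∀ᶠ s in 𝓝 0, γ (σ s) = φ ((ζ * s ^ l) ^ m, y (ζ * s ^ l)) := by
    filter_upwards [hwl, hxσ] with s h2 h3
    rw [hxw, h2, h3, mul_pow, hζ, one_mul, ← pow_mul, mul_comm l]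
  -- Now `γ ∘ σ` depends only on `s ^ l`, so rotation by a primitive `l`-th root of unity preserves
  -- it; injectivity makes that root `1`.
  have hl1 : l = 1 := by
    obtain ⟨ξ, hξ⟩ := exists_isPrimitiveRoot hl0
    have hσξ := hσ.comp (isMapGerm_const_mul ξ)
    have h2 : ∀ᶠ s in 𝓝 (0 : ℂ), ξ * s = s := by
      filter_upwards [hσ.eventually hU, hσξ.eventually hU, hγσ,
        (isMapGerm_const_mul ξ).eventually hγσ, hτσ, (isMapGerm_const_mul ξ).eventually hτσ]
        with s h2 h3 h4 h5 h6 h7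
      rw [mul_pow ξ, hξ.pow_eq_one, one_mul, ← h4] at h5
      rw [← h7, hinj h3 h2 h5, h6]
    obtain ⟨s, hs, hs0⟩ := ((h2.filter_mono nhdsWithin_le_nhds).and
      (self_mem_nhdsWithin (s := {(0 : ℂ)}ᶜ))).exists
    have h3 : ξ = 1 := mul_right_cancel₀ hs0 (hs.trans (one_mul s).symm)
    rw [h3] at hξ
    exact Nat.dvd_one.mp ((hξ.pow_eq_one_iff_dvd 1).mp (one_pow 1))
  subst hl1
  refine ⟨fun t => σ (ζ⁻¹ * t), hσd.comp (isDiffeoGerm_const_mul (inv_ne_zero hζ0)), ?_⟩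
  filter_upwards [(isMapGerm_const_mul ζ⁻¹).eventually hγσ] with t ht
  rw [ht, pow_one, mul_inv_cancel_left₀ hζ0]

theorem paramContactOrders_eq (h : IsPuiseuxChart f φ m y) {γ : ℂ → ℂ × ℂ} (hγ : IsMapGerm γ)
    (hinj : ∃ U ∈ 𝓝 (0 : ℂ), Set.InjOn γ U) (hfγ : ∀ᶠ t in 𝓝 0, f (γ t) = 0) :
    paramContactOrders γ = graphOrders m y := by
  obtain ⟨σ, hσ, hγσ⟩ := h.exists_reparametrisation hγ hinj hfγ
  rw [← PlaneGerm.paramContactOrders_eq h.pos h.isMapGerm h.lt_order]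
  exact (AEquiv.paramContactOrders_eq ((isMapGerm_pow h.pos.ne').prodMk h.isMapGerm) hγ
    ⟨σ, fun p => φ p, hσ, isDiffeoGerm_cle φ, hγσ⟩).symm

/-- The first Puiseux exponent can be read off any chart. -/
theorem puiseux_eq (h : IsPuiseuxChart f φ m y) : puiseux f = lowestNonMultiple m y := by
  refine le_antisymm ?_ ?_
  · refine (iInf₂_le (f := fun γ _ => paramPuiseux γ) _ h.isParametrisation).trans ?_
    have hN : IsNormalForm (fun t => φ (t ^ m, y t)) m y :=
      ⟨h.pos, h.isMapGerm, h.lt_order, fun t => t, fun p => φ.symm p, isDiffeoGerm_id,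
        isDiffeoGerm_cle φ.symm, Eventually.of_forall fun t => (φ.symm_apply_apply _).symm⟩
    exact (iInf_le _ m).trans (iInf₂_le (f := fun y' _ => lowestNonMultiple m y') y hN)
  -- Any normal form of any parametrisation has the contact orders of the chart, hence the same
  -- exponent.
  · refine le_iInf₂ fun γ hγ => le_iInf fun m' => le_iInf₂ fun y' hy' => ?_
    obtain ⟨hm', hy', hmy', hA⟩ := hy'
    refine (lowestNonMultiple_eq_of_graphOrders_eq h.pos h.isMapGerm h.lt_order hm' hy' hmy' ?_).le
    rw [← h.paramContactOrders_eq hγ.1 hγ.2.1 hγ.vanishes,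
      ← PlaneGerm.paramContactOrders_eq hm' hy' hmy']
    exact AEquiv.paramContactOrders_eq hγ.1 ((isMapGerm_pow hm'.ne').prodMk hy') hA

end IsPuiseuxChart

/-- The curve `γ` lies on one irreducible factor. A further factor would have its branch inside the
image of `γ`, hence divide the first one, and its square would divide `f`. So `f` is a unit times
one irreducible germ, for which a chart computes both sets. -/
theorem paramContactOrders_eq_contactOrders {γ : ℂ → ℂ × ℂ} {f : ℂ × ℂ → ℂ} (hf : IsReducedGerm f)
    (hγ : IsParametrisation γ f) : paramContactOrders γ = contactOrders f := by
  classical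
  obtain ⟨ι, _, F, u, hF, hu, hu0, hfF⟩ := exists_factorization hf.isMapGerm.1 hf.ne_zero
  have huγ : ∀ᶠ t in 𝓝 0, u (γ t) ≠ 0 := hγ.1.eventually (hu.continuousAt.eventually_ne hu0)
  obtain ⟨i, -, hi⟩ := exists_eventually_eq_zero_of_prod Finset.univ (f := fun i t => F i (γ t))
    (fun i _ => hγ.1.analyticAt_comp (hF i).isMapGerm.1) (by
      filter_upwards [hγ.vanishes, huγ, hγ.1.eventually hfF] with t h1 h2 h3
      rw [h3, mul_eq_zero, or_iff_right h2] at h1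
      exact h1)
  have huniq : ∀ j, j = i := by
    intro j
    by_contra hji
    obtain ⟨φ, y, hj⟩ := (hF j).exists_chart
    have h1 : ∀ᶠ t in 𝓝 0, F i (φ (t ^ mult (F j), y t)) = 0 := by
      obtain ⟨-, -, U, hU, hc⟩ := hγ
      obtain ⟨V, hV, hVi⟩ := Filter.eventually_iff_exists_mem.mp hi
      -- The image is shrunk to parameters in `V`, where `F i ∘ γ` vanishes.
      filter_upwards [hj.isMapGerm_curve.eventually (hc (U ∩ V) (Filter.inter_mem hU hV)
        Set.inter_subset_left), hj.isMapGerm_curve.eventually hfF, hj.vanishes] with t h1 h2 h3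
      have h4 : f (φ (t ^ mult (F j), y t)) = 0 := by
        rw [h2, Finset.prod_eq_zero (Finset.mem_univ j) h3, mul_zero]
      obtain ⟨s, hs, h5⟩ := h1.mp h4
      rw [← h5]
      exact hVi s hs.2
    obtain ⟨Q, hQ, hFQ⟩ := hj.dvd (hF j).isMapGerm.1 (hF i).isMapGerm.1 h1
    refine hf.of_sq_dvd (g := F j) (hF j).isMapGerm.1
      (q := fun p => u p * Q p * ∏ l ∈ (Finset.univ.erase j).erase i, F l p)
      ((hu.mul hQ).mul (Finset.analyticAt_fun_prod _ fun l _ => (hF l).isMapGerm.1)) ?_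
      (hF j).isMapGerm.2
    filter_upwards [hfF, hFQ] with p h2 h3
    rw [h2, ← Finset.mul_prod_erase Finset.univ _ (Finset.mem_univ j),
      ← Finset.mul_prod_erase (Finset.univ.erase j) _
        (Finset.mem_erase.mpr ⟨Ne.symm hji, Finset.mem_univ i⟩), h3]
    ring
  obtain ⟨φ, y, h⟩ := (hF i).exists_chart
  rw [h.paramContactOrders_eq hγ.1 hγ.2.1 hi, ← h.contactOrders_eq (hF i).isMapGerm.1]
  refine (contactOrders_unit_mul (hF i).isMapGerm.1 hu hu0 ?_).symm
  filter_upwards [hfF] with p hp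
  rw [hp, Fintype.prod_eq_single i fun j hj => absurd (huniq j) hj]

/-! ### Contact orders of irreducible germs -/

theorem order_graph_le_lowestNonMultiple {m : ℕ} (hm : 0 < m) {y a : ℂ → ℂ} (hy : IsMapGerm y)
    (ha : IsMapGerm a) :
    analyticOrderAt (fun t => a (t ^ m) - y t) 0 ≤ lowestNonMultiple m y := by
  refine le_iInf₂ fun k hk => ?_
  by_contra hlt
  have ham := ha.comp (isMapGerm_pow hm.ne')
  have h2 : ((k + 1 : ℕ) : ℕ∞) ≤ analyticOrderAt (fun t => a (t ^ m) - y t) 0 := by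
    push_cast
    exact Order.add_one_le_of_lt (not_le.mp hlt)
  have h3 := (natCast_le_analyticOrderAt_iff_iteratedDeriv_eq_zero (ham.sub hy).1).mp h2 k
    (Nat.lt_succ_self k)
  rw [iteratedDeriv_fun_sub ham.1.contDiffAt hy.1.contDiffAt,
    iteratedDeriv_comp_pow_eq_zero ha.1 hm hk.1, zero_sub, neg_eq_zero] at h3
  exact hk.2 h3

/-- Without such an exponent, `y` would agree to every order with a series in `t ^ m`, hence be
invariant under a primitive `m`-th root of unity. -/
theorem ConjDistinct.lowestNonMultiple_ne_top {m : ℕ} (hm : 1 < m) {y : ℂ → ℂ}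
    (hy : IsMapGerm y) (hd : ConjDistinct m y) : lowestNonMultiple m y ≠ ⊤ := by
  intro htop
  have hm0 : 0 < m := by omega
  obtain ⟨ζ, hζ⟩ := exists_isPrimitiveRoot hm0
  have hord : analyticOrderAt (fun t => y (ζ * t) - y t) 0 = ⊤ := by
    refine ENat.eq_top_iff_forall_ge.mpr fun n => ?_
    obtain ⟨a, F, ha, hF, hyF⟩ := exists_truncation hm0 hy (n := n) (by rw [htop]; exact le_top)
    have hζm := isMapGerm_const_mul ζ
    have h1 : (fun t => y (ζ * t) - y t) =ᶠ[𝓝 0] fun t => t ^ n * (ζ ^ n * F (ζ * t) - F t) := by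
      filter_upwards [hyF, hζm.eventually hyF] with t h1 h2
      rw [h1, h2, mul_pow ζ t m, hζ.pow_eq_one, one_mul, mul_pow]
      ring
    have h2 : AnalyticAt ℂ (fun t => ζ ^ n * F (ζ * t) - F t) 0 :=
      (analyticAt_const.mul (hζm.analyticAt_comp hF)).sub hF
    rw [analyticOrderAt_congr h1, order_pow_mul h2]
    exact le_self_add
  have h1 : ∀ᶠ t in 𝓝 0, y (ζ * t) = y t :=
    (analyticOrderAt_eq_top.mp hord).mono fun t ht => sub_eq_zero.mp ht
  have h2 := hd ζ hζ.pow_eq_one h1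
  rw [h2] at hζ
  have := Nat.dvd_one.mp ((hζ.pow_eq_one_iff_dvd 1).mp (one_pow 1))
  omega

namespace IsIrreducibleGerm

variable {f : ℂ × ℂ → ℂ}

theorem contactOrders_eq (h : IsIrreducibleGerm f) :
    contactOrders f = {n | ∃ k, 1 ≤ k ∧ n = k * mult f ∧ (n : ℕ∞) < puiseux f} ∪
      {n | puiseux f = n} := by
  obtain ⟨φ, y, hc⟩ := h.exists_chart
  rw [hc.contactOrders_eq h.isMapGerm.1, hc.puiseux_eq,
    graphOrders_eq hc.pos hc.isMapGerm hc.lt_order]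

theorem one_le_mult (h : IsIrreducibleGerm f) : 1 ≤ mult f :=
  PlaneGerm.one_le_mult h.isMapGerm h.ne_zero

theorem mult_lt_puiseux (h : IsIrreducibleGerm f) : (mult f : ℕ∞) < puiseux f := by
  obtain ⟨φ, y, hc⟩ := h.exists_chart
  rw [hc.puiseux_eq]
  exact lt_lowestNonMultiple hc.isMapGerm.1 hc.lt_order

theorem not_dvd_of_puiseux_eq (h : IsIrreducibleGerm f) {b : ℕ} (hb : puiseux f = b) :
    ¬ mult f ∣ b := by
  obtain ⟨φ, y, hc⟩ := h.exists_chart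
  rw [hc.puiseux_eq] at hb
  exact (lowestNonMultiple_eq_natCast_iff.mp hb).2.1

theorem exists_puiseux_eq (h : IsIrreducibleGerm f) (hs : fderiv ℂ f 0 = 0) :
    ∃ b : ℕ, puiseux f = b := by
  have h1 : mult f ≠ 1 := fun h1 => (mult_eq_one_iff h.isMapGerm h.ne_zero).mp h1 hs
  have h2 := h.one_le_mult
  obtain ⟨φ, y, hc⟩ := h.exists_chart
  have h3 := hc.distinct.lowestNonMultiple_ne_top (by omega) hc.isMapGerm
  rw [← hc.puiseux_eq] at h3
  obtain ⟨b, hb⟩ := ENat.ne_top_iff_exists.mp h3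
  exact ⟨b, hb.symm⟩

theorem contactOrders_eq_of_puiseux_eq (h : IsIrreducibleGerm f) {b : ℕ} (hb : puiseux f = b) :
    contactOrders f = {n | ∃ k, 1 ≤ k ∧ n = k * mult f ∧ n < b} ∪ {b} := by
  rw [h.contactOrders_eq, hb]
  ext n
  simp only [Nat.cast_lt, Nat.cast_inj, Set.mem_union, Set.mem_ofPred_eq, Set.mem_singleton_iff,
    eq_comm (a := b)]

theorem finite_contactOrders (h : IsIrreducibleGerm f) (hs : fderiv ℂ f 0 = 0) :
    (contactOrders f).Finite := by
  obtain ⟨b, hb⟩ := h.exists_puiseux_eq hs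
  rw [h.contactOrders_eq_of_puiseux_eq hb]
  refine ((Set.finite_lt_nat b).subset ?_).union (Set.finite_singleton b)
  rintro n ⟨k, -, -, hn⟩
  exact hn

theorem contactOrders_eq_pair (h : IsIrreducibleGerm f) {b : ℕ} (hb : puiseux f = b)
    (hlt : b < 2 * mult f) : contactOrders f = {mult f, b} := by
  have h1 := h.mult_lt_puiseux
  rw [hb] at h1
  rw [h.contactOrders_eq_of_puiseux_eq hb]
  ext n
  simp only [Set.mem_union, Set.mem_ofPred_eq, Set.mem_singleton_iff, Set.mem_insert_iff]
  refine or_congr_left ⟨?_, ?_⟩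
  · rintro ⟨k, hk, rfl, hkb⟩
    have h2 : k < 2 := Nat.lt_of_mul_lt_mul_right (hkb.trans hlt)
    rw [show k = 1 by omega, one_mul]
  · rintro rfl
    exact ⟨1, le_rfl, (one_mul _).symm, by exact_mod_cast h1⟩

theorem triple_subset_contactOrders (h : IsIrreducibleGerm f) {b : ℕ} (hb : puiseux f = b)
    (hle : 2 * mult f ≤ b) : mult f < 2 * mult f ∧ 2 * mult f < b ∧
      {mult f, 2 * mult f, b} ⊆ contactOrders f := by
  have h1 := h.one_le_mult
  -- Equality is impossible, since `mult f` does not divide the Puiseux exponent; so the three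
  -- elements are distinct.
  have h2 : 2 * mult f < b := lt_of_le_of_ne hle fun h2 =>
    h.not_dvd_of_puiseux_eq hb (h2 ▸ dvd_mul_left _ _)
  refine ⟨by omega, h2, ?_⟩
  rw [h.contactOrders_eq_of_puiseux_eq hb]
  rintro n (rfl | rfl | rfl)
  · exact Or.inl ⟨1, le_rfl, (one_mul _).symm, by omega⟩
  · exact Or.inl ⟨2, by norm_num, rfl, h2⟩
  · exact Or.inr rfl

theorem order_of_notMem (h : IsIrreducibleGerm f) {α : ℂ → ℂ × ℂ} (hα : IsMapGerm α)
    (hv : deriv α 0 ∉ tangentCone f) : analyticOrderAt (fun s => f (α s)) 0 = mult f :=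
  (order_curve h.isMapGerm.1 hα).2.mpr hv

/-- The order is finite, being bounded by the Puiseux exponent, so it is one of the two contact
orders; tangency excludes `mult f`. -/
theorem order_of_mem (h : IsIrreducibleGerm f) {b : ℕ} (hb : puiseux f = b)
    (hlt : b < 2 * mult f) {α : ℂ → ℂ × ℂ} (hα : IsImmersionGerm α)
    (hv : deriv α 0 ∈ tangentCone f) : analyticOrderAt (fun s => f (α s)) 0 = b := by
  obtain ⟨φ, y, hc⟩ := h.exists_chart
  obtain ⟨a, ha, h1⟩ := hc.exists_graph_of_mem_tangentCone h.isMapGerm.1 hα hv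
  have h2 := order_graph_le_lowestNonMultiple hc.pos hc.isMapGerm ha
  rw [← h1, ← hc.puiseux_eq, hb] at h2
  obtain ⟨n, hn⟩ := ENat.ne_top_iff_exists.mp (ne_top_of_le_ne_top (ENat.natCast_ne_top b) h2)
  have h3 : n ∈ contactOrders f := ⟨α, hα, hn.symm⟩
  rw [h.contactOrders_eq_pair hb hlt] at h3
  rcases h3 with rfl | rfl
  · exact absurd hv ((order_curve h.isMapGerm.1 hα.1).2.mp hn.symm)
  · exact hn.symm

theorem exists_tangentCone_eq (h : IsIrreducibleGerm f) :
    ∃ v : ℂ × ℂ, v ≠ 0 ∧ tangentCone f = (Submodule.span ℂ {v} : Set (ℂ × ℂ)) := by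
  obtain ⟨φ, y, hc⟩ := h.exists_chart
  refine ⟨φ (1, 0), by simp, ?_⟩
  ext v
  rw [hc.mem_tangentCone_iff h.isMapGerm.1, SetLike.mem_coe, Submodule.mem_span_singleton]
  constructor
  · intro hv
    refine ⟨(φ.symm v).1, ?_⟩
    rw [← map_smul, ← φ.apply_symm_apply v]
    congr 1
    ext <;> simp [hv]
  · rintro ⟨c, rfl⟩
    rw [← map_smul, φ.symm_apply_apply]
    simp

end IsIrreducibleGerm

theorem isImmersionGerm_smul_const {v : ℂ × ℂ} (hv : v ≠ 0) :
    IsImmersionGerm (fun s : ℂ => s • v) :=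
  ⟨isMapGerm_smul_const v, by rwa [deriv_smul_const]⟩

/-- A plane over an infinite field is not a finite union of proper subspaces. The index `none` adds
the zero subspace, which accounts for `v ≠ 0` and for an empty family. -/
theorem exists_common_transversal {ι : Type*} [Finite ι] {F : ι → ℂ × ℂ → ℂ}
    (hF : ∀ i, IsIrreducibleGerm (F i)) : ∃ v : ℂ × ℂ, v ≠ 0 ∧ ∀ i, v ∉ tangentCone (F i) := by
  choose w _ hw using fun i => (hF i).exists_tangentCone_eq
  by_contra hcon
  push Not at hcon
  obtain ⟨i, hi⟩ := Subspace.exists_eq_top_of_iUnion_eq_univ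
    (p := fun i : Option ι => i.elim ⊥ fun i => Submodule.span ℂ {w i}) (by
      refine Set.eq_univ_of_forall fun v => Set.mem_iUnion.mpr ?_
      by_cases hv : v = 0
      · exact ⟨none, hv⟩
      · obtain ⟨i, hi⟩ := hcon v hv
        rw [hw i] at hi
        exact ⟨some i, hi⟩)
  cases i with
  | none => exact bot_ne_top hi
  | some i =>
    obtain ⟨v, hv⟩ := exists_notMem_tangentCone (hF i).isMapGerm.1 (hF i).ne_zero
    rw [hw i] at hv
    exact hv ((show Submodule.span ℂ {w i} = ⊤ from hi) ▸ Submodule.mem_top)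

/-! ### Products -/

theorem contactOrders_mul_of_transversal {f g : ℂ × ℂ → ℂ} (hf : IsIrreducibleGerm f)
    (hg : IsIrreducibleGerm g) (h : tangentCone f ∩ tangentCone g = {0}) :
    contactOrders (fun p => f p * g p) =
      (fun n => mult f + n) '' contactOrders g ∪ (fun n => mult g + n) '' contactOrders f := by
  have hord : ∀ {α : ℂ → ℂ × ℂ}, IsMapGerm α → analyticOrderAt (fun s => f (α s) * g (α s)) 0 =
      analyticOrderAt (fun s => f (α s)) 0 + analyticOrderAt (fun s => g (α s)) 0 := fun hα =>
    order_mul (hα.analyticAt_comp hf.isMapGerm.1) (hα.analyticAt_comp hg.isMapGerm.1)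
  have hnot : ∀ {v : ℂ × ℂ}, v ≠ 0 → v ∈ tangentCone f → v ∉ tangentCone g := by
    intro v hv h1 h2
    exact hv (h.subset ⟨h1, h2⟩)
  have hmm : mult f + mult g ∈ contactOrders (fun p => f p * g p) := by
    obtain ⟨v, hv, hi⟩ := exists_common_transversal (F := ![f, g]) (by
      intro i
      fin_cases i
      · exact hf
      · exact hg)
    have hα := isImmersionGerm_smul_const hv
    refine ⟨_, hα, (hord hα.1).trans ?_⟩
    rw [(order_line hf.isMapGerm.1 v).2.mpr (hi 0), (order_line hg.isMapGerm.1 v).2.mpr (hi 1)]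
    push_cast
    rfl
  ext n
  constructor
  · rintro ⟨α, hα, hn⟩
    replace hn := (hord hα.1).symm.trans hn
    by_cases hv : deriv α 0 ∈ tangentCone f
    · right
      rw [hg.order_of_notMem hα.1 (hnot hα.2 hv)] at hn
      obtain ⟨k, hk⟩ := ENat.ne_top_iff_exists.mp
        (ne_top_of_le_ne_top (ENat.natCast_ne_top n) (le_self_add.trans hn.le))
      rw [← hk] at hn
      refine ⟨k, ⟨α, hα, hk.symm⟩, ?_⟩
      exact (add_comm _ _).trans (by exact_mod_cast hn)
    · left
      rw [hf.order_of_notMem hα.1 hv] at hn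
      obtain ⟨k, hk⟩ := ENat.ne_top_iff_exists.mp
        (ne_top_of_le_ne_top (ENat.natCast_ne_top n) (le_add_self.trans hn.le))
      rw [← hk] at hn
      exact ⟨k, ⟨α, hα, hk.symm⟩, by exact_mod_cast hn⟩
  · rintro (⟨k, ⟨α, hα, hk⟩, rfl⟩ | ⟨k, ⟨α, hα, hk⟩, rfl⟩)
    · by_cases hv : deriv α 0 ∈ tangentCone f
      -- Here `α` is tangent to `f`, so it does not realise the sum. But it is transversal to `g`,
      -- so `k = mult g`, and a common transversal realises the sum.
      · have h1 := hg.order_of_notMem hα.1 (hnot hα.2 hv)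
        have h2 : k = mult g := by exact_mod_cast hk.symm.trans h1
        rwa [h2]
      · refine ⟨α, hα, (hord hα.1).trans ?_⟩
        rw [hf.order_of_notMem hα.1 hv]
        exact (congrArg _ hk).trans (by push_cast; rfl)
    · by_cases hv : deriv α 0 ∈ tangentCone g
      · have h1 := hf.order_of_notMem hα.1 fun h2 => hnot hα.2 h2 hv
        have h2 : k = mult f := by exact_mod_cast hk.symm.trans h1
        simpa only [h2, add_comm] using hmm
      · refine ⟨α, hα, (hord hα.1).trans ?_⟩
        rw [hg.order_of_notMem hα.1 hv, add_comm]
        exact (congrArg _ hk).trans (by push_cast; rfl)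

theorem contactOrders_prod_subset {ι : Type*} [Fintype ι] {F : ι → ℂ × ℂ → ℂ}
    (hF : ∀ i, AnalyticAt ℂ (F i) 0) : contactOrders (fun p => ∏ i, F i p) ⊆
      {n | ∃ a : ι → ℕ, (∀ i, a i ∈ contactOrders (F i)) ∧ n = ∑ i, a i} := by
  rintro n ⟨α, hα, hn⟩
  replace hn := (order_prod Finset.univ (f := fun i s => F i (α s))
    fun i _ => hα.1.analyticAt_comp (hF i)).symm.trans hn
  have hfin : ∀ i, ∃ k : ℕ, (k : ℕ∞) = analyticOrderAt (fun s => F i (α s)) 0 := fun i =>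
    ENat.ne_top_iff_exists.mp (ne_top_of_le_ne_top (ENat.natCast_ne_top n)
      ((Finset.single_le_sum (f := fun i => analyticOrderAt (fun s => F i (α s)) 0)
        (fun _ _ => zero_le) (Finset.mem_univ i)).trans hn.le))
  choose a ha using hfin
  refine ⟨a, fun i => ⟨α, hα, (ha i).symm⟩, ?_⟩
  simp only [← ha] at hn
  exact_mod_cast hn.symm

theorem finite_contactOrders_prod {ι : Type*} [Fintype ι] {F : ι → ℂ × ℂ → ℂ}
    (hF : ∀ i, IsIrreducibleGerm (F i)) (hs : ∀ i, fderiv ℂ (F i) 0 = 0) :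
    (contactOrders (fun p => ∏ i, F i p)).Finite := by
  refine Set.Finite.subset ?_ (contactOrders_prod_subset fun i => (hF i).isMapGerm.1)
  refine ((Set.Finite.pi' fun i => (hF i).finite_contactOrders (hs i)).image
    fun a => ∑ i, a i).subset ?_
  rintro n ⟨a, ha, rfl⟩
  exact ⟨a, ha, rfl⟩

/-! ### Smooth components -/

theorem hasSmoothComponent_of_not_bddAbove {f : ℂ × ℂ → ℂ} (hf : IsReducedGerm f)
    (h : ¬ BddAbove (contactOrders f)) : HasSmoothComponent f := by
  classical
  by_contra hns
  obtain ⟨ι, _, F, u, hF, hu, hu0, hfF⟩ := exists_factorization hf.isMapGerm.1 hf.ne_zero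
  refine h ?_
  rw [contactOrders_unit_mul (analyticAt_prod fun i => (hF i).isMapGerm.1) hu hu0 hfF]
  refine (finite_contactOrders_prod hF fun i => ?_).bddAbove
  by_contra hi
  obtain ⟨hFi, hirr⟩ := hF i
  refine hns ⟨hf.isMapGerm.1, F i, hFi, hirr, (germOf_dvd_iff _ _).mpr
    ⟨fun p => u p * ∏ j ∈ Finset.univ.erase i, F j p,
      hu.mul (Finset.analyticAt_fun_prod _ fun j _ => (hF j).isMapGerm.1), ?_⟩, hi⟩
  filter_upwards [hfF] with p hp
  rw [hp, ← Finset.mul_prod_erase Finset.univ _ (Finset.mem_univ i)]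
  ring

/-- The graph of `y + s ^ N` meets the smooth branch `g` with order exactly `N`. The cofactor `q`
has finite order `d` on the branch, as otherwise `g` would divide it and `f` would not be reduced. A
perturbation of order `N > d` does not change this order. -/
theorem exists_mem_contactOrders_ge {f : ℂ × ℂ → ℂ} (hf : IsReducedGerm f)
    (h : HasSmoothComponent f) : ∃ d, ∀ N, d < N → N + d ∈ contactOrders f := by
  obtain ⟨hfa, g, hg, hirr, hdvd, hg0⟩ := h
  have hgi : IsIrreducibleGerm g := ⟨hg, hirr⟩
  obtain ⟨q, hq, hfq⟩ := (germOf_dvd_iff _ _).mp hdvd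
  obtain ⟨φ, y, hc⟩ := hgi.exists_chart
  rw [(mult_eq_one_iff hgi.isMapGerm hgi.ne_zero).mpr hg0] at hc
  have hy := hc.isMapGerm
  have hqφ : AnalyticAt ℂ (fun p : ℂ × ℂ => q (φ (p.1, y p.1 + p.2))) 0 :=
    ((isMapGerm_cle φ).comp (isMapGerm_fst.prodMk
      ((hy.comp isMapGerm_fst).add isMapGerm_snd))).analyticAt_comp hq
  obtain ⟨r, hr, hqr⟩ := exists_eq_add_snd_mul hqφ
  simp only [add_zero] at hqr
  have hqγ : AnalyticAt ℂ (fun s => q (φ (s, y s))) 0 :=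
    ((isMapGerm_cle φ).comp (isMapGerm_id.prodMk hy)).analyticAt_comp hq
  have hq0 : ¬ ∀ᶠ s in 𝓝 0, q (φ (s, y s)) = 0 := by
    intro h0
    obtain ⟨Q, hQ, hqQ⟩ := hc.dvd hg hq (by simpa using h0)
    refine hf.of_sq_dvd hg hQ ?_ hgi.isMapGerm.2
    filter_upwards [hfq, hqQ] with p h1 h2
    rw [h1, h2, mul_assoc]
  obtain ⟨d, hd⟩ := ENat.ne_top_iff_exists.mp (fun h => hq0 (analyticOrderAt_eq_top.mp h))
  refine ⟨d, fun N hN => ?_⟩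
  have hN0 : N ≠ 0 := by omega
  have hpow := isMapGerm_pow (n := N) hN0
  have ha : IsMapGerm (fun s => y s + s ^ N) := hy.add hpow
  have hα := IsPuiseuxChart.isImmersionGerm_graph φ ha
  have hsN : IsMapGerm (fun s : ℂ => (s, s ^ N)) := isMapGerm_id.prodMk hpow
  refine ⟨_, hα, ?_⟩
  have h1 : (fun s => f (φ (s, y s + s ^ N))) =ᶠ[𝓝 0]
      fun s => g (φ (s, y s + s ^ N)) * q (φ (s, y s + s ^ N)) := hα.1.eventually hfq
  have h2 : analyticOrderAt (fun s => g (φ (s, y s + s ^ N))) 0 = N := by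
    rw [hc.order_graph hg ha, ← order_pow N]
    congr 1
    funext t
    rw [pow_one]
    ring
  have h3 : analyticOrderAt (fun s => q (φ (s, y s + s ^ N))) 0 = d := by
    have h4 : (fun s => q (φ (s, y s + s ^ N))) =ᶠ[𝓝 0]
        (fun s => q (φ (s, y s))) + fun s => s ^ N * r (s, s ^ N) := hsN.eventually hqr
    rw [analyticOrderAt_congr h4, analyticOrderAt_add_eq_left_of_lt, hd]
    rw [← hd, order_pow_mul (hsN.analyticAt_comp hr)]
    exact lt_of_lt_of_le (by exact_mod_cast hN) le_self_add
  refine (analyticOrderAt_congr h1).trans ?_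
  rw [order_mul (hα.1.analyticAt_comp hg) (hα.1.analyticAt_comp hq), h2, h3]
  push_cast
  rfl

theorem not_bddAbove_contactOrders_iff {f : ℂ × ℂ → ℂ} (hf : IsReducedGerm f) :
    ¬ BddAbove (contactOrders f) ↔ HasSmoothComponent f := by
  refine ⟨hasSmoothComponent_of_not_bddAbove hf, fun h => ?_⟩
  obtain ⟨d, hd⟩ := exists_mem_contactOrders_ge hf h
  rintro ⟨B, hB⟩
  have := hB (hd (d + B + 1) (by omega))
  omega

/-! ### Several tangent directions -/

/-- A nonzero tangent vector lies in at most one `L j`. The factors of that group contribute their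
Puiseux exponents, all others their multiplicities. -/
theorem contactOrders_of_tangent_lines {k : ℕ} {r : Fin k → ℕ}
    {F : (j : Fin k) → Fin (r j) → ℂ × ℂ → ℂ} {L : Fin k → Submodule ℂ (ℂ × ℂ)}
    (hF : ∀ j i, IsIrreducibleGerm (F j i))
    (hL : ∀ j i, tangentCone (F j i) = (L j : Set (ℂ × ℂ))) (hinj : Function.Injective L)
    {b : (j : Fin k) → Fin (r j) → ℕ} (hb : ∀ j i, puiseux (F j i) = b j i)
    (hlt : ∀ j i, b j i < 2 * mult (F j i)) :
    contactOrders (fun p => ∏ j, ∏ i, F j i p) = {∑ j, ∑ i, mult (F j i)} ∪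
      Set.range (fun j => ∑ j', ∑ i, mult (F j' i) - ∑ i, mult (F j i) + ∑ i, b j i) := by
  classical
  have hord : ∀ {α : ℂ → ℂ × ℂ}, IsMapGerm α →
      analyticOrderAt (fun s => ∏ j, ∏ i, F j i (α s)) 0 =
        ∑ j, ∑ i, analyticOrderAt (fun s => F j i (α s)) 0 := by
    intro α hα
    have h1 : ∀ j i, AnalyticAt ℂ (fun s => F j i (α s)) 0 := fun j i =>
      hα.analyticAt_comp (hF j i).isMapGerm.1
    refine (order_prod Finset.univ (f := fun j s => ∏ i, F j i (α s))
      fun j _ => Finset.analyticAt_fun_prod _ fun i _ => h1 j i).trans ?_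
    exact Finset.sum_congr rfl fun j _ => order_prod Finset.univ (f := fun i s => F j i (α s))
      fun i _ => h1 j i
  have hA : ∀ {α : ℂ → ℂ × ℂ}, IsImmersionGerm α → (∀ j i, deriv α 0 ∉ tangentCone (F j i)) →
      analyticOrderAt (fun s => ∏ j, ∏ i, F j i (α s)) 0 =
        ((∑ j, ∑ i, mult (F j i) : ℕ) : ℕ∞) := by
    intro α hα hv
    rw [hord hα.1]
    push_cast
    exact Finset.sum_congr rfl fun j _ => Finset.sum_congr rfl fun i _ =>
      (hF j i).order_of_notMem hα.1 (hv j i)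
  have hB : ∀ {α : ℂ → ℂ × ℂ}, IsImmersionGerm α → ∀ j (i : Fin (r j)),
      deriv α 0 ∈ tangentCone (F j i) →
      analyticOrderAt (fun s => ∏ j, ∏ i, F j i (α s)) 0 =
        ((∑ j', ∑ i, mult (F j' i) - ∑ i, mult (F j i) + ∑ i, b j i : ℕ) : ℕ∞) := by
    intro α hα j i hv
    -- Two of the lines containing the same nonzero vector are both spanned by it, hence equal.
    have hother : ∀ j' ≠ j, ∀ i', deriv α 0 ∉ tangentCone (F j' i') := by
      intro j' hj' i' hv'
      obtain ⟨w, hw, hw1⟩ := (hF j i).exists_tangentCone_eq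
      obtain ⟨w', hw', hw1'⟩ := (hF j' i').exists_tangentCone_eq
      refine hj' (hinj ?_)
      rw [hw1, SetLike.mem_coe, Submodule.mem_span_singleton] at hv
      rw [hw1', SetLike.mem_coe, Submodule.mem_span_singleton] at hv'
      rw [hL] at hw1 hw1'
      rw [SetLike.coe_injective hw1, SetLike.coe_injective hw1']
      have hspan : ∀ (c : ℂ) (w : ℂ × ℂ), c • w = deriv α 0 →
          Submodule.span ℂ {w} = Submodule.span ℂ {deriv α 0} := by
        rintro c w hcw
        rw [← hcw]
        refine (Submodule.span_singleton_smul_eq (IsUnit.mk0 c fun hc => hα.2 ?_) w).symm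
        rw [← hcw, hc, zero_smul]
      obtain ⟨c, hc⟩ := hv
      obtain ⟨c', hc'⟩ := hv'
      rw [hspan c w hc, hspan c' w' hc']
    rw [hord hα.1, ← Finset.add_sum_erase Finset.univ _ (Finset.mem_univ j),
      ← Finset.add_sum_erase Finset.univ (fun j => ∑ i, mult (F j i)) (Finset.mem_univ j),
      Nat.add_sub_cancel_left, add_comm]
    push_cast
    congr 1
    · refine Finset.sum_congr rfl fun j' hj' => Finset.sum_congr rfl fun i' _ => ?_
      exact (hF j' i').order_of_notMem hα.1 (hother j' (Finset.ne_of_mem_erase hj') i')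
    · refine Finset.sum_congr rfl fun i' _ => ?_
      exact (hF j i').order_of_mem (hb j i') (hlt j i') hα (by rwa [hL, ← hL j i])
  have htot : ∑ j, ∑ i, mult (F j i) ∈ contactOrders (fun p => ∏ j, ∏ i, F j i p) := by
    obtain ⟨v, hv, hv'⟩ := exists_common_transversal (ι := (j : Fin k) × Fin (r j))
      (F := fun x => F x.1 x.2) fun x => hF x.1 x.2
    refine ⟨_, isImmersionGerm_smul_const hv, hA (isImmersionGerm_smul_const hv) fun j i => ?_⟩
    rw [deriv_smul_const]
    exact hv' ⟨j, i⟩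
  ext n
  constructor
  · rintro ⟨α, hα, hn⟩
    by_cases hv : ∀ j i, deriv α 0 ∉ tangentCone (F j i)
    · exact Or.inl (by exact_mod_cast hn.symm.trans (hA hα hv))
    · push Not at hv
      obtain ⟨j, i, hji⟩ := hv
      exact Or.inr ⟨j, by exact_mod_cast (hB hα j i hji).symm.trans hn⟩
  · rintro (rfl | ⟨j, rfl⟩)
    · exact htot
    -- An empty group contributes nothing, so its value is the total multiplicity again.
    · rcases Nat.eq_zero_or_pos (r j) with h0 | hpos
      · have : IsEmpty (Fin (r j)) := by rw [h0]; infer_instance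
        simpa using htot
      · obtain ⟨w, hw, hw1⟩ := (hF j ⟨0, hpos⟩).exists_tangentCone_eq
        refine ⟨_, isImmersionGerm_smul_const hw, hB (isImmersionGerm_smul_const hw) j ⟨0, hpos⟩ ?_⟩
        rw [deriv_smul_const, hw1]
        exact Submodule.mem_span_singleton_self w

end PlaneGerm

/-! ### Assembly of the theorem -/

theorem mainTheorem6 :
    -- (1) invariance under equivalence
    (∀ γ₁ γ₂ : ℂ → ℂ × ℂ, PlaneGerm.IsMapGerm γ₁ → PlaneGerm.IsMapGerm γ₂ →
      PlaneGerm.AEquiv γ₁ γ₂ →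
      PlaneGerm.paramContactOrders γ₁ = PlaneGerm.paramContactOrders γ₂) ∧
    (∀ f₁ f₂ : ℂ × ℂ → ℂ, PlaneGerm.IsMapGerm f₁ → PlaneGerm.IsMapGerm f₂ →
      PlaneGerm.KEquiv f₁ f₂ →
      PlaneGerm.contactOrders f₁ = PlaneGerm.contactOrders f₂) ∧
    -- (2) equations and parametrisations of the same curve
    (∀ (γ : ℂ → ℂ × ℂ) (f : ℂ × ℂ → ℂ), PlaneGerm.IsReducedGerm f →
      PlaneGerm.IsParametrisation γ f →
      PlaneGerm.paramContactOrders γ = PlaneGerm.contactOrders f) ∧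
    -- (3) irreducible singular germs
    (∀ f : ℂ × ℂ → ℂ, PlaneGerm.IsIrreducibleGerm f → fderiv ℂ f 0 = 0 →
      ∃ b : ℕ, PlaneGerm.puiseux f = (b : ℕ∞) ∧
        PlaneGerm.contactOrders f =
          {n : ℕ | ∃ k : ℕ, 1 ≤ k ∧ (k : ℚ) < (b : ℚ) / (PlaneGerm.mult f : ℚ) ∧
            n = k * PlaneGerm.mult f} ∪ {b} ∧
        (PlaneGerm.contactOrders f = {PlaneGerm.mult f, b} ↔ b < 2 * PlaneGerm.mult f) ∧
        ((PlaneGerm.contactOrders f).encard = 2 ↔ b < 2 * PlaneGerm.mult f) ∧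
        (b < 2 * PlaneGerm.mult f → ∀ α : ℂ → ℂ × ℂ, PlaneGerm.IsImmersionGerm α →
          (deriv α 0 ∉ PlaneGerm.tangentCone f →
            analyticOrderAt (f ∘ α) 0 = (PlaneGerm.mult f : ℕ∞)) ∧
          (deriv α 0 ∈ PlaneGerm.tangentCone f →
            analyticOrderAt (f ∘ α) 0 = (b : ℕ∞)))) ∧
    -- (4) transverse products
    (∀ f g : ℂ × ℂ → ℂ, PlaneGerm.IsIrreducibleGerm f → PlaneGerm.IsIrreducibleGerm g →
      PlaneGerm.tangentCone f ∩ PlaneGerm.tangentCone g = {0} →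
      PlaneGerm.contactOrders (fun p => f p * g p) =
        (fun n => PlaneGerm.mult f + n) '' PlaneGerm.contactOrders g ∪
          (fun n => PlaneGerm.mult g + n) '' PlaneGerm.contactOrders f) ∧
    -- (5) products of irreducible germs
    (∀ (k : ℕ) (F : Fin k → ℂ × ℂ → ℂ), (∀ i, PlaneGerm.IsIrreducibleGerm (F i)) →
      PlaneGerm.contactOrders (fun p => ∏ i, F i p) ⊆
        {n : ℕ | ∃ a : Fin k → ℕ, (∀ i, a i ∈ PlaneGerm.contactOrders (F i)) ∧ n = ∑ i, a i} ∧
      ((∀ i, fderiv ℂ (F i) 0 = 0) →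
        (PlaneGerm.contactOrders (fun p => ∏ i, F i p)).Finite)) ∧
    -- (6) unboundedness and smooth components
    (∀ f : ℂ × ℂ → ℂ, PlaneGerm.IsReducedGerm f →
      (¬ BddAbove (PlaneGerm.contactOrders f) ↔ PlaneGerm.HasSmoothComponent f)) ∧
    -- (7) several tangent directions, `puiseux < 2 * mult` for every branch
    (∀ (k : ℕ) (r : Fin k → ℕ) (F : (j : Fin k) → Fin (r j) → ℂ × ℂ → ℂ)
      (L : Fin k → Submodule ℂ (ℂ × ℂ)) (f : ℂ × ℂ → ℂ),
      PlaneGerm.IsReducedGerm f →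
      f =ᶠ[nhds 0] (fun p => ∏ j, ∏ i, F j i p) →
      (∀ j i, PlaneGerm.IsIrreducibleGerm (F j i)) →
      (∀ j i, PlaneGerm.tangentCone (F j i) = (L j : Set (ℂ × ℂ))) →
      Function.Injective L →
      (∀ j i, PlaneGerm.puiseux (F j i) < 2 * (PlaneGerm.mult (F j i) : ℕ∞)) →
      ∀ (M : Fin k → ℕ) (B : Fin k → ℕ) (Mtot : ℕ),
        (∀ j, M j = ∑ i, PlaneGerm.mult (F j i)) →
        (∀ j, B j = ∑ i, (PlaneGerm.puiseux (F j i)).toNat) →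
        Mtot = ∑ j, M j →
        PlaneGerm.contactOrders f =
          {Mtot} ∪ Set.range (fun j => Mtot - M j + B j)) := by
  refine ⟨fun γ₁ γ₂ h₁ h₂ h => h.paramContactOrders_eq h₁ h₂,
    fun f₁ f₂ h₁ _ h => h.contactOrders_eq h₁.1,
    fun γ f hf hγ => PlaneGerm.paramContactOrders_eq_contactOrders hf hγ, fun f hf hs => ?_,
    fun f g hf hg h => PlaneGerm.contactOrders_mul_of_transversal hf hg h,
    fun k F hF => ⟨PlaneGerm.contactOrders_prod_subset fun i => (hF i).isMapGerm.1,
      PlaneGerm.finite_contactOrders_prod hF⟩,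
    fun f hf => PlaneGerm.not_bddAbove_contactOrders_iff hf, ?_⟩
  · obtain ⟨b, hb⟩ := hf.exists_puiseux_eq hs
    have hm : (0 : ℚ) < PlaneGerm.mult f := by exact_mod_cast hf.one_le_mult
    have hmb := hf.mult_lt_puiseux
    rw [hb, Nat.cast_lt] at hmb
    refine ⟨b, hb, ?_, ⟨fun h => ?_, hf.contactOrders_eq_pair hb⟩, ⟨fun h => ?_, fun h => ?_⟩,
      fun h α hα => ⟨hf.order_of_notMem hα.1, hf.order_of_mem hb h hα⟩⟩
    · rw [hf.contactOrders_eq_of_puiseux_eq hb]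
      congr 1
      ext n
      refine exists_congr fun k => and_congr_right fun _ => ?_
      rw [lt_div_iff₀ hm, and_comm]
      refine and_congr_left fun h => ?_
      rw [h]
      norm_cast
    · by_contra hle
      obtain ⟨h1, h2, h3⟩ := hf.triple_subset_contactOrders hb (not_lt.mp hle)
      have h4 : 2 * PlaneGerm.mult f ∈ PlaneGerm.contactOrders f := h3 (by simp)
      rw [h] at h4
      rcases h4 with h4 | h4
      · omega
      · exact h2.ne h4
    · by_contra hle
      obtain ⟨h1, h2, h3⟩ := hf.triple_subset_contactOrders hb (not_lt.mp hle)
      have h4 := Set.encard_le_encard h3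
      rw [h, Set.encard_insert_of_notMem (by simp; omega), Set.encard_pair h2.ne] at h4
      exact absurd h4 (by decide)
    · rw [hf.contactOrders_eq_pair hb h, Set.encard_pair hmb.ne]
  · intro k r F L f _ hfF hF hL hinj hlt M B Mtot hM hB hMtot
    -- The bound by `2 * mult` makes the exponents finite, so `toNat` loses nothing.
    have hb : ∀ j i, PlaneGerm.puiseux (F j i) = ((PlaneGerm.puiseux (F j i)).toNat : ℕ∞) :=
      fun j i => (ENat.natCast_toNat (hlt j i).ne_top).symm
    rw [PlaneGerm.contactOrders_congr (PlaneGerm.analyticAt_prod fun j =>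
        PlaneGerm.analyticAt_prod fun i => (hF j i).isMapGerm.1) hfF,
      PlaneGerm.contactOrders_of_tangent_lines hF hL hinj hb fun j i => ?_]
    · simp only [hMtot, hM, hB]
    · have := hlt j i
      rw [hb j i] at this
      exact_mod_cast this
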